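/- Let $\mathbb{T}=\mathbb{R}/2\pi\mathbb{Z}$ and consider the Zakharov--Kuznetsov equation $$\partial_t u+\partial_{xxx}u+3\,\partial_x\partial_{yy}u=u\,\partial_x u\qquad\text{on }[0,T]\times\mathbb{T}^2. \tag{ZK}$$ Put $\varphi(k)=k_1^3+3k_1k_2^2$ for $k\in\mathbb{Z}^2$. For a dyadic number $N\in\{1,2,4,\dots\}$ let $P_N$ be the Fourier projection onto the frequencies $k\in\mathbb{Z}^2$ with $N\le|k|<2N$ if $N\ge2$, and $|k|<2$ if $N=1$. For an interval $I=[a,b)$, a $U^2(I)$-atom is a step function $\sum_{m=1}^{K}\phi_{m-1}\chi_{[t_{m-1},t_m)}$ with $a=t_0<\dots<t_K=b$, $\phi_m\in L^2(\mathbb{T}^2;\mathbb{C})$ and $\sum_m\|\phi_m\|_{L^2}^2=1$; let $$\|f\|_{U^2(I)}=\inf\Big\{\sum_n|\lambda_n| : f(t)=\sum_{n}\lambda_na_n(t)\ \text{for all } t\in I,\ a_n\ U^2(I)\text{-atoms}\Big\},\qquad \|u\|_{U^2_\varphi(I)}=\|e^{-it\varphi(\nabla/i)}u\|_{U^2(I)}.$$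 For $\sigma\in\mathbb{R}$ let $\|f\|_{H^\sigma}^2=\sum_{k}(1+|k|^2)^{\sigma}|\hat f(k)|^2$ and $$\|u\|_{E^\sigma(T)}^2=\sum_{N}N^{2\sigma}\sup_{t\in[0,T]}\|P_Nu(t)\|_{L^2}^2,\qquad \|u\|_{F^\sigma(T)}^2=\sum_{N}N^{2\sigma}\sup_{|I|=N^{-2}}\|P_Nu\|_{U^2_\varphi(I\cap[0,T))}^2,$$ where the last supremum is over the intervals $I=[a,a+N^{-2})$ that meet $[0,T)$. **Proposition.** Let $s>3/2$. There is a constant $C=C(s)$ such that the following holds for every $T\in(0,1]$. (a) If $u$ is a smooth real-valued solution to (ZK) on $[0,T]\times\mathbb{T}^2$, then $$\|u\|_{E^s(T)}^2\le C\big(\|u(0)\|_{H^s}^2+\|u\|_{F^s(T)}^3\big).$$ (b) If $u_1,u_2$ are smooth real-valued solutions to (ZK) on $[0,T]\times\mathbb{T}^2$ and $v=u_1-u_2$, then $$\|v\|_{E^0(T)}^2\le C\big(\|v(0)\|_{L^2}^2+\|v\|_{F^0(T)}^2(\|u_1\|_{F^s(T)}+\|u_2\|_{F^s(T)})\big)$$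 and $$\|v\|_{E^s(T)}^2\le C\big(\|v(0)\|_{H^s}^2+\|v\|_{F^s(T)}^3+\|v\|_{F^s(T)}^2\|u_2\|_{F^s(T)}+\|v\|_{F^0(T)}\|v\|_{F^s(T)}\|u_2\|_{F^{2s}(T)}\big).$$ -/

import Mathlib

open MeasureTheory Set
open scoped ENNReal NNReal ContDiff

noncomputable section

namespace ZK

instance fact_two_pi_pos : Fact (0 < 2 * Real.pi) := ⟨Real.two_pi_pos⟩

/-- The circle `ℝ / 2πℤ`. -/
abbrev Circle1 : Type := AddCircle (2 * Real.pi)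

/-- The two-dimensional torus `(ℝ / 2πℤ)²`. -/
abbrev Torus : Type := Circle1 × Circle1

/-- Normalized Lebesgue measure `dx dy / (2π)²` on the torus. -/
abbrev torusMeasure : Measure Torus :=
  (AddCircle.haarAddCircle : Measure Circle1).prod AddCircle.haarAddCircle

/-- The Hilbert space `L²(𝕋²; ℂ)`. -/
abbrev L2 : Type := Lp ℂ 2 torusMeasure

/-- The character `(x, y) ↦ exp (i (k₁ x + k₂ y))` as a continuous function on the torus. -/
def character (k : ℤ × ℤ) : C(Torus, ℂ) where
  toFun p := fourier k.1 p.1 * fourier k.2 p.2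
  continuous_toFun := by fun_prop

/-- The character with frequency `k` as an element of `L²(𝕋²)`. -/
def characterL2 (k : ℤ × ℤ) : L2 := ContinuousMap.toLp 2 torusMeasure ℂ (character k)

/-- The Fourier coefficient `(2π)⁻² ∫ f(x, y) exp (-i (k₁ x + k₂ y)) dx dy`. -/
def coeff (f : Torus → ℝ) (k : ℤ × ℤ) : ℂ :=
  ∫ p, starRingEnd ℂ (character k p) * (f p : ℂ) ∂torusMeasure

/-- The frequencies in the dyadic annulus of `N = 2 ^ j`:
`N ≤ |k| < 2 N` if `j ≥ 1`, and `|k| < 2` if `j = 0`, with `|k|` the Euclidean length. -/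
def annulus (j : ℕ) : Finset (ℤ × ℤ) :=
  (Finset.Icc (-2 ^ (j + 1)) (2 ^ (j + 1)) ×ˢ Finset.Icc (-2 ^ (j + 1)) (2 ^ (j + 1))).filter
    fun k => (j = 0 ∨ (2 ^ j) ^ 2 ≤ k.1 ^ 2 + k.2 ^ 2) ∧ k.1 ^ 2 + k.2 ^ 2 < (2 ^ (j + 1)) ^ 2

/-- The box in the definition of `annulus` does not cut off anything. -/
theorem mem_annulus (j : ℕ) (k : ℤ × ℤ) : k ∈ annulus j ↔
    (j = 0 ∨ (2 ^ j) ^ 2 ≤ k.1 ^ 2 + k.2 ^ 2) ∧ k.1 ^ 2 + k.2 ^ 2 < (2 ^ (j + 1)) ^ 2 := by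
  simp only [annulus, Finset.mem_filter, Finset.mem_product, Finset.mem_Icc,
    and_iff_right_iff_imp]
  rintro ⟨-, h⟩
  have hp : (0 : ℤ) ≤ 2 ^ (j + 1) := by positivity
  have h1 : k.1 ^ 2 ≤ (2 ^ (j + 1)) ^ 2 := by nlinarith [sq_nonneg k.2]
  have h2 : k.2 ^ 2 ≤ (2 ^ (j + 1)) ^ 2 := by nlinarith [sq_nonneg k.1]
  exact ⟨abs_le.mp (abs_le_of_sq_le_sq h1 hp), abs_le.mp (abs_le_of_sq_le_sq h2 hp)⟩

/-- The Littlewood-Paley projection `P_N f`, `N = 2 ^ j`, as an element of `L²(𝕋²)`. -/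
def proj (j : ℕ) (f : Torus → ℝ) : L2 := ∑ k ∈ annulus j, coeff f k • characterL2 k

/-- The dispersion relation of the linear equation `∂ₜ u + ∂ₓₓₓ u + 3 ∂ₓ ∂_yy u = 0`,
whose solutions are `exp (i t φ(∇ / i)) u(0)`. -/
def phase (k : ℤ × ℤ) : ℝ := (k.1 : ℝ) ^ 3 + 3 * (k.1 : ℝ) * (k.2 : ℝ) ^ 2

/-- `exp (-i t φ(∇ / i)) P_N f` with `N = 2 ^ j`. -/
def backProj (j : ℕ) (t : ℝ) (f : Torus → ℝ) : L2 :=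
  ∑ k ∈ annulus j, (Complex.exp (-(Complex.I * t * phase k)) * coeff f k) • characterL2 k

/-- `U²([a, b); H)`-atoms: step functions `∑ φ_m χ_[t_m, t_(m+1))` over a finite partition
`a = t_0 < ... < t_K = b`, with `∑ ‖φ_m‖² = 1`. -/
def IsU2Atom {H : Type*} [NormedAddCommGroup H] (a b : ℝ) (f : ℝ → H) : Prop :=
  ∃ (K : ℕ) (t : Fin (K + 1) → ℝ) (φ : Fin K → H),
    StrictMono t ∧ t 0 = a ∧ t (Fin.last K) = b ∧ ∑ m, ‖φ m‖ ^ 2 = 1 ∧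
    ∀ τ, f τ = ∑ m : Fin K, (Ico (t m.castSucc) (t m.succ)).indicator (fun _ => φ m) τ

/-- The norm of `U²([a, b); H)` for `a < b`, with value `∞` off the space. Only the values of `f`
on `[a, b)` matter. -/
def U2norm {H : Type*} [NormedAddCommGroup H] [NormedSpace ℂ H] (a b : ℝ) (f : ℝ → H) : ℝ≥0∞ :=
  ⨅ (c : ℕ → ℂ) (A : ℕ → ℝ → H) (_ : ∀ n, IsU2Atom a b (A n))
    (_ : ∀ τ ∈ Ico a b, HasSum (fun n => c n • A n τ) (f τ)), ∑' n, ‖c n‖ₑ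

/-- The Sobolev norm `(∑ (1 + |k|²)^s |f̂(k)|²)^(1/2)`. -/
def Hnorm (s : ℝ) (f : Torus → ℝ) : ℝ≥0∞ :=
  (∑' k : ℤ × ℤ, ENNReal.ofReal ((1 + (k.1 : ℝ) ^ 2 + (k.2 : ℝ) ^ 2) ^ s) * ‖coeff f k‖ₑ ^ 2)
    ^ (1 / 2 : ℝ)

/-- The norm of `L²(𝕋²)`. -/
def L2norm (f : Torus → ℝ) : ℝ≥0∞ := eLpNorm f 2 torusMeasure

/-- The energy norm `E^s(T)`:
`‖u‖² = ∑_N N^(2s) sup_{t ∈ [0, T]} ‖P_N u(t)‖²`, `N = 2 ^ j`. -/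
def Enorm (s T : ℝ) (u : ℝ → Torus → ℝ) : ℝ≥0∞ :=
  (∑' j : ℕ, ((2 : ℝ≥0∞) ^ j) ^ (2 * s) * ⨆ t ∈ Icc 0 T, ‖proj j (u t)‖ₑ ^ 2) ^ (1 / 2 : ℝ)

/-- The short-time norm `F^s(T)`:
`‖u‖² = ∑_N N^(2s) sup_{|I| = N⁻²} ‖P_N u‖²` with the norm of `U²_φ(I ∩ [0, T); L²)`, `N = 2 ^ j`.
The intervals `I = [a, a + N⁻²)` with `a ∈ [0, T)` are enough: if `a < 0`, then `I ∩ [0, T)` is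
empty or an initial part of `[0, N⁻²) ∩ [0, T)`. -/
def Fnorm (s T : ℝ) (u : ℝ → Torus → ℝ) : ℝ≥0∞ :=
  (∑' j : ℕ, ((2 : ℝ≥0∞) ^ j) ^ (2 * s) *
    ⨆ a ∈ Ico 0 T, U2norm a (min (a + ((2 : ℝ) ^ j)⁻¹ ^ 2) T) (fun t => backProj j t (u t)) ^ 2)
    ^ (1 / 2 : ℝ)

/-- Smooth real-valued solutions of `∂ₜ u + ∂ₓₓₓ u + 3 ∂ₓ ∂_yy u = u ∂ₓ u` on `[0, T] × 𝕋²`;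
the time derivative is one-sided at the end points. -/
structure IsSmoothSolution (T : ℝ) (u : ℝ → Torus → ℝ) : Prop where
  smooth : ContDiffOn ℝ ∞ (fun q : ℝ × ℝ × ℝ => u q.1 ((q.2.1 : Circle1), (q.2.2 : Circle1)))
    (Icc 0 T ×ˢ univ)
  equation : ∀ t ∈ Icc 0 T, ∀ x y : ℝ,
    derivWithin (fun τ : ℝ => u τ ((x : Circle1), (y : Circle1))) (Icc 0 T) t
      + iteratedDeriv 3 (fun x' : ℝ => u t ((x' : Circle1), (y : Circle1))) x
      + 3 * deriv (fun x' : ℝ =>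
          iteratedDeriv 2 (fun y' : ℝ => u t ((x' : Circle1), (y' : Circle1))) y) x
    = u t ((x : Circle1), (y : Circle1)) *
        deriv (fun x' : ℝ => u t ((x' : Circle1), (y : Circle1))) x

end ZK

end

noncomputable section

namespace ZK

/-! ### Almost orthogonality of exponentials on short intervals -/

theorem integral_exp_neg_abs_mul_exp {δ : ℝ} (hδ : 0 < δ) (x : ℝ) :
    Integrable (fun t : ℝ => (Real.exp (-|t| / δ) : ℂ) * Complex.exp (Complex.I * t * x)) ∧
    ∫ t : ℝ, (Real.exp (-|t| / δ) : ℂ) * Complex.exp (Complex.I * t * x)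
      = ((2 * δ / (1 + (δ * x) ^ 2) : ℝ) : ℂ) := by
  have h1 : (-(1 / δ) + Complex.I * x : ℂ).re < 0 := by
    simp [← Complex.ofReal_inv, hδ]
  have h2 : 0 < ((1 / δ) + Complex.I * x : ℂ).re := by
    simp [← Complex.ofReal_inv, hδ]
  have e1 : EqOn (fun t : ℝ => Complex.exp ((-(1 / δ) + Complex.I * x) * t))
      (fun t : ℝ => (Real.exp (-|t| / δ) : ℂ) * Complex.exp (Complex.I * t * x)) (Ioi 0) := by
    intro t ht
    simp only [abs_of_pos (show (0 : ℝ) < t from ht), Complex.ofReal_exp, ← Complex.exp_add]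
    congr 1
    push_cast
    ring
  have e2 : EqOn (fun t : ℝ => Complex.exp (((1 / δ) + Complex.I * x) * t))
      (fun t : ℝ => (Real.exp (-|t| / δ) : ℂ) * Complex.exp (Complex.I * t * x)) (Iic 0) := by
    intro t ht
    simp only [abs_of_nonpos (show t ≤ (0 : ℝ) from ht), Complex.ofReal_exp, ← Complex.exp_add]
    congr 1
    push_cast
    ring
  have i1 := (integrableOn_exp_mul_complex_Ioi h1 0).congr_fun e1 measurableSet_Ioi
  have i2 := (integrableOn_exp_mul_complex_Iic h2 0).congr_fun e2 measurableSet_Iic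
  have hi : Integrable
      (fun t : ℝ => (Real.exp (-|t| / δ) : ℂ) * Complex.exp (Complex.I * t * x)) := by
    rw [← integrableOn_univ, ← Iic_union_Ioi (a := (0 : ℝ))]
    exact i2.union i1
  refine ⟨hi, ?_⟩
  rw [← intervalIntegral.integral_Iic_add_Ioi i2 i1, ← setIntegral_congr_fun measurableSet_Iic e2,
    ← setIntegral_congr_fun measurableSet_Ioi e1, integral_exp_mul_complex_Iic h2,
    integral_exp_mul_complex_Ioi h1]
  have n1 : (-(1 / δ) + Complex.I * x : ℂ) ≠ 0 := fun h => by rw [h] at h1; simp at h1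
  have n2 : ((1 / δ) + Complex.I * x : ℂ) ≠ 0 := fun h => by rw [h] at h2; simp at h2
  have n3 : (1 + (δ * x) ^ 2 : ℂ) ≠ 0 := by
    have : (1 + (δ * x) ^ 2 : ℝ) ≠ 0 := by positivity
    exact_mod_cast this
  have n4 : (δ : ℂ) ≠ 0 := by exact_mod_cast hδ.ne'
  have n1' : (-1 + Complex.I * x * δ : ℂ) ≠ 0 := by
    intro h; apply n1; field_simp; linear_combination h
  have n2' : (1 + Complex.I * x * δ : ℂ) ≠ 0 := by
    intro h; apply n2; field_simp; linear_combination h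
  simp only [Complex.ofReal_zero, mul_zero, Complex.exp_zero]
  push_cast
  have a1 : (-(1 / δ) + Complex.I * x : ℂ) = (-1 + Complex.I * x * δ) / δ := by field_simp
  have a2 : ((1 / δ) + Complex.I * x : ℂ) = (1 + Complex.I * x * δ) / δ := by field_simp
  rw [a1, a2]
  have key : (-1 + Complex.I * x * δ : ℂ) * (1 + Complex.I * x * δ) = -(1 + (δ * x) ^ 2) := by
    linear_combination (x * δ) ^ 2 * Complex.I_sq
  have key2 : (1 + (δ * x) ^ 2 : ℂ) = -((-1 + Complex.I * x * δ) * (1 + Complex.I * x * δ)) := by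
    rw [key, neg_neg]
  rw [key2]
  field_simp
  ring

theorem lintegral_exp_sum_sq_le {ι : Type*} (P : Finset ι) (c : ι → ℂ) (x : ι → ℝ)
    {δ : ℝ} (hδ : 0 < δ) (α : ℝ) {L : ℝ}
    (hL : ∀ p ∈ P, ∑ p' ∈ P, 1 / (1 + (δ * (x p - x p')) ^ 2) ≤ L) :
    ∫⁻ t in Ico α (α + δ), ‖∑ p ∈ P, c p * Complex.exp (Complex.I * t * x p)‖ₑ ^ 2
      ≤ ENNReal.ofReal (2 * Real.exp 1 * δ * L * ∑ p ∈ P, ‖c p‖ ^ 2) := by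
  set d : ι → ℂ := fun p => c p * Complex.exp (Complex.I * α * x p) with hd
  have hdn : ∀ p, ‖d p‖ = ‖c p‖ := by
    intro p
    have : Complex.I * α * x p = ((α * x p : ℝ) : ℂ) * Complex.I := by push_cast; ring
    simp only [hd]
    rw [norm_mul, this, Complex.norm_exp_ofReal_mul_I, mul_one]
  set g : ℝ → ℂ := fun t => ∑ p ∈ P, d p * Complex.exp (Complex.I * t * x p) with hg
  set G : ℝ → ℝ := fun t => Real.exp 1 * (Real.exp (-|t| / δ) * ‖g t‖ ^ 2) with hG
  have shift : ∀ t : ℝ, ∑ p ∈ P, c p * Complex.exp (Complex.I * t * x p) = g (t - α) := by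
    intro t
    refine Finset.sum_congr rfl fun p _ => ?_
    simp only [hd]
    rw [mul_assoc (c p), ← Complex.exp_add]
    congr 2
    push_cast
    ring
  have hexp : ∀ t : ℝ, ((Real.exp (-|t| / δ) * ‖g t‖ ^ 2 : ℝ) : ℂ) =
      ∑ p ∈ P, ∑ p' ∈ P, d p * starRingEnd ℂ (d p') *
        ((Real.exp (-|t| / δ) : ℂ) * Complex.exp (Complex.I * t * (x p - x p' : ℝ))) := by
    intro t
    rw [Complex.ofReal_mul, Complex.ofReal_pow, ← Complex.mul_conj', hg]
    simp only [map_sum]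
    rw [Finset.sum_mul_sum, Finset.mul_sum]
    simp only [Finset.mul_sum, map_mul, ← Complex.exp_conj]
    refine Finset.sum_congr rfl fun p _ => Finset.sum_congr rfl fun p' _ => ?_
    have : Complex.exp (Complex.I * t * (x p - x p' : ℝ)) = Complex.exp (Complex.I * t * x p) *
        Complex.exp (starRingEnd ℂ Complex.I * starRingEnd ℂ (t : ℂ) * starRingEnd ℂ (x p' : ℂ)) := by
      rw [← Complex.exp_add]
      congr 1
      simp
      ring
    rw [this]
    ring
  have hint : Integrable (fun t : ℝ => ((Real.exp (-|t| / δ) * ‖g t‖ ^ 2 : ℝ) : ℂ)) := by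
    simp_rw [hexp]
    exact integrable_finsetSum _ fun p _ => integrable_finsetSum _ fun p' _ =>
      (integral_exp_neg_abs_mul_exp hδ _).1.const_mul _
  have hintR : Integrable (fun t : ℝ => Real.exp (-|t| / δ) * ‖g t‖ ^ 2) := by
    have := hint.re
    simpa only [RCLike.re_to_complex, Complex.ofReal_re] using this
  have hval : ∫ t : ℝ, Real.exp (-|t| / δ) * ‖g t‖ ^ 2 ≤ 2 * δ * L * ∑ p ∈ P, ‖c p‖ ^ 2 := by
    have h1 : ((∫ t : ℝ, Real.exp (-|t| / δ) * ‖g t‖ ^ 2 : ℝ) : ℂ) =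
        ∑ p ∈ P, ∑ p' ∈ P, d p * starRingEnd ℂ (d p') *
          ((2 * δ / (1 + (δ * (x p - x p')) ^ 2) : ℝ) : ℂ) := by
      rw [← integral_complex_ofReal]
      simp_rw [hexp]
      rw [integral_finsetSum _ fun p _ => integrable_finsetSum _ fun p' _ =>
        (integral_exp_neg_abs_mul_exp hδ _).1.const_mul _]
      refine Finset.sum_congr rfl fun p _ => ?_
      rw [integral_finsetSum _ fun p' _ => (integral_exp_neg_abs_mul_exp hδ _).1.const_mul _]
      refine Finset.sum_congr rfl fun p' _ => ?_
      rw [integral_const_mul, (integral_exp_neg_abs_mul_exp hδ _).2]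
    have h2 : ∫ t : ℝ, Real.exp (-|t| / δ) * ‖g t‖ ^ 2 ≤
        ∑ p ∈ P, ∑ p' ∈ P, ‖c p‖ * ‖c p'‖ * (2 * δ / (1 + (δ * (x p - x p')) ^ 2)) := by
      refine (le_abs_self _).trans ?_
      rw [← Real.norm_eq_abs, ← Complex.norm_real, h1]
      refine (norm_sum_le _ _).trans (Finset.sum_le_sum fun p _ => (norm_sum_le _ _).trans
        (Finset.sum_le_sum fun p' _ => ?_))
      rw [norm_mul, norm_mul, RCLike.norm_conj, hdn, hdn, Complex.norm_real, Real.norm_of_nonneg]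
      positivity
    refine h2.trans ?_
    have h3 : ∀ p ∈ P, ∀ p' ∈ P, ‖c p‖ * ‖c p'‖ * (2 * δ / (1 + (δ * (x p - x p')) ^ 2)) ≤
        δ * (‖c p‖ ^ 2 * (1 / (1 + (δ * (x p - x p')) ^ 2))) +
        δ * (‖c p'‖ ^ 2 * (1 / (1 + (δ * (x p' - x p)) ^ 2))) := by
      intro p _ p' _
      have e : (δ * (x p' - x p)) ^ 2 = (δ * (x p - x p')) ^ 2 := by ring
      rw [e]
      have hk : 0 ≤ 1 / (1 + (δ * (x p - x p')) ^ 2) := by positivity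
      have := two_mul_le_add_sq ‖c p‖ ‖c p'‖
      have h := mul_le_mul_of_nonneg_right this (mul_nonneg hδ.le hk)
      calc _ = 2 * ‖c p‖ * ‖c p'‖ * (δ * (1 / (1 + (δ * (x p - x p')) ^ 2))) := by ring
        _ ≤ _ := h
        _ = _ := by ring
    have h4 : ∑ p ∈ P, ∑ p' ∈ P, δ * (‖c p‖ ^ 2 * (1 / (1 + (δ * (x p - x p')) ^ 2))) ≤
        δ * L * ∑ p ∈ P, ‖c p‖ ^ 2 := by
      rw [Finset.mul_sum]
      refine Finset.sum_le_sum fun p hp => ?_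
      rw [← Finset.mul_sum, ← Finset.mul_sum]
      calc _ ≤ δ * (‖c p‖ ^ 2 * L) := by gcongr; exact hL p hp
        _ = _ := by ring
    calc _ ≤ _ := Finset.sum_le_sum fun p hp => Finset.sum_le_sum fun p' hp' => h3 p hp p' hp'
      _ = ∑ p ∈ P, ∑ p' ∈ P, δ * (‖c p‖ ^ 2 * (1 / (1 + (δ * (x p - x p')) ^ 2))) +
          ∑ p ∈ P, ∑ p' ∈ P, δ * (‖c p‖ ^ 2 * (1 / (1 + (δ * (x p - x p')) ^ 2))) := by
        simp_rw [Finset.sum_add_distrib]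
        congr 1
        rw [Finset.sum_comm]
      _ ≤ _ := by linarith
  calc ∫⁻ t in Ico α (α + δ), ‖∑ p ∈ P, c p * Complex.exp (Complex.I * t * x p)‖ₑ ^ 2
      ≤ ∫⁻ t in Ico α (α + δ), ENNReal.ofReal (G (t - α)) := by
        refine setLIntegral_mono' measurableSet_Ico fun t ht => ?_
        rw [shift, ← ofReal_norm, ← ENNReal.ofReal_pow (norm_nonneg _)]
        refine ENNReal.ofReal_le_ofReal ?_
        have h0 : 0 ≤ t - α := by linarith [ht.1]
        have h1 : (t - α) / δ ≤ 1 := by rw [div_le_one hδ]; linarith [ht.2]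
        have : 1 ≤ Real.exp 1 * Real.exp (-|t - α| / δ) := by
          rw [← Real.exp_add, abs_of_nonneg h0]
          apply Real.one_le_exp
          rw [neg_div]
          linarith
        calc ‖g (t - α)‖ ^ 2 = 1 * ‖g (t - α)‖ ^ 2 := by ring
          _ ≤ Real.exp 1 * Real.exp (-|t - α| / δ) * ‖g (t - α)‖ ^ 2 := by gcongr
          _ = _ := by simp only [hG]; ring
    _ ≤ ∫⁻ t, ENNReal.ofReal (G (t - α)) := setLIntegral_le_lintegral _ _
    _ = ∫⁻ t, ENNReal.ofReal (G t) := lintegral_sub_right_eq_self (fun t => ENNReal.ofReal (G t)) α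
    _ = ENNReal.ofReal (∫ t, G t) := by
        rw [ofReal_integral_eq_lintegral_ofReal (hintR.const_mul _)]
        exact Filter.Eventually.of_forall fun t => by positivity
    _ ≤ _ := by
        refine ENNReal.ofReal_le_ofReal ?_
        simp only [hG]
        rw [integral_const_mul]
        calc _ ≤ Real.exp 1 * (2 * δ * L * ∑ p ∈ P, ‖c p‖ ^ 2) := by gcongr
          _ = _ := by ring

/-! ### Counting -/

/-- The constant `∑ 8 / (1 + n²)`. -/
def lineConst : ℝ := ∑' n : ℤ, 8 / (1 + (n : ℝ) ^ 2)

theorem summable_eight_div : Summable fun n : ℤ => 8 / (1 + (n : ℝ) ^ 2) := by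
  have h : Summable fun n : ℤ => 8 * (1 / (n : ℝ) ^ 2) :=
    (Real.summable_one_div_int_pow.mpr (by norm_num)).mul_left 8
  refine h.of_norm_bounded_eventually ?_
  filter_upwards [(finite_singleton (0 : ℤ)).compl_mem_cofinite] with n hn
  have hn' : (n : ℝ) ≠ 0 := by exact_mod_cast hn
  rw [Real.norm_of_nonneg (by positivity), mul_one_div]
  gcongr
  linarith

theorem lineConst_nonneg : 0 ≤ lineConst := tsum_nonneg fun _ => by positivity

theorem sum_one_div_le_of_separated {ι : Type*} (P : Finset ι) (x : ι → ℝ) (y : ℝ)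
    (h : ∀ p ∈ P, ∀ p' ∈ P, p ≠ p' → 1 / 2 ≤ |x p - x p'|) :
    ∑ p ∈ P, 1 / (1 + (y - x p) ^ 2) ≤ lineConst := by
  classical
  set n : ι → ℤ := fun p => ⌊2 * (x p - y)⌋ with hn
  have hinj : Set.InjOn n P := by
    intro p hp p' hp' he
    by_contra hne
    have h1 := h p hp p' hp' hne
    have := Int.abs_sub_lt_one_of_floor_eq_floor he
    rw [show 2 * (x p - y) - 2 * (x p' - y) = 2 * (x p - x p') by ring, abs_mul] at this
    norm_num at this
    linarith
  calc ∑ p ∈ P, 1 / (1 + (y - x p) ^ 2) ≤ ∑ p ∈ P, 8 / (1 + (n p : ℝ) ^ 2) := by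
        refine Finset.sum_le_sum fun p _ => ?_
        rw [div_le_div_iff₀ (by positivity) (by positivity)]
        have h1 := Int.floor_le (2 * (x p - y))
        have h2 := Int.lt_floor_add_one (2 * (x p - y))
        simp only [hn]
        set m : ℝ := (⌊2 * (x p - y)⌋ : ℝ)
        nlinarith [sq_nonneg (2 * (x p - y) + (2 * (x p - y) - m)),
          mul_nonneg (sub_nonneg.mpr h1) (sub_nonneg.mpr h2.le)]
    _ = ∑ m ∈ P.image n, 8 / (1 + (m : ℝ) ^ 2) := by
        rw [Finset.sum_image fun p hp p' hp' he => hinj hp hp' he]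
    _ ≤ lineConst := summable_eight_div.sum_le_tsum _ fun _ _ => by positivity

/-- Two frequencies whose group velocities differ by at least a multiple of `4 ^ J` in one of the
diagonal directions. -/
def Transversal (J : ℕ) (p q : ℤ × ℤ) : Prop :=
  3 * ((2 : ℝ) ^ J) ^ 2 ≤ 8 * |((p.1 : ℝ) + p.2) ^ 2 - ((q.1 : ℝ) + q.2) ^ 2| ∨
  3 * ((2 : ℝ) ^ J) ^ 2 ≤ 8 * |((p.1 : ℝ) - p.2) ^ 2 - ((q.1 : ℝ) - q.2) ^ 2|

theorem sum_line_le (ε : ℤ) (hε : ε ^ 2 = 1) {N : ℝ} (hN : 0 < N) (k : ℤ × ℤ) (b : ℤ)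
    (P : Finset ((ℤ × ℤ) × (ℤ × ℤ))) (hk : ∀ w ∈ P, w.1 + w.2 = k)
    (hb : ∀ w ∈ P, w.1.1 - ε * w.1.2 = b)
    (ht : ∀ w ∈ P, 3 * N ^ 2 ≤ 8 * |((w.1.1 : ℝ) + ε * w.1.2) ^ 2 - (w.2.1 + ε * w.2.2) ^ 2|)
    (y : ℝ) :
    ∑ w ∈ P, 1 / (1 + ((N ^ 2)⁻¹ * (y - (phase w.1 + phase w.2))) ^ 2) ≤ 2 * lineConst := by
  classical
  have hε' : (ε : ℝ) ^ 2 = 1 := by exact_mod_cast hε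
  set A : ℝ := k.1 + ε * k.2 with hA
  have hsub : ∀ w ∈ P, (w.2.1 : ℝ) = k.1 - w.1.1 ∧ (w.2.2 : ℝ) = k.2 - w.1.2 := by
    intro w hw
    rw [← hk w hw]
    constructor <;> simp
  have key : ∀ Q ⊆ P, (∀ w ∈ Q, ∀ w' ∈ Q,
      0 ≤ (2 * ((w.1.1 : ℝ) + ε * w.1.2) - A) * (2 * ((w'.1.1 : ℝ) + ε * w'.1.2) - A)) →
      ∑ w ∈ Q, 1 / (1 + ((N ^ 2)⁻¹ * (y - (phase w.1 + phase w.2))) ^ 2) ≤ lineConst := by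
    intro Q hQ hs
    have := sum_one_div_le_of_separated Q
      (fun w => (N ^ 2)⁻¹ * (phase w.1 + phase w.2)) ((N ^ 2)⁻¹ * y) ?_
    · simpa only [← mul_sub] using this
    intro w hw w' hw' hne
    have hsgn := hs w hw w' hw'
    obtain ⟨e1, e2⟩ := hsub w (hQ hw)
    obtain ⟨e1', e2'⟩ := hsub w' (hQ hw')
    have t1 := ht w (hQ hw)
    have t2 := ht w' (hQ hw')
    have b1 := hb w (hQ hw)
    have b2 := hb w' (hQ hw')
    set a : ℝ := w.1.1 + ε * w.1.2 with ha
    set a' : ℝ := w'.1.1 + ε * w'.1.2 with ha'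
    have hbb : (w.1.1 : ℝ) - ε * w.1.2 = w'.1.1 - ε * w'.1.2 := by exact_mod_cast b1.trans b2.symm
    have hint : 1 ≤ |a - a'| := by
      have hz : w.1.1 + ε * w.1.2 - (w'.1.1 + ε * w'.1.2) ≠ 0 := by
        intro h0
        have h1 : w.1.1 = w'.1.1 := by lia
        have h2 : ε * w.1.2 = ε * w'.1.2 := by lia
        have h3 : w.1.2 = w'.1.2 := mul_left_cancel₀ (by rintro rfl; simp at hε) h2
        have h4 : w.1 = w'.1 := Prod.ext h1 h3
        have h5 : w.2 = w'.2 := by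
          have := (hk w (hQ hw)).trans (hk w' (hQ hw')).symm
          rw [h4] at this
          exact add_left_cancel this
        exact hne (Prod.ext h4 h5)
      have := Int.one_le_abs hz
      rw [ha, ha']
      exact_mod_cast this
    have f1 : a ^ 2 - (w.2.1 + ε * w.2.2 : ℝ) ^ 2 = A * (2 * a - A) := by
      rw [e1, e2, hA, ha]; ring
    have f2 : a' ^ 2 - (w'.2.1 + ε * w'.2.2 : ℝ) ^ 2 = A * (2 * a' - A) := by
      rw [e1', e2', hA, ha']; ring
    rw [f1, abs_mul] at t1
    rw [f2, abs_mul] at t2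
    have hph : (phase w.1 + phase w.2) - (phase w'.1 + phase w'.2)
        = 3 / 2 * (A * ((a - a') * (a + a' - A))) := by
      have hphase : ∀ z : ℤ × ℤ, phase z
          = (((z.1 : ℝ) + ε * z.2) ^ 3 + ((z.1 : ℝ) - ε * z.2) ^ 3) / 2 := by
        intro z
        rw [phase]
        linear_combination (-3 * (z.1 : ℝ) * z.2 ^ 2) * hε'
      rw [hphase, hphase, hphase, hphase, e1, e2, e1', e2']
      have g1 : (w.1.1 : ℝ) = a - ε * w.1.2 := by rw [ha]; ring
      have c1 : (k.1 - w.1.1 : ℝ) + ε * (k.2 - w.1.2) = A - a := by rw [hA, ha]; ring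
      have c2 : (k.1 - w'.1.1 : ℝ) + ε * (k.2 - w'.1.2) = A - a' := by rw [hA, ha']; ring
      have c3 : (k.1 - w.1.1 : ℝ) - ε * (k.2 - w.1.2) = (k.1 - w'.1.1) - ε * (k.2 - w'.1.2) := by
        linear_combination -hbb
      rw [c1, c2, c3, hbb, ← ha, ← ha']
      ring
    have habs : |2 * a - A| + |2 * a' - A| = 2 * |a + a' - A| := by
      have : |2 * a - A| + |2 * a' - A| = |(2 * a - A) + (2 * a' - A)| := by
        rcases mul_nonneg_iff.mp hsgn with ⟨h1, h2⟩ | ⟨h1, h2⟩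
        · rw [abs_of_nonneg h1, abs_of_nonneg h2, abs_of_nonneg (by linarith)]
        · rw [abs_of_nonpos h1, abs_of_nonpos h2, abs_of_nonpos (by linarith)]; ring
      rw [this, show (2 * a - A) + (2 * a' - A) = 2 * (a + a' - A) by ring, abs_mul]
      norm_num
    rw [← mul_sub, hph, abs_mul, abs_mul, abs_mul, abs_mul, abs_of_pos (by positivity : 0 < (N ^ 2)⁻¹),
      abs_of_pos (by norm_num : (0 : ℝ) < 3 / 2), inv_mul_eq_div, le_div_iff₀ (by positivity)]
    have h5 : 3 * N ^ 2 ≤ 8 * (|A| * |a + a' - A|) := by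
      have : |A| * (|2 * a - A| + |2 * a' - A|) = |A| * (2 * |a + a' - A|) := by rw [habs]
      rw [mul_add] at this
      linarith
    have h6 : |A| * |a + a' - A| ≤ |A| * (|a - a'| * |a + a' - A|) := by
      gcongr
      exact le_mul_of_one_le_left (abs_nonneg _) hint
    linarith [sq_nonneg N]
  rw [← Finset.sum_filter_add_sum_filter_not P
    (fun w => A ≤ 2 * ((w.1.1 : ℝ) + ε * w.1.2)), two_mul]
  refine add_le_add (key _ (Finset.filter_subset _ _) ?_) (key _ (Finset.filter_subset _ _) ?_)
  · intro w hw w' hw'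
    rw [Finset.mem_filter] at hw hw'
    exact mul_nonneg (by linarith [hw.2]) (by linarith [hw'.2])
  · intro w hw w' hw'
    rw [Finset.mem_filter] at hw hw'
    exact mul_nonneg_of_nonpos_of_nonpos (by linarith [hw.2]) (by linarith [hw'.2])

theorem abs_le_of_mem_annulus {j : ℕ} {k : ℤ × ℤ} (hk : k ∈ annulus j) :
    |k.1| ≤ 2 * 2 ^ j ∧ |k.2| ≤ 2 * 2 ^ j := by
  have h := Finset.mem_product.mp (Finset.mem_filter.mp hk).1
  rw [Finset.mem_Icc, Finset.mem_Icc, ← abs_le, ← abs_le, pow_succ'] at h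
  exact h

theorem sum_lines_le (ε : ℤ) (hε : ε = 1 ∨ ε = -1) {N : ℝ} (hN : 0 < N) (k : ℤ × ℤ) (j : ℕ)
    (P : Finset ((ℤ × ℤ) × (ℤ × ℤ))) (hk : ∀ w ∈ P, w.1 + w.2 = k)
    (hb : ∀ w ∈ P, w.1 ∈ annulus j)
    (ht : ∀ w ∈ P, 3 * N ^ 2 ≤ 8 * |((w.1.1 : ℝ) + ε * w.1.2) ^ 2 - (w.2.1 + ε * w.2.2) ^ 2|)
    (y : ℝ) :
    ∑ w ∈ P, 1 / (1 + ((N ^ 2)⁻¹ * (y - (phase w.1 + phase w.2))) ^ 2)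
      ≤ 18 * lineConst * 2 ^ j := by
  classical
  have hε2 : ε ^ 2 = 1 := by rcases hε with rfl | rfl <;> norm_num
  have hmaps : ∀ w ∈ P, w.1.1 - ε * w.1.2 ∈ Finset.Icc (-(4 * 2 ^ j) : ℤ) (4 * 2 ^ j) := by
    intro w hw
    obtain ⟨h1, h2⟩ := abs_le_of_mem_annulus (hb w hw)
    rw [abs_le] at h1 h2
    rw [Finset.mem_Icc]
    rcases hε with rfl | rfl <;> constructor <;> linarith
  rw [← Finset.sum_fiberwise_of_maps_to hmaps]
  calc _ ≤ ∑ b ∈ Finset.Icc (-(4 * 2 ^ j) : ℤ) (4 * 2 ^ j), 2 * lineConst := by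
        refine Finset.sum_le_sum fun b _ => sum_line_le ε hε2 hN k b _ ?_ ?_ ?_ y
        · exact fun w hw => hk w (Finset.mem_filter.mp hw).1
        · exact fun w hw => (Finset.mem_filter.mp hw).2
        · exact fun w hw => ht w (Finset.mem_filter.mp hw).1
    _ = (8 * 2 ^ j + 1) * (2 * lineConst) := by
        rw [Finset.sum_const, Int.card_Icc, nsmul_eq_mul]
        congr 1
        have : ((4 * 2 ^ j + 1 - -(4 * 2 ^ j) : ℤ).toNat : ℤ) = 8 * 2 ^ j + 1 := by
          have h0 : (0 : ℤ) < 2 ^ j := by positivity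
          rw [Int.toNat_of_nonneg (by linarith)]; ring
        exact_mod_cast this
    _ ≤ _ := by
        have h1 : (1 : ℝ) ≤ 2 ^ j := one_le_pow₀ (by norm_num)
        nlinarith [lineConst_nonneg]

/-- The constant in the counting estimate. -/
def countConst : ℝ := 36 * lineConst + 25

theorem countConst_pos : 0 < countConst := by
  have := lineConst_nonneg
  unfold countConst
  positivity

theorem sum_transversal_le (J j : ℕ) (k : ℤ × ℤ) (P : Finset ((ℤ × ℤ) × (ℤ × ℤ)))
    (hk : ∀ w ∈ P, w.1 + w.2 = k) (hb : ∀ w ∈ P, w.1 ∈ annulus j)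
    (ht : j = 0 ∧ J = 0 ∨ ∀ w ∈ P, Transversal J w.1 w.2) (y : ℝ) :
    ∑ w ∈ P, 1 / (1 + ((((2 : ℝ) ^ J) ^ 2)⁻¹ * (y - (phase w.1 + phase w.2))) ^ 2)
      ≤ countConst * 2 ^ j := by
  classical
  rcases ht with ⟨rfl, rfl⟩ | ht
  · have hcard : P.card ≤ 25 := by
      have hinj : Set.InjOn Prod.fst (P : Set ((ℤ × ℤ) × (ℤ × ℤ))) := by
        intro w hw w' hw' h
        have := (hk w hw).trans (hk w' hw').symm
        rw [h] at this
        exact Prod.ext h (add_left_cancel this)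
      have h1 := Finset.card_le_card_of_injOn Prod.fst (fun w hw => hb w hw) hinj
      refine h1.trans ((Finset.card_filter_le _ _).trans ?_)
      simp
    calc _ ≤ ∑ w ∈ P, (1 : ℝ) := by
          refine Finset.sum_le_sum fun w _ => ?_
          rw [div_le_one (by positivity)]
          nlinarith [sq_nonneg ((((2 : ℝ) ^ 0) ^ 2)⁻¹ * (y - (phase w.1 + phase w.2)))]
      _ = (P.card : ℝ) := by simp
      _ ≤ 25 := by exact_mod_cast hcard
      _ ≤ _ := by have := lineConst_nonneg; simp only [countConst]; linarith
  · have hN : (0 : ℝ) < 2 ^ J := by positivity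
    rw [← Finset.sum_filter_add_sum_filter_not P
      (fun w => 3 * ((2 : ℝ) ^ J) ^ 2
        ≤ 8 * |((w.1.1 : ℝ) + w.1.2) ^ 2 - ((w.2.1 : ℝ) + w.2.2) ^ 2|)]
    have h1 := sum_lines_le 1 (Or.inl rfl) hN k j (P.filter fun w => 3 * ((2 : ℝ) ^ J) ^ 2
        ≤ 8 * |((w.1.1 : ℝ) + w.1.2) ^ 2 - ((w.2.1 : ℝ) + w.2.2) ^ 2|)
        (fun w hw => hk w (Finset.mem_filter.mp hw).1)
        (fun w hw => hb w (Finset.mem_filter.mp hw).1)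
        (fun w hw => by simpa using (Finset.mem_filter.mp hw).2) y
    have h2 := sum_lines_le (-1) (Or.inr rfl) hN k j (P.filter fun w => ¬ 3 * ((2 : ℝ) ^ J) ^ 2
        ≤ 8 * |((w.1.1 : ℝ) + w.1.2) ^ 2 - ((w.2.1 : ℝ) + w.2.2) ^ 2|)
        (fun w hw => hk w (Finset.mem_filter.mp hw).1)
        (fun w hw => hb w (Finset.mem_filter.mp hw).1)
        (fun w hw => by
          have h := Finset.mem_filter.mp hw
          simpa [← sub_eq_add_neg] using (ht w h.1).resolve_left h.2) y
    refine (add_le_add h1 h2).trans ?_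
    have : (0 : ℝ) < 2 ^ j := by positivity
    simp only [countConst]
    nlinarith

theorem gap_of_add_eq_zero {x y z N : ℝ} (h : x + y + z = 0) (hN : N ^ 2 ≤ y ^ 2) :
    3 * N ^ 2 ≤ 8 * |x ^ 2 - y ^ 2| ∨ 3 * N ^ 2 ≤ 8 * |x ^ 2 - z ^ 2| := by
  by_contra! hc
  obtain ⟨h1, h2⟩ := hc
  have hx : x = -(y + z) := by linarith
  set w := y + 2 * z with hw
  have hz : z = (w - y) / 2 := by rw [hw]; ring
  have e1 : x ^ 2 - y ^ 2 = (w ^ 2 + 2 * (w * y) - 3 * y ^ 2) / 4 := by rw [hx, hz]; ring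
  have e2 : x ^ 2 - z ^ 2 = w * y := by rw [hx, hz]; ring
  rw [e1] at h1
  rw [e2] at h2
  have h3 : |w * y| < 3 / 8 * y ^ 2 := by linarith
  have hy : 0 < y ^ 2 := by linarith [abs_nonneg (w * y)]
  have h4 : w ^ 2 ≤ 9 / 64 * y ^ 2 := by
    have : |w * y| ^ 2 ≤ (3 / 8 * y ^ 2) ^ 2 := by gcongr
    rw [sq_abs, mul_pow] at this
    have h5 : w ^ 2 * y ^ 2 ≤ 9 / 64 * y ^ 2 * y ^ 2 := by linarith
    exact le_of_mul_le_mul_right h5 hy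
  have h6 := (abs_lt.mp h3).2
  have h7 := neg_abs_le ((w ^ 2 + 2 * (w * y) - 3 * y ^ 2) / 4)
  linarith

theorem transversal_or {J : ℕ} (hJ : J ≠ 0) {p q r : ℤ × ℤ} (hq : q ∈ annulus J ∨ r ∈ annulus J)
    (h : p + q + r = 0) : Transversal J p q ∨ Transversal J p r := by
  have key : ∀ q r : ℤ × ℤ, q ∈ annulus J → p + q + r = 0 →
      Transversal J p q ∨ Transversal J p r := by
    intro q r hq h
    have hq' := ((mem_annulus J q).mp hq).1.resolve_left hJ
    have hq2 : ((2 : ℝ) ^ J) ^ 2 ≤ (q.1 : ℝ) ^ 2 + (q.2 : ℝ) ^ 2 := by exact_mod_cast hq'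
    have h1 : (p.1 : ℝ) + q.1 + r.1 = 0 := by
      have := congrArg Prod.fst h
      simp only [Prod.fst_add, Prod.fst_zero] at this
      exact_mod_cast this
    have h2 : (p.2 : ℝ) + q.2 + r.2 = 0 := by
      have := congrArg Prod.snd h
      simp only [Prod.snd_add, Prod.snd_zero] at this
      exact_mod_cast this
    rcases le_or_gt (((2 : ℝ) ^ J) ^ 2) (((q.1 : ℝ) + q.2) ^ 2) with hc | hc
    · rcases gap_of_add_eq_zero (x := (p.1 : ℝ) + p.2) (z := (r.1 : ℝ) + r.2)
        (by linarith) hc with h3 | h3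
      · exact Or.inl (Or.inl h3)
      · exact Or.inr (Or.inl h3)
    · have hc' : ((2 : ℝ) ^ J) ^ 2 ≤ ((q.1 : ℝ) - q.2) ^ 2 := by nlinarith
      rcases gap_of_add_eq_zero (x := (p.1 : ℝ) - p.2) (z := (r.1 : ℝ) - r.2)
        (by linarith) hc' with h3 | h3
      · exact Or.inl (Or.inr h3)
      · exact Or.inr (Or.inr h3)
  rcases hq with hq | hr
  · exact key q r hq h
  · exact (key r q hr (by rw [← h]; abel)).symm

/-! ### Fourier coefficients of square integrable functions -/

theorem inner_characterL2 (k l : ℤ × ℤ) :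
    inner ℂ (characterL2 k) (characterL2 l) = if k = l then 1 else 0 := by
  have h1 : ∀ m n : ℤ, ∫ x : Circle1, fourier n x * starRingEnd ℂ (fourier m x)
      ∂AddCircle.haarAddCircle = if m = n then 1 else 0 := by
    intro m n
    have := (orthonormal_iff_ite.mp (orthonormal_fourier (T := 2 * Real.pi))) m n
    rw [← this, fourierLp, fourierLp, ContinuousMap.inner_toLp]
  rw [characterL2, characterL2, ContinuousMap.inner_toLp]
  have : ∀ p : Torus, character l p * starRingEnd ℂ (character k p) =
      (fourier l.1 p.1 * starRingEnd ℂ (fourier k.1 p.1)) *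
        (fourier l.2 p.2 * starRingEnd ℂ (fourier k.2 p.2)) := by
    intro p
    simp only [character, ContinuousMap.coe_mk, map_mul]
    ring
  simp_rw [this]
  rw [integral_prod_mul (fun x : Circle1 => fourier l.1 x * starRingEnd ℂ (fourier k.1 x))
    (fun x : Circle1 => fourier l.2 x * starRingEnd ℂ (fourier k.2 x)), h1, h1]
  by_cases h1 : k.1 = l.1 <;> by_cases h2 : k.2 = l.2 <;> simp [h1, h2, Prod.ext_iff]

theorem orthonormal_characterL2 : Orthonormal ℂ characterL2 :=
  orthonormal_iff_ite.mpr inner_characterL2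

/-- The `k`-th Fourier coefficient of the free evolution at time `t` of `f ∈ L²`. -/
def evolve (t : ℝ) (f : L2) (k : ℤ × ℤ) : ℂ :=
  Complex.exp (Complex.I * t * phase k) * inner ℂ (characterL2 k) f

theorem norm_exp_phase (t : ℝ) (k : ℤ × ℤ) : ‖Complex.exp (Complex.I * t * phase k)‖ = 1 := by
  have : Complex.I * t * phase k = ((t * phase k : ℝ) : ℂ) * Complex.I := by push_cast; ring
  rw [this, Complex.norm_exp_ofReal_mul_I]

theorem norm_evolve (t : ℝ) (f : L2) (k : ℤ × ℤ) :
    ‖evolve t f k‖ = ‖inner ℂ (characterL2 k) f‖ := by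
  rw [evolve, norm_mul, norm_exp_phase, one_mul]

theorem sum_norm_evolve_sq_le (A : Finset (ℤ × ℤ)) (t : ℝ) (f : L2) :
    ∑ k ∈ A, ‖evolve t f k‖ ^ 2 ≤ ‖f‖ ^ 2 := by
  simp_rw [norm_evolve]
  exact orthonormal_characterL2.sum_inner_products_le f

theorem inner_sum_smul_characterL2 (A : Finset (ℤ × ℤ)) (c : ℤ × ℤ → ℂ) {k : ℤ × ℤ} (hk : k ∈ A) :
    inner ℂ (characterL2 k) (∑ l ∈ A, c l • characterL2 l) = c k := by
  rw [inner_sum]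
  simp_rw [inner_smul_right, inner_characterL2, mul_ite, mul_one, mul_zero]
  rw [Finset.sum_ite_eq, if_pos hk]

theorem evolve_backProj {j : ℕ} {k : ℤ × ℤ} (hk : k ∈ annulus j) (t : ℝ) (f : Torus → ℝ) :
    evolve t (backProj j t f) k = coeff f k := by
  rw [evolve, backProj, inner_sum_smul_characterL2 _ _ hk, ← mul_assoc, ← Complex.exp_add,
    add_neg_cancel, Complex.exp_zero, one_mul]

/-! ### Sums over resonant triples -/

/-- The bilinear form `∑_{p + q + r = 0} M(p, q, r) f(p) g(q)` with values in functions of `r`. -/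
def bilSum (A₁ A₂ : Finset (ℤ × ℤ)) (M : ℤ × ℤ → ℤ × ℤ → ℤ × ℤ → ℂ) (f g : ℤ × ℤ → ℂ)
    (r : ℤ × ℤ) : ℂ :=
  ∑ p ∈ A₁, ∑ q ∈ A₂, if p + q + r = 0 then M p q r * f p * g q else 0

/-- The trilinear form `∑_{p + q + r = 0} M(p, q, r) f(p) g(q) h(r)`. -/
def triSum (A₁ A₂ A₃ : Finset (ℤ × ℤ)) (M : ℤ × ℤ → ℤ × ℤ → ℤ × ℤ → ℂ) (f g h : ℤ × ℤ → ℂ) : ℂ :=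
  ∑ p ∈ A₁, ∑ q ∈ A₂, ∑ r ∈ A₃, if p + q + r = 0 then M p q r * f p * g q * h r else 0

theorem triSum_eq_sum_bilSum (A₁ A₂ A₃ : Finset (ℤ × ℤ)) (M : ℤ × ℤ → ℤ × ℤ → ℤ × ℤ → ℂ)
    (f g h : ℤ × ℤ → ℂ) : triSum A₁ A₂ A₃ M f g h = ∑ r ∈ A₃, bilSum A₁ A₂ M f g r * h r := by
  simp only [triSum, bilSum, Finset.sum_mul, ite_mul, zero_mul]
  conv_rhs => rw [Finset.sum_comm]
  refine Finset.sum_congr rfl fun p _ => ?_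
  rw [Finset.sum_comm]

theorem triSum_swap_right (A₁ A₂ A₃ : Finset (ℤ × ℤ)) (M : ℤ × ℤ → ℤ × ℤ → ℤ × ℤ → ℂ)
    (f g h : ℤ × ℤ → ℂ) :
    triSum A₁ A₂ A₃ M f g h = triSum A₁ A₃ A₂ (fun p q r => M p r q) f h g := by
  simp only [triSum]
  refine Finset.sum_congr rfl fun p _ => ?_
  rw [Finset.sum_comm]
  refine Finset.sum_congr rfl fun q _ => Finset.sum_congr rfl fun r _ => ?_
  rw [add_right_comm]
  congr 1
  ring

theorem triSum_swap_left (A₁ A₂ A₃ : Finset (ℤ × ℤ)) (M : ℤ × ℤ → ℤ × ℤ → ℤ × ℤ → ℂ)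
    (f g h : ℤ × ℤ → ℂ) :
    triSum A₁ A₂ A₃ M f g h = triSum A₂ A₁ A₃ (fun p q r => M q p r) g f h := by
  simp only [triSum]
  rw [Finset.sum_comm]
  refine Finset.sum_congr rfl fun p _ => Finset.sum_congr rfl fun q _ =>
    Finset.sum_congr rfl fun r _ => ?_
  rw [add_comm q p]
  congr 1
  ring

/-- The squared constant in the short-time bilinear estimate. -/
def bilConst (J j : ℕ) (μ : ℝ) : ℝ :=
  2 * Real.exp 1 * (((2 : ℝ) ^ J) ^ 2)⁻¹ * (countConst * 2 ^ j) * μ ^ 2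

theorem bilConst_nonneg (J j : ℕ) (μ : ℝ) : 0 ≤ bilConst J j μ := by
  have := countConst_pos
  unfold bilConst
  positivity

theorem lintegral_bilSum_free_le (J j : ℕ) (A₂ A₃ : Finset (ℤ × ℤ))
    (M : ℤ × ℤ → ℤ × ℤ → ℤ × ℤ → ℂ) {μ : ℝ}
    (hM : ∀ p ∈ annulus j, ∀ q ∈ A₂, ∀ r ∈ A₃, p + q + r = 0 → ‖M p q r‖ ≤ μ)
    (hT : j = 0 ∧ J = 0 ∨ ∀ p ∈ annulus j, ∀ q ∈ A₂, ∀ r ∈ A₃, p + q + r = 0 → M p q r ≠ 0 →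
      Transversal J p q)
    (f g : L2) (α : ℝ) :
    ∫⁻ t in Ico α (α + (((2 : ℝ) ^ J) ^ 2)⁻¹),
      ∑ r ∈ A₃, ‖bilSum (annulus j) A₂ M (evolve t f) (evolve t g) r‖ₑ ^ 2
      ≤ ENNReal.ofReal (bilConst J j μ * (‖f‖ ^ 2 * ‖g‖ ^ 2)) := by
  classical
  set δ := (((2 : ℝ) ^ J) ^ 2)⁻¹ with hδ
  have hδ0 : 0 < δ := by positivity
  set fc : ℤ × ℤ → ℂ := fun k => inner ℂ (characterL2 k) f with hfc
  set gc : ℤ × ℤ → ℂ := fun k => inner ℂ (characterL2 k) g with hgc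
  set P : ℤ × ℤ → Finset ((ℤ × ℤ) × (ℤ × ℤ)) := fun r =>
    (annulus j ×ˢ A₂).filter fun w => w.1 + w.2 + r = 0 ∧ M w.1 w.2 r ≠ 0 with hP
  have hform : ∀ (t : ℝ) (r : ℤ × ℤ), bilSum (annulus j) A₂ M (evolve t f) (evolve t g) r =
      ∑ w ∈ P r, (M w.1 w.2 r * fc w.1 * gc w.2) *
        Complex.exp (Complex.I * t * (phase w.1 + phase w.2 : ℝ)) := by
    intro t r
    rw [bilSum, ← Finset.sum_product', hP, Finset.sum_filter]
    refine Finset.sum_congr rfl fun w _ => ?_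
    by_cases h1 : w.1 + w.2 + r = 0
    · by_cases h2 : M w.1 w.2 r = 0
      · simp [h2]
      · rw [if_pos h1, if_pos ⟨h1, h2⟩, evolve, evolve, Complex.ofReal_add, mul_add,
          Complex.exp_add]
        ring
    · rw [if_neg h1, if_neg fun h => h1 h.1]
  have hmem : ∀ r, ∀ w ∈ P r, w.1 ∈ annulus j ∧ w.2 ∈ A₂ ∧ w.1 + w.2 + r = 0 ∧
      M w.1 w.2 r ≠ 0 := by
    intro r w hw
    simp only [hP, Finset.mem_filter, Finset.mem_product] at hw
    tauto
  have hone : ∀ r ∈ A₃, ∫⁻ t in Ico α (α + δ),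
      ‖bilSum (annulus j) A₂ M (evolve t f) (evolve t g) r‖ₑ ^ 2 ≤
      ENNReal.ofReal (2 * Real.exp 1 * δ * (countConst * 2 ^ j) *
        ∑ w ∈ P r, ‖M w.1 w.2 r * fc w.1 * gc w.2‖ ^ 2) := by
    intro r hr
    simp_rw [hform]
    refine lintegral_exp_sum_sq_le (P r) (fun w => M w.1 w.2 r * fc w.1 * gc w.2)
      (fun w => phase w.1 + phase w.2) hδ0 α fun w _ => ?_
    refine sum_transversal_le J j (-r) (P r) ?_ ?_ ?_ _
    · intro w hw
      exact eq_neg_of_add_eq_zero_left (hmem r w hw).2.2.1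
    · exact fun w hw => (hmem r w hw).1
    · refine hT.imp id fun h w hw => ?_
      obtain ⟨h1, h2, h3, h4⟩ := hmem r w hw
      exact h _ h1 _ h2 _ hr h3 h4
  have hmeas : ∀ r ∈ A₃, Measurable fun t : ℝ =>
      ‖bilSum (annulus j) A₂ M (evolve t f) (evolve t g) r‖ₑ ^ 2 := by
    intro r _
    simp_rw [hform]
    exact (Continuous.measurable (by fun_prop)).enorm.pow_const _
  rw [lintegral_finsetSum _ hmeas]
  refine (Finset.sum_le_sum hone).trans ?_
  rw [← ENNReal.ofReal_sum_of_nonneg]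
  swap
  · intro r _
    have := countConst_pos
    positivity
  refine ENNReal.ofReal_le_ofReal ?_
  rw [← Finset.mul_sum]
  have hsum : ∑ r ∈ A₃, ∑ w ∈ P r, ‖M w.1 w.2 r * fc w.1 * gc w.2‖ ^ 2 ≤
      μ ^ 2 * (‖f‖ ^ 2 * ‖g‖ ^ 2) := by
    calc ∑ r ∈ A₃, ∑ w ∈ P r, ‖M w.1 w.2 r * fc w.1 * gc w.2‖ ^ 2
        ≤ ∑ r ∈ A₃, ∑ w ∈ annulus j ×ˢ A₂,
          if r = -(w.1 + w.2) then μ ^ 2 * (‖fc w.1‖ ^ 2 * ‖gc w.2‖ ^ 2) else 0 := by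
          refine Finset.sum_le_sum fun r hr => ?_
          rw [hP, Finset.sum_filter]
          refine Finset.sum_le_sum fun w hw => ?_
          rw [Finset.mem_product] at hw
          by_cases h1 : w.1 + w.2 + r = 0
          · rw [if_pos (eq_neg_of_add_eq_zero_right h1)]
            split_ifs
            · rw [norm_mul, norm_mul, mul_pow, mul_pow, mul_assoc]
              gcongr
              exact hM _ hw.1 _ hw.2 _ hr h1
            · positivity
          · rw [if_neg fun h => h1 h.1]
            split_ifs <;> positivity
      _ = ∑ w ∈ annulus j ×ˢ A₂, ∑ r ∈ A₃,
          if r = -(w.1 + w.2) then μ ^ 2 * (‖fc w.1‖ ^ 2 * ‖gc w.2‖ ^ 2) else 0 :=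
          Finset.sum_comm
      _ ≤ ∑ w ∈ annulus j ×ˢ A₂, μ ^ 2 * (‖fc w.1‖ ^ 2 * ‖gc w.2‖ ^ 2) := by
          refine Finset.sum_le_sum fun w _ => ?_
          rw [Finset.sum_ite_eq']
          split_ifs
          · exact le_rfl
          · positivity
      _ = μ ^ 2 * ((∑ p ∈ annulus j, ‖fc p‖ ^ 2) * ∑ q ∈ A₂, ‖gc q‖ ^ 2) := by
          rw [← Finset.mul_sum, Finset.sum_mul_sum, Finset.sum_product]
      _ ≤ _ := by
          gcongr
          · exact orthonormal_characterL2.sum_inner_products_le f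
          · exact orthonormal_characterL2.sum_inner_products_le g
  have hc := countConst_pos
  calc _ ≤ 2 * Real.exp 1 * δ * (countConst * 2 ^ j) * (μ ^ 2 * (‖f‖ ^ 2 * ‖g‖ ^ 2)) := by gcongr
    _ = _ := by rw [bilConst]; ring

/-! ### Atoms -/

theorem sum_indicator_Ico_eq {H : Type*} [AddCommMonoid H] {K : ℕ} {t : Fin (K + 1) → ℝ}
    (ht : StrictMono t) (φ : Fin K → H) (τ : ℝ) :
    (∑ m : Fin K, (Ico (t m.castSucc) (t m.succ)).indicator (fun _ => φ m) τ = 0) ∨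
    ∃ m, ∑ m : Fin K, (Ico (t m.castSucc) (t m.succ)).indicator (fun _ => φ m) τ = φ m := by
  by_cases h : ∃ m : Fin K, τ ∈ Ico (t m.castSucc) (t m.succ)
  · obtain ⟨m, hm⟩ := h
    refine Or.inr ⟨m, ?_⟩
    rw [Finset.sum_eq_single m, indicator_of_mem hm]
    · intro m' _ hne
      refine indicator_of_notMem (fun hm' => ?_) _
      rcases lt_or_gt_of_ne hne with h | h
      · have : t m'.succ ≤ t m.castSucc := ht.monotone (by
          rw [Fin.le_def]; simpa using h)
        linarith [hm.1, hm'.2]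
      · have : t m.succ ≤ t m'.castSucc := ht.monotone (by
          rw [Fin.le_def]; simpa using h)
        linarith [hm.2, hm'.1]
    · simp
  · push Not at h
    exact Or.inl (Finset.sum_eq_zero fun m _ => indicator_of_notMem (h m) _)

theorem IsU2Atom.norm_le_one {H : Type*} [NormedAddCommGroup H] {a b : ℝ} {f : ℝ → H}
    (hf : IsU2Atom a b f) (τ : ℝ) : ‖f τ‖ ≤ 1 := by
  obtain ⟨K, t, φ, ht, -, -, hφ, hval⟩ := hf
  rw [hval]
  rcases sum_indicator_Ico_eq ht φ τ with h | ⟨m, h⟩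
  · simp [h]
  · rw [h]
    have h1 : ‖φ m‖ ^ 2 ≤ ∑ m, ‖φ m‖ ^ 2 :=
      Finset.single_le_sum (f := fun m => ‖φ m‖ ^ 2) (fun _ _ => sq_nonneg _) (Finset.mem_univ m)
    rw [hφ] at h1
    exact (sq_le_one_iff₀ (norm_nonneg _)).mp h1

theorem IsU2Atom.measurable_evolve {a b : ℝ} {f : ℝ → L2} (hf : IsU2Atom a b f) (k : ℤ × ℤ) :
    Measurable fun t : ℝ => evolve t (f t) k := by
  obtain ⟨K, t, φ, ht, -, -, hφ, hval⟩ := hf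
  have : ∀ τ, inner ℂ (characterL2 k) (f τ) = ∑ m : Fin K,
      (Ico (t m.castSucc) (t m.succ)).indicator (fun _ => inner ℂ (characterL2 k) (φ m)) τ := by
    intro τ
    rw [hval, inner_sum]
    refine Finset.sum_congr rfl fun m _ => ?_
    by_cases h : τ ∈ Ico (t m.castSucc) (t m.succ)
    · simp only [indicator_of_mem h]
    · simp only [indicator_of_notMem h, inner_zero_right]
  simp only [evolve, this]
  refine Measurable.mul (Continuous.measurable (by fun_prop)) ?_
  exact Finset.measurable_sum _ fun m _ => measurable_const.indicator measurableSet_Ico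

theorem measurable_bilSum_atom {a b a' b' : ℝ} {f g : ℝ → L2} (hf : IsU2Atom a b f)
    (hg : IsU2Atom a' b' g) (A₁ A₂ : Finset (ℤ × ℤ)) (M : ℤ × ℤ → ℤ × ℤ → ℤ × ℤ → ℂ) (r : ℤ × ℤ) :
    Measurable fun t : ℝ => bilSum A₁ A₂ M (evolve t (f t)) (evolve t (g t)) r := by
  unfold bilSum
  refine Finset.measurable_sum _ fun p _ => Finset.measurable_sum _ fun q _ => ?_
  split_ifs
  · exact ((hf.measurable_evolve p).const_mul _).mul (hg.measurable_evolve q)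
  · exact measurable_const

theorem evolve_zero (t : ℝ) : evolve t 0 = 0 := by
  ext k
  simp [evolve]

theorem bilSum_zero_left (A₁ A₂ : Finset (ℤ × ℤ)) (M : ℤ × ℤ → ℤ × ℤ → ℤ × ℤ → ℂ)
    (g : ℤ × ℤ → ℂ) (r : ℤ × ℤ) : bilSum A₁ A₂ M 0 g r = 0 := by
  simp [bilSum]

theorem bilSum_zero_right (A₁ A₂ : Finset (ℤ × ℤ)) (M : ℤ × ℤ → ℤ × ℤ → ℤ × ℤ → ℂ)
    (f : ℤ × ℤ → ℂ) (r : ℤ × ℤ) : bilSum A₁ A₂ M f 0 r = 0 := by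
  simp [bilSum]

theorem lintegral_bilSum_atom_sq_le (J j : ℕ) (A₂ A₃ : Finset (ℤ × ℤ))
    (M : ℤ × ℤ → ℤ × ℤ → ℤ × ℤ → ℂ) {μ : ℝ}
    (hM : ∀ p ∈ annulus j, ∀ q ∈ A₂, ∀ r ∈ A₃, p + q + r = 0 → ‖M p q r‖ ≤ μ)
    (hT : j = 0 ∧ J = 0 ∨ ∀ p ∈ annulus j, ∀ q ∈ A₂, ∀ r ∈ A₃, p + q + r = 0 → M p q r ≠ 0 →
      Transversal J p q)
    {a b a' b' : ℝ} {f g : ℝ → L2} (hf : IsU2Atom a b f) (hg : IsU2Atom a' b' g) (α : ℝ) :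
    ∫⁻ t in Ico α (α + (((2 : ℝ) ^ J) ^ 2)⁻¹),
      ∑ r ∈ A₃, ‖bilSum (annulus j) A₂ M (evolve t (f t)) (evolve t (g t)) r‖ₑ ^ 2
      ≤ ENNReal.ofReal (bilConst J j μ) := by
  obtain ⟨K, t, φ, ht, -, -, hφ, hval⟩ := hf
  obtain ⟨K', t', ψ, ht', -, -, hψ, hval'⟩ := hg
  set G : L2 → L2 → ℝ → ℝ≥0∞ := fun x y τ =>
    ∑ r ∈ A₃, ‖bilSum (annulus j) A₂ M (evolve τ x) (evolve τ y) r‖ₑ ^ 2 with hG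
  have hmeas : ∀ x y, Measurable (G x y) := by
    intro x y
    refine Finset.measurable_sum _ fun r _ => Measurable.pow_const (Measurable.enorm ?_) _
    refine Continuous.measurable ?_
    unfold bilSum evolve
    refine continuous_finsetSum _ fun p _ => continuous_finsetSum _ fun q _ => ?_
    split_ifs <;> fun_prop
  have hpt : ∀ τ, G (f τ) (g τ) τ ≤ ∑ m, ∑ n, G (φ m) (ψ n) τ := by
    intro τ
    rcases sum_indicator_Ico_eq ht φ τ with h | ⟨m, h⟩
    · rw [← hval] at h
      simp [hG, h, evolve_zero, bilSum_zero_left]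
    rcases sum_indicator_Ico_eq ht' ψ τ with h' | ⟨n, h'⟩
    · rw [← hval'] at h'
      simp [hG, h', evolve_zero, bilSum_zero_right]
    rw [← hval] at h
    rw [← hval'] at h'
    rw [h, h']
    exact (Finset.single_le_sum (f := fun n => G (φ m) (ψ n) τ) (fun _ _ => zero_le)
      (Finset.mem_univ n)).trans (Finset.single_le_sum (f := fun m => ∑ n, G (φ m) (ψ n) τ)
        (fun _ _ => zero_le) (Finset.mem_univ m))
  calc _ ≤ ∫⁻ τ in Ico α (α + (((2 : ℝ) ^ J) ^ 2)⁻¹), ∑ m, ∑ n, G (φ m) (ψ n) τ :=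
        lintegral_mono hpt
    _ = ∑ m, ∑ n, ∫⁻ τ in Ico α (α + (((2 : ℝ) ^ J) ^ 2)⁻¹), G (φ m) (ψ n) τ := by
        rw [lintegral_finsetSum _ fun m _ => Finset.measurable_sum _ fun n _ => hmeas _ _]
        exact Finset.sum_congr rfl fun m _ => lintegral_finsetSum _ fun n _ => hmeas _ _
    _ ≤ ∑ m, ∑ n, ENNReal.ofReal (bilConst J j μ * (‖φ m‖ ^ 2 * ‖ψ n‖ ^ 2)) :=
        Finset.sum_le_sum fun m _ => Finset.sum_le_sum fun n _ =>
          lintegral_bilSum_free_le J j A₂ A₃ M hM hT _ _ α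
    _ = ENNReal.ofReal (bilConst J j μ) := by
        have hnn := bilConst_nonneg J j μ
        simp_rw [← ENNReal.ofReal_sum_of_nonneg (s := (Finset.univ : Finset (Fin K')))
          (fun n _ => mul_nonneg hnn (mul_nonneg (sq_nonneg _) (sq_nonneg _)))]
        rw [← ENNReal.ofReal_sum_of_nonneg fun m _ => Finset.sum_nonneg fun n _ =>
          mul_nonneg hnn (mul_nonneg (sq_nonneg _) (sq_nonneg _))]
        simp_rw [← Finset.mul_sum, hψ, mul_one, hφ, mul_one]

/-- The `ℓ²` norm over `A₃` of the bilinear form. -/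
def bilNorm (A₁ A₂ A₃ : Finset (ℤ × ℤ)) (M : ℤ × ℤ → ℤ × ℤ → ℤ × ℤ → ℂ) (f g : ℤ × ℤ → ℂ) :
    ℝ≥0∞ := (∑ r ∈ A₃, ‖bilSum A₁ A₂ M f g r‖ₑ ^ 2) ^ (1 / 2 : ℝ)

theorem lintegral_bilNorm_atom_le (J j : ℕ) (A₂ A₃ : Finset (ℤ × ℤ))
    (M : ℤ × ℤ → ℤ × ℤ → ℤ × ℤ → ℂ) {μ : ℝ}
    (hM : ∀ p ∈ annulus j, ∀ q ∈ A₂, ∀ r ∈ A₃, p + q + r = 0 → ‖M p q r‖ ≤ μ)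
    (hT : j = 0 ∧ J = 0 ∨ ∀ p ∈ annulus j, ∀ q ∈ A₂, ∀ r ∈ A₃, p + q + r = 0 → M p q r ≠ 0 →
      Transversal J p q)
    {a b a' b' : ℝ} {f g : ℝ → L2} (hf : IsU2Atom a b f) (hg : IsU2Atom a' b' g) (α : ℝ) :
    ∫⁻ t in Ico α (α + (((2 : ℝ) ^ J) ^ 2)⁻¹),
      bilNorm (annulus j) A₂ A₃ M (evolve t (f t)) (evolve t (g t))
      ≤ ENNReal.ofReal (bilConst J j μ * (((2 : ℝ) ^ J) ^ 2)⁻¹) ^ (1 / 2 : ℝ) := by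
  set δ := (((2 : ℝ) ^ J) ^ 2)⁻¹ with hδ
  have hδ0 : 0 < δ := by positivity
  have hmeas : Measurable fun t => bilNorm (annulus j) A₂ A₃ M (evolve t (f t)) (evolve t (g t)) := by
    refine Measurable.pow_const (Finset.measurable_sum _ fun r _ => Measurable.pow_const
      (Measurable.enorm ?_) _) _
    exact measurable_bilSum_atom hf hg _ _ _ _
  have h := ENNReal.lintegral_mul_le_Lp_mul_Lq (volume.restrict (Ico α (α + δ)))
    Real.HolderConjugate.two_two hmeas.aemeasurable (measurable_const (a := (1 : ℝ≥0∞))).aemeasurable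
  have e : ∀ x : ℝ≥0∞, (x ^ (1 / 2 : ℝ)) ^ (2 : ℝ) = x := by
    intro x
    rw [← ENNReal.rpow_mul]
    norm_num
  simp only [Pi.mul_apply, mul_one, ENNReal.one_rpow, lintegral_const, one_mul,
    Measure.restrict_apply_univ, Real.volume_Ico, add_sub_cancel_left] at h
  refine h.trans ?_
  simp only [bilNorm, e]
  rw [ENNReal.ofReal_mul (bilConst_nonneg _ _ _), ENNReal.mul_rpow_of_nonneg _ _ (by norm_num)]
  gcongr
  exact lintegral_bilSum_atom_sq_le J j A₂ A₃ M hM hT hf hg α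

/-! ### The norm of `U²` -/

theorem exists_atoms_of_U2norm_lt {H : Type*} [NormedAddCommGroup H] [NormedSpace ℂ H] {a b : ℝ}
    {f : ℝ → H} {x : ℝ≥0∞} (h : U2norm a b f < x) :
    ∃ (c : ℕ → ℂ) (A : ℕ → ℝ → H), (∀ n, IsU2Atom a b (A n)) ∧
      (∀ τ ∈ Ico a b, HasSum (fun n => c n • A n τ) (f τ)) ∧ ∑' n, ‖c n‖ₑ < x := by
  simp only [U2norm, iInf_lt_iff] at h
  obtain ⟨c, A, hA, hs, hx⟩ := h
  exact ⟨c, A, hA, hs, hx⟩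

theorem le_mul_U2norm {H : Type*} [NormedAddCommGroup H] [NormedSpace ℂ H] {a b : ℝ} {f : ℝ → H}
    (hf : U2norm a b f ≠ ⊤) {B X : ℝ≥0∞} (hX : X ≠ ⊤)
    (h : ∀ (c : ℕ → ℂ) (A : ℕ → ℝ → H), (∀ n, IsU2Atom a b (A n)) →
      (∀ τ ∈ Ico a b, HasSum (fun n => c n • A n τ) (f τ)) → ∑' n, ‖c n‖ₑ ≠ ⊤ →
      B ≤ X * ∑' n, ‖c n‖ₑ) : B ≤ X * U2norm a b f := by
  rcases eq_or_ne X 0 with rfl | hX0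
  · obtain ⟨c, A, hA, hs, hx⟩ := exists_atoms_of_U2norm_lt hf.lt_top
    simpa using h c A hA hs hx.ne
  by_contra! hlt
  rw [mul_comm, ← ENNReal.lt_div_iff_mul_lt (Or.inl hX0) (Or.inl hX)] at hlt
  obtain ⟨c, A, hA, hs, hx⟩ := exists_atoms_of_U2norm_lt hlt
  have h1 := h c A hA hs (ne_top_of_lt hx)
  rw [ENNReal.lt_div_iff_mul_lt (Or.inl hX0) (Or.inl hX), mul_comm] at hx
  exact absurd h1 (not_le.mpr hx)

theorem enorm_le_tsum_enorm_of_hasSum {ι E : Type*} [NormedAddCommGroup E] {f : ι → E} {x : E}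
    (h : HasSum f x) : ‖x‖ₑ ≤ ∑' i, ‖f i‖ₑ := by
  rw [← h.tsum_eq]
  exact enorm_tsum_le_tsum_enorm

theorem enorm_le_U2norm {H : Type*} [NormedAddCommGroup H] [NormedSpace ℂ H] {a b : ℝ} (f : ℝ → H)
    {τ : ℝ} (hτ : τ ∈ Ico a b) : ‖f τ‖ₑ ≤ U2norm a b f := by
  simp only [U2norm, le_iInf_iff]
  intro c A hA hs
  refine (enorm_le_tsum_enorm_of_hasSum (hs τ hτ)).trans (ENNReal.tsum_le_tsum fun n => ?_)
  rw [enorm_smul]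
  refine mul_le_of_le_one_right' ?_
  rw [← ofReal_norm]
  exact ENNReal.ofReal_le_one.mpr ((hA n).norm_le_one τ)

/-! ### The short-time trilinear estimate -/

theorem hasSum_evolve {ι : Type*} {c : ι → ℂ} {A : ι → L2} {f : L2}
    (h : HasSum (fun n => c n • A n) f) (t : ℝ) (k : ℤ × ℤ) :
    HasSum (fun n => c n * evolve t (A n) k) (evolve t f k) := by
  have h1 : HasSum (fun n => inner ℂ (characterL2 k) (c n • A n)) (inner ℂ (characterL2 k) f) :=
    h.mapL (innerSL ℂ (characterL2 k))
  simp only [inner_smul_right] at h1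
  simpa only [evolve, mul_left_comm (c _)] using
    h1.mul_left (Complex.exp (Complex.I * t * phase k))

theorem hasSum_triSum_left {ι : Type*} {c : ι → ℂ} {F : ι → ℤ × ℤ → ℂ} {f : ℤ × ℤ → ℂ}
    (hF : ∀ k, HasSum (fun n => c n * F n k) (f k)) (A₁ A₂ A₃ : Finset (ℤ × ℤ))
    (M : ℤ × ℤ → ℤ × ℤ → ℤ × ℤ → ℂ) (g h : ℤ × ℤ → ℂ) :
    HasSum (fun n => c n * triSum A₁ A₂ A₃ M (F n) g h) (triSum A₁ A₂ A₃ M f g h) := by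
  simp only [triSum, Finset.mul_sum]
  refine hasSum_sum fun p _ => hasSum_sum fun q _ => hasSum_sum fun r _ => ?_
  split_ifs
  · have := ((hF p).mul_left (M p q r)).mul_right (g q * h r)
    simp only [← mul_assoc] at this
    simpa only [mul_comm (M p q r) (c _), ← mul_assoc] using this
  · simp

theorem enorm_triSum_le_of_hasSum {c d : ℕ → ℂ} {F G : ℕ → ℤ × ℤ → ℂ} {f g : ℤ × ℤ → ℂ}
    (hF : ∀ k, HasSum (fun n => c n * F n k) (f k)) (hG : ∀ k, HasSum (fun n => d n * G n k) (g k))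
    (A₁ A₂ A₃ : Finset (ℤ × ℤ)) (M : ℤ × ℤ → ℤ × ℤ → ℤ × ℤ → ℂ) (h : ℤ × ℤ → ℂ) :
    ‖triSum A₁ A₂ A₃ M f g h‖ₑ ≤
      ∑' n, ‖c n‖ₑ * ∑' m, ‖d m‖ₑ * ‖triSum A₁ A₂ A₃ M (F n) (G m) h‖ₑ := by
  refine (enorm_le_tsum_enorm_of_hasSum (hasSum_triSum_left hF A₁ A₂ A₃ M g h)).trans
    (ENNReal.tsum_le_tsum fun n => ?_)
  rw [enorm_mul]
  gcongr
  rw [triSum_swap_left]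
  refine (enorm_le_tsum_enorm_of_hasSum (hasSum_triSum_left hG _ _ _ _ _ _)).trans
    (ENNReal.tsum_le_tsum fun m => ?_)
  rw [enorm_mul, triSum_swap_left A₁]

theorem enorm_triSum_le_bilNorm_mul (A₁ A₂ A₃ : Finset (ℤ × ℤ))
    (M : ℤ × ℤ → ℤ × ℤ → ℤ × ℤ → ℂ) (f g h : ℤ × ℤ → ℂ) :
    ‖triSum A₁ A₂ A₃ M f g h‖ₑ ≤
      bilNorm A₁ A₂ A₃ M f g * (∑ r ∈ A₃, ‖h r‖ₑ ^ 2) ^ (1 / 2 : ℝ) := by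
  rw [triSum_eq_sum_bilSum]
  refine (enorm_sum_le _ _).trans ?_
  have := ENNReal.inner_le_Lp_mul_Lq A₃ (fun r => ‖bilSum A₁ A₂ M f g r‖ₑ) (fun r => ‖h r‖ₑ)
    Real.HolderConjugate.two_two
  simpa only [ENNReal.rpow_two, bilNorm, enorm_mul] using this

theorem lintegral_triSum_transversal_le (J j : ℕ) (A₂ A₃ : Finset (ℤ × ℤ))
    (M : ℤ × ℤ → ℤ × ℤ → ℤ × ℤ → ℂ) {μ : ℝ}
    (hM : ∀ p ∈ annulus j, ∀ q ∈ A₂, ∀ r ∈ A₃, p + q + r = 0 → ‖M p q r‖ ≤ μ)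
    (hT : j = 0 ∧ J = 0 ∨ ∀ p ∈ annulus j, ∀ q ∈ A₂, ∀ r ∈ A₃, p + q + r = 0 → M p q r ≠ 0 →
      Transversal J p q)
    {S : Set ℝ} (hS : MeasurableSet S) {α a₁ b₁ a₂ b₂ : ℝ}
    (hS₀ : S ⊆ Ico α (α + (((2 : ℝ) ^ J) ^ 2)⁻¹)) (hS₁ : S ⊆ Ico a₁ b₁) (hS₂ : S ⊆ Ico a₂ b₂)
    {f₁ f₂ : ℝ → L2} (h₁ : U2norm a₁ b₁ f₁ ≠ ⊤) (h₂ : U2norm a₂ b₂ f₂ ≠ ⊤)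
    {h : ℝ → ℤ × ℤ → ℂ} {H : ℝ≥0∞} (hH : H ≠ ⊤)
    (hh : ∀ t ∈ S, (∑ r ∈ A₃, ‖h t r‖ₑ ^ 2) ^ (1 / 2 : ℝ) ≤ H) :
    ∫⁻ t in S, ‖triSum (annulus j) A₂ A₃ M (evolve t (f₁ t)) (evolve t (f₂ t)) (h t)‖ₑ ≤
      ENNReal.ofReal (bilConst J j μ * (((2 : ℝ) ^ J) ^ 2)⁻¹) ^ (1 / 2 : ℝ) * H *
        U2norm a₁ b₁ f₁ * U2norm a₂ b₂ f₂ := by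
  set D := ENNReal.ofReal (bilConst J j μ * (((2 : ℝ) ^ J) ^ 2)⁻¹) ^ (1 / 2 : ℝ) with hD
  have hDtop : D ≠ ⊤ := ENNReal.rpow_ne_top_of_nonneg (by norm_num) ENNReal.ofReal_ne_top
  refine le_mul_U2norm h₂ (ENNReal.mul_ne_top (ENNReal.mul_ne_top hDtop hH) h₁) ?_
  intro d B hB hsB hd
  rw [mul_right_comm]
  refine le_mul_U2norm h₁ (ENNReal.mul_ne_top (ENNReal.mul_ne_top hDtop hH) hd) ?_
  intro c A hA hsA _
  have hmeas : ∀ n m, Measurable fun t =>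
      bilNorm (annulus j) A₂ A₃ M (evolve t (A n t)) (evolve t (B m t)) := by
    intro n m
    refine Measurable.pow_const (Finset.measurable_sum _ fun r _ => Measurable.pow_const
      (Measurable.enorm ?_) _) _
    exact measurable_bilSum_atom (hA n) (hB m) _ _ _ _
  calc ∫⁻ t in S, ‖triSum (annulus j) A₂ A₃ M (evolve t (f₁ t)) (evolve t (f₂ t)) (h t)‖ₑ
      ≤ ∫⁻ t in S, ∑' n, ‖c n‖ₑ * ∑' m, ‖d m‖ₑ *
          (bilNorm (annulus j) A₂ A₃ M (evolve t (A n t)) (evolve t (B m t)) * H) := by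
        refine setLIntegral_mono' hS fun t ht => ?_
        refine (enorm_triSum_le_of_hasSum (fun k => hasSum_evolve (hsA t (hS₁ ht)) t k)
          (fun k => hasSum_evolve (hsB t (hS₂ ht)) t k) _ _ _ _ _).trans ?_
        gcongr with n m
        exact (enorm_triSum_le_bilNorm_mul _ _ _ _ _ _ _).trans (by gcongr; exact hh t ht)
    _ ≤ ∫⁻ t in Ico α (α + (((2 : ℝ) ^ J) ^ 2)⁻¹), ∑' n, ‖c n‖ₑ * ∑' m, ‖d m‖ₑ *
          (bilNorm (annulus j) A₂ A₃ M (evolve t (A n t)) (evolve t (B m t)) * H) :=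
        lintegral_mono_set hS₀
    _ = ∑' n, ‖c n‖ₑ * ∑' m, ‖d m‖ₑ * ((∫⁻ t in Ico α (α + (((2 : ℝ) ^ J) ^ 2)⁻¹),
          bilNorm (annulus j) A₂ A₃ M (evolve t (A n t)) (evolve t (B m t))) * H) := by
        rw [lintegral_tsum fun n => (Measurable.const_mul (Measurable.tsum fun m =>
          ((hmeas n m).mul_const H).const_mul _) _).aemeasurable]
        congr 1
        ext n
        rw [lintegral_const_mul _ (Measurable.tsum fun m =>
          ((hmeas n m).mul_const H).const_mul _),
          lintegral_tsum fun m => (((hmeas n m).mul_const H).const_mul _).aemeasurable]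
        congr 2
        ext m
        rw [lintegral_const_mul _ ((hmeas n m).mul_const H), lintegral_mul_const _ (hmeas n m)]
    _ ≤ ∑' n, ‖c n‖ₑ * ∑' m, ‖d m‖ₑ * (D * H) := by
        gcongr with n m
        exact lintegral_bilNorm_atom_le J j A₂ A₃ M hM hT (hA n) (hB m) α
    _ = D * H * (∑' n, ‖d n‖ₑ) * ∑' n, ‖c n‖ₑ := by
        rw [ENNReal.tsum_mul_right, ENNReal.tsum_mul_right]
        ring

theorem sum_enorm_evolve_sq_le (A : Finset (ℤ × ℤ)) (t : ℝ) (f : L2) :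
    (∑ k ∈ A, ‖evolve t f k‖ₑ ^ 2) ^ (1 / 2 : ℝ) ≤ ‖f‖ₑ := by
  have h : ∑ k ∈ A, ‖evolve t f k‖ₑ ^ 2 ≤ ‖f‖ₑ ^ 2 := by
    simp only [← ofReal_norm, ← ENNReal.ofReal_pow (norm_nonneg _)]
    rw [← ENNReal.ofReal_sum_of_nonneg fun _ _ => sq_nonneg _]
    exact ENNReal.ofReal_le_ofReal (sum_norm_evolve_sq_le A t f)
  calc _ ≤ (‖f‖ₑ ^ 2) ^ (1 / 2 : ℝ) := by gcongr
    _ = ‖f‖ₑ := by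
      rw [← ENNReal.rpow_natCast, ← ENNReal.rpow_mul]
      norm_num

theorem aemeasurable_evolve_of_U2norm_ne_top {a b : ℝ} {f : ℝ → L2} (hf : U2norm a b f ≠ ⊤)
    {S : Set ℝ} (hS : MeasurableSet S) (hSab : S ⊆ Ico a b) (k : ℤ × ℤ) :
    AEMeasurable (fun t => evolve t (f t) k) (volume.restrict S) := by
  obtain ⟨c, A, hA, hs, -⟩ := exists_atoms_of_U2norm_lt hf.lt_top
  have h : Measurable fun t => ∑' n, c n * evolve t (A n t) k :=
    Measurable.tsum fun n => ((hA n).measurable_evolve k).const_mul _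
  refine h.aemeasurable.congr ?_
  filter_upwards [ae_restrict_mem hS] with t ht
  exact (hasSum_evolve (hs t (hSab ht)) t k).tsum_eq

/-- The constant in the trilinear estimate. -/
def triConst : ℝ≥0 := 2 * Real.toNNReal (Real.sqrt (2 * Real.exp 1 * countConst))

theorem triConst_pos : 0 < triConst := by
  have := countConst_pos
  unfold triConst
  positivity

theorem two_mul_bilConst_rpow (J j : ℕ) (μ : ℝ≥0) :
    2 * ENNReal.ofReal (bilConst J j μ * (((2 : ℝ) ^ J) ^ 2)⁻¹) ^ (1 / 2 : ℝ) =
      triConst * μ * ((2 : ℝ≥0∞) ^ j) ^ (1 / 2 : ℝ) * ENNReal.ofReal ((((2 : ℝ) ^ J) ^ 2)⁻¹) := by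
  have hc := countConst_pos
  have e : bilConst J j μ * (((2 : ℝ) ^ J) ^ 2)⁻¹ =
      (2 * Real.exp 1 * countConst) * 2 ^ j * (μ * (((2 : ℝ) ^ J) ^ 2)⁻¹) ^ 2 := by
    rw [bilConst]; ring
  have h2 : ((2 : ℝ≥0∞) ^ j) = ENNReal.ofReal (2 ^ j) := by
    rw [ENNReal.ofReal_pow (by norm_num)]; norm_num
  rw [e, ENNReal.ofReal_rpow_of_nonneg (by positivity) (by norm_num), h2,
    ENNReal.ofReal_rpow_of_nonneg (by positivity) (by norm_num), triConst, ← Real.sqrt_eq_rpow,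
    ← Real.sqrt_eq_rpow, Real.sqrt_mul (by positivity), Real.sqrt_mul (by positivity),
    Real.sqrt_sq (by positivity), ENNReal.ofReal_mul (by positivity),
    ENNReal.ofReal_mul (by positivity), ENNReal.ofReal_mul (by positivity),
    ENNReal.ofReal_coe_nnreal]
  simp only [ENNReal.coe_mul, ENNReal.coe_ofNat, ENNReal.ofReal]
  ring

theorem lintegral_triSum_low_le {j₁ j₂ j₃ J : ℕ} (h12 : j₁ ≤ j₂) (h13 : j₁ ≤ j₃)
    (hJ : J = max j₂ j₃) (M : ℤ × ℤ → ℤ × ℤ → ℤ × ℤ → ℂ) {μ : ℝ≥0}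
    (hM : ∀ p ∈ annulus j₁, ∀ q ∈ annulus j₂, ∀ r ∈ annulus j₃, p + q + r = 0 → ‖M p q r‖ ≤ μ)
    {S : Set ℝ} (hS : MeasurableSet S) {α a b₁ b₂ b₃ : ℝ}
    (hS₀ : S ⊆ Ico α (α + (((2 : ℝ) ^ J) ^ 2)⁻¹)) (hS₁ : S ⊆ Ico a b₁) (hS₂ : S ⊆ Ico a b₂)
    (hS₃ : S ⊆ Ico a b₃)
    {f₁ f₂ f₃ : ℝ → L2} (h₁ : U2norm a b₁ f₁ ≠ ⊤) (h₂ : U2norm a b₂ f₂ ≠ ⊤)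
    (h₃ : U2norm a b₃ f₃ ≠ ⊤) :
    ∫⁻ t in S, ‖triSum (annulus j₁) (annulus j₂) (annulus j₃) M (evolve t (f₁ t)) (evolve t (f₂ t))
      (evolve t (f₃ t))‖ₑ ≤
      triConst * μ * ((2 : ℝ≥0∞) ^ j₁) ^ (1 / 2 : ℝ) * ENNReal.ofReal ((((2 : ℝ) ^ J) ^ 2)⁻¹) *
        (U2norm a b₁ f₁ * U2norm a b₂ f₂ * U2norm a b₃ f₃) := by
  classical
  set M₁ : ℤ × ℤ → ℤ × ℤ → ℤ × ℤ → ℂ := fun p q r => if Transversal J p q then M p q r else 0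
    with hM₁
  set M₂ : ℤ × ℤ → ℤ × ℤ → ℤ × ℤ → ℂ := fun p r q => if Transversal J p q then 0 else M p q r
    with hM₂
  have hsplit : ∀ f g h, triSum (annulus j₁) (annulus j₂) (annulus j₃) M f g h =
      triSum (annulus j₁) (annulus j₂) (annulus j₃) M₁ f g h +
      triSum (annulus j₁) (annulus j₃) (annulus j₂) M₂ f h g := by
    intro f g h
    rw [triSum_swap_right (annulus j₁) (annulus j₃)]
    simp only [triSum, ← Finset.sum_add_distrib]
    refine Finset.sum_congr rfl fun p _ => Finset.sum_congr rfl fun q _ =>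
      Finset.sum_congr rfl fun r _ => ?_
    simp only [hM₁, hM₂]
    split_ifs <;> simp
  have hzero : J = 0 → j₁ = 0 ∧ J = 0 := by lia
  have g₁ := lintegral_triSum_transversal_le J j₁ (annulus j₂) (annulus j₃) M₁ (μ := μ)
    (by
      intro p hp q hq r hr h0
      simp only [hM₁]
      split_ifs
      · exact hM p hp q hq r hr h0
      · simp)
    (by
      right
      intro p hp q hq r hr h0 hne
      by_contra hc
      exact hne (if_neg hc)) hS hS₀ hS₁ hS₂ h₁ h₂ h₃
    (fun t ht => (sum_enorm_evolve_sq_le _ t (f₃ t)).trans (enorm_le_U2norm f₃ (hS₃ ht)))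
  have g₂ := lintegral_triSum_transversal_le J j₁ (annulus j₃) (annulus j₂) M₂ (μ := μ)
    (by
      intro p hp q hq r hr h0
      simp only [hM₂]
      split_ifs
      · simp
      · exact hM p hp r hr q hq (by rw [add_right_comm]; exact h0))
    (by
      rcases eq_or_ne J 0 with hJ0 | hJ0
      · exact Or.inl (hzero hJ0)
      right
      intro p hp q hq r hr h0 hne
      by_contra hc
      have hnt : ¬ Transversal J p r := fun h => hne (if_pos h)
      have hmem : q ∈ annulus J ∨ r ∈ annulus J := by
        rcases max_choice j₂ j₃ with h | h
        · right; rw [hJ, h]; exact hr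
        · left; rw [hJ, h]; exact hq
      rcases transversal_or hJ0 hmem h0 with h | h
      · exact hc h
      · exact hnt h) hS hS₀ hS₁ hS₃ h₁ h₃ h₂
    (fun t ht => (sum_enorm_evolve_sq_le _ t (f₂ t)).trans (enorm_le_U2norm f₂ (hS₂ ht)))
  rw [← two_mul_bilConst_rpow]
  set D := ENNReal.ofReal (bilConst J j₁ μ * (((2 : ℝ) ^ J) ^ 2)⁻¹) ^ (1 / 2 : ℝ)
  have hmeas : AEMeasurable (fun t => triSum (annulus j₁) (annulus j₂) (annulus j₃) M₁
      (evolve t (f₁ t)) (evolve t (f₂ t)) (evolve t (f₃ t))) (volume.restrict S) := by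
    unfold triSum
    refine Finset.aemeasurable_fun_sum _ fun p _ => Finset.aemeasurable_fun_sum _ fun q _ =>
      Finset.aemeasurable_fun_sum _ fun r _ => ?_
    split_ifs
    · exact (((aemeasurable_evolve_of_U2norm_ne_top h₁ hS hS₁ p).const_mul _).mul
        (aemeasurable_evolve_of_U2norm_ne_top h₂ hS hS₂ q)).mul
        (aemeasurable_evolve_of_U2norm_ne_top h₃ hS hS₃ r)
    · exact aemeasurable_const
  calc _ ≤ ∫⁻ t in S, (‖triSum (annulus j₁) (annulus j₂) (annulus j₃) M₁ (evolve t (f₁ t))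
        (evolve t (f₂ t)) (evolve t (f₃ t))‖ₑ + ‖triSum (annulus j₁) (annulus j₃) (annulus j₂) M₂
        (evolve t (f₁ t)) (evolve t (f₃ t)) (evolve t (f₂ t))‖ₑ) := by
        refine lintegral_mono fun t => ?_
        rw [hsplit]
        exact enorm_add_le _ _
    _ ≤ D * U2norm a b₃ f₃ * U2norm a b₁ f₁ * U2norm a b₂ f₂ +
        D * U2norm a b₂ f₂ * U2norm a b₁ f₁ * U2norm a b₃ f₃ := by
        rw [lintegral_add_left' hmeas.enorm]
        exact add_le_add g₁ g₂
    _ = _ := by ring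

/-! ### The trilinear estimate on `[0, T)` -/

/-- The supremum in the definition of `Fnorm` at the dyadic frequency `2 ^ j`. -/
def shortNorm (T : ℝ) (u : ℝ → Torus → ℝ) (j : ℕ) : ℝ≥0∞ :=
  ⨆ a ∈ Ico 0 T, U2norm a (min (a + ((2 : ℝ) ^ j)⁻¹ ^ 2) T) (fun t => backProj j t (u t))

theorem U2norm_le_shortNorm {T a : ℝ} (ha : a ∈ Ico 0 T) (u : ℝ → Torus → ℝ) (j : ℕ) :
    U2norm a (min (a + ((2 : ℝ) ^ j)⁻¹ ^ 2) T) (fun t => backProj j t (u t)) ≤ shortNorm T u j :=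
  le_iSup₂ (f := fun a (_ : a ∈ Ico 0 T) =>
    U2norm a (min (a + ((2 : ℝ) ^ j)⁻¹ ^ 2) T) (fun t => backProj j t (u t))) a ha

theorem coeff_eq_zero_of_shortNorm {T t : ℝ} (ht : t ∈ Ico 0 T) {u : ℝ → Torus → ℝ} {j : ℕ}
    (h : shortNorm T u j = 0) {k : ℤ × ℤ} (hk : k ∈ annulus j) : coeff (u t) k = 0 := by
  have h1 : t ∈ Ico t (min (t + ((2 : ℝ) ^ j)⁻¹ ^ 2) T) :=
    ⟨le_rfl, lt_min (by simp) ht.2⟩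
  have h2 := (enorm_le_U2norm (fun t => backProj j t (u t)) h1).trans (U2norm_le_shortNorm ht u j)
  rw [h, nonpos_iff_eq_zero, enorm_eq_zero] at h2
  rw [← evolve_backProj hk t (u t), h2, evolve_zero, Pi.zero_apply]

theorem triSum_congr {A₁ A₂ A₃ : Finset (ℤ × ℤ)} (M : ℤ × ℤ → ℤ × ℤ → ℤ × ℤ → ℂ)
    {f f' g g' h h' : ℤ × ℤ → ℂ} (hf : ∀ p ∈ A₁, f p = f' p) (hg : ∀ p ∈ A₂, g p = g' p)
    (hh : ∀ p ∈ A₃, h p = h' p) : triSum A₁ A₂ A₃ M f g h = triSum A₁ A₂ A₃ M f' g' h' := by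
  refine Finset.sum_congr rfl fun p hp => Finset.sum_congr rfl fun q hq =>
    Finset.sum_congr rfl fun r hr => ?_
  rw [hf p hp, hg q hq, hh r hr]

theorem lintegral_biUnion_finset_le {ι : Type*} (s : Finset ι) (S : ι → Set ℝ) (f : ℝ → ℝ≥0∞) :
    ∫⁻ t in ⋃ i ∈ s, S i, f t ≤ ∑ i ∈ s, ∫⁻ t in S i, f t := by
  classical
  induction s using Finset.induction_on with
  | empty => simp
  | insert i s hi ih =>
    rw [Finset.set_biUnion_insert, Finset.sum_insert hi]
    exact (lintegral_union_le _ _ _).trans (by gcongr)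

theorem lintegral_triSum_coeff_low_le {j₁ j₂ j₃ : ℕ} (h12 : j₁ ≤ j₂) (h13 : j₁ ≤ j₃)
    (M : ℤ × ℤ → ℤ × ℤ → ℤ × ℤ → ℂ) {μ : ℝ≥0} (hμ : 0 < μ)
    (hM : ∀ p ∈ annulus j₁, ∀ q ∈ annulus j₂, ∀ r ∈ annulus j₃, p + q + r = 0 → ‖M p q r‖ ≤ μ)
    {T : ℝ} (hT : T ≤ 1) (u₁ u₂ u₃ : ℝ → Torus → ℝ) :
    ∫⁻ t in Ico 0 T, ‖triSum (annulus j₁) (annulus j₂) (annulus j₃) M (coeff (u₁ t)) (coeff (u₂ t))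
      (coeff (u₃ t))‖ₑ ≤ triConst * μ * ((2 : ℝ≥0∞) ^ j₁) ^ (1 / 2 : ℝ) *
        (shortNorm T u₁ j₁ * shortNorm T u₂ j₂ * shortNorm T u₃ j₃) := by
  set X₁ := shortNorm T u₁ j₁ with hX₁
  set X₂ := shortNorm T u₂ j₂ with hX₂
  set X₃ := shortNorm T u₃ j₃ with hX₃
  have hzero : X₁ = 0 ∨ X₂ = 0 ∨ X₃ = 0 → ∫⁻ t in Ico 0 T, ‖triSum (annulus j₁) (annulus j₂)
      (annulus j₃) M (coeff (u₁ t)) (coeff (u₂ t)) (coeff (u₃ t))‖ₑ = 0 := by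
    intro h
    refine setLIntegral_eq_zero measurableSet_Ico fun t ht => ?_
    rw [Pi.zero_apply, enorm_eq_zero]
    refine Finset.sum_eq_zero fun p hp => Finset.sum_eq_zero fun q hq =>
      Finset.sum_eq_zero fun r hr => ?_
    rcases h with h | h | h
    · simp [coeff_eq_zero_of_shortNorm ht h hp]
    · simp [coeff_eq_zero_of_shortNorm ht h hq]
    · simp [coeff_eq_zero_of_shortNorm ht h hr]
  by_cases h0 : X₁ = 0 ∨ X₂ = 0 ∨ X₃ = 0
  · rw [hzero h0]
    exact zero_le
  push Not at h0
  obtain ⟨n₁, n₂, n₃⟩ := h0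
  by_cases htop : X₁ * X₂ * X₃ = ⊤
  · rw [htop, ENNReal.mul_top]
    · exact le_top
    · simp [triConst_pos.ne', hμ.ne']
  have t₁ : X₁ ≠ ⊤ := by
    intro h
    apply htop
    rw [h, ENNReal.top_mul n₂, ENNReal.top_mul n₃]
  have t₂ : X₂ ≠ ⊤ := by
    intro h
    apply htop
    rw [h, ENNReal.mul_top n₁, ENNReal.top_mul n₃]
  have t₃ : X₃ ≠ ⊤ := by
    intro h
    apply htop
    rw [h, ENNReal.mul_top (mul_ne_zero n₁ n₂)]
  set J := max j₂ j₃ with hJ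
  set δ := (((2 : ℝ) ^ J) ^ 2)⁻¹ with hδ
  have hδ0 : 0 < δ := by positivity
  have hδle : ∀ j ≤ J, δ ≤ ((2 : ℝ) ^ j)⁻¹ ^ 2 := by
    intro j hj
    rw [inv_pow, hδ]
    gcongr
    norm_num
  have hcard : ((4 ^ J : ℕ) : ℝ) * δ = 1 := by
    rw [hδ, ← pow_mul, mul_comm J 2, pow_mul]
    push_cast
    norm_num
  set S : ℕ → Set ℝ := fun i => Ico (i * δ) (i * δ + δ) ∩ Ico 0 T with hS
  have hcover : Ico 0 T ⊆ ⋃ i ∈ Finset.range (4 ^ J), S i := by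
    intro t ht
    have hnn : 0 ≤ t / δ := div_nonneg ht.1 hδ0.le
    refine mem_iUnion₂.mpr ⟨⌊t / δ⌋₊, ?_, ⟨?_, ?_⟩, ht⟩
    · rw [Finset.mem_range, Nat.floor_lt hnn, div_lt_iff₀ hδ0, hcard]
      exact ht.2.trans_le hT
    · exact (le_div_iff₀ hδ0).mp (Nat.floor_le hnn)
    · have := (div_lt_iff₀ hδ0).mp (Nat.lt_floor_add_one (t / δ))
      linarith
  set Φ : ℝ → ℝ≥0∞ := fun t => ‖triSum (annulus j₁) (annulus j₂) (annulus j₃) M (coeff (u₁ t))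
    (coeff (u₂ t)) (coeff (u₃ t))‖ₑ with hΦ
  have hpiece : ∀ i ∈ Finset.range (4 ^ J), ∫⁻ t in S i, Φ t ≤
      triConst * μ * ((2 : ℝ≥0∞) ^ j₁) ^ (1 / 2 : ℝ) * ENNReal.ofReal δ * (X₁ * X₂ * X₃) := by
    intro i _
    rcases lt_or_ge (i * δ : ℝ) T with hi | hi
    · have ha : (i * δ : ℝ) ∈ Ico 0 T := ⟨by positivity, hi⟩
      have hsub : ∀ j ≤ J, S i ⊆ Ico (i * δ : ℝ) (min (i * δ + ((2 : ℝ) ^ j)⁻¹ ^ 2) T) := by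
        intro j hj t ht
        refine ⟨ht.1.1, lt_min (ht.1.2.trans_le ?_) ht.2.2⟩
        gcongr
        exact hδle j hj
      have hm₁ := U2norm_le_shortNorm ha u₁ j₁
      have hm₂ := U2norm_le_shortNorm ha u₂ j₂
      have hm₃ := U2norm_le_shortNorm ha u₃ j₃
      have key := lintegral_triSum_low_le h12 h13 hJ M hM
        (measurableSet_Ico.inter measurableSet_Ico : MeasurableSet (S i))
        (inter_subset_left) (hsub j₁ (h12.trans (le_max_left _ _))) (hsub j₂ (le_max_left _ _))
        (hsub j₃ (le_max_right _ _)) (ne_top_of_le_ne_top t₁ hm₁) (ne_top_of_le_ne_top t₂ hm₂)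
        (ne_top_of_le_ne_top t₃ hm₃)
      refine (le_of_eq ?_).trans (key.trans ?_)
      · refine lintegral_congr fun t => ?_
        simp only [hΦ]
        congr 1
        exact triSum_congr M (fun p hp => (evolve_backProj hp t _).symm)
          (fun p hp => (evolve_backProj hp t _).symm) (fun p hp => (evolve_backProj hp t _).symm)
      · gcongr
    · have : S i = ∅ := by
        ext t
        simp only [hS, mem_inter_iff, mem_Ico, mem_empty_iff_false, iff_false]
        rintro ⟨⟨h1, -⟩, -, h2⟩
        linarith
      rw [this]
      simp
  calc ∫⁻ t in Ico 0 T, Φ t ≤ ∫⁻ t in ⋃ i ∈ Finset.range (4 ^ J), S i, Φ t :=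
        lintegral_mono_set hcover
    _ ≤ ∑ i ∈ Finset.range (4 ^ J), ∫⁻ t in S i, Φ t :=
        lintegral_biUnion_finset_le _ _ _
    _ ≤ ∑ i ∈ Finset.range (4 ^ J),
        triConst * μ * ((2 : ℝ≥0∞) ^ j₁) ^ (1 / 2 : ℝ) * ENNReal.ofReal δ * (X₁ * X₂ * X₃) :=
        Finset.sum_le_sum hpiece
    _ = triConst * μ * ((2 : ℝ≥0∞) ^ j₁) ^ (1 / 2 : ℝ) * (((4 ^ J : ℕ) : ℝ≥0∞) * ENNReal.ofReal δ)
        * (X₁ * X₂ * X₃) := by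
        rw [Finset.sum_const, Finset.card_range, nsmul_eq_mul]
        ring
    _ = _ := by
        rw [← ENNReal.ofReal_natCast, ← ENNReal.ofReal_mul (by positivity), hcard,
          ENNReal.ofReal_one, mul_one]

theorem lintegral_triSum_coeff_le {j₁ j₂ j₃ : ℕ}
    (M : ℤ × ℤ → ℤ × ℤ → ℤ × ℤ → ℂ) {μ : ℝ≥0} (hμ : 0 < μ)
    (hM : ∀ p ∈ annulus j₁, ∀ q ∈ annulus j₂, ∀ r ∈ annulus j₃, p + q + r = 0 → ‖M p q r‖ ≤ μ)
    {T : ℝ} (hT : T ≤ 1) (u₁ u₂ u₃ : ℝ → Torus → ℝ) :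
    ∫⁻ t in Ico 0 T, ‖triSum (annulus j₁) (annulus j₂) (annulus j₃) M (coeff (u₁ t)) (coeff (u₂ t))
      (coeff (u₃ t))‖ₑ ≤ triConst * μ * ((2 : ℝ≥0∞) ^ min j₁ (min j₂ j₃)) ^ (1 / 2 : ℝ) *
        (shortNorm T u₁ j₁ * shortNorm T u₂ j₂ * shortNorm T u₃ j₃) := by
  by_cases hc : j₁ ≤ j₂ ∧ j₁ ≤ j₃
  · rw [min_eq_left (le_min hc.1 hc.2)]
    exact lintegral_triSum_coeff_low_le hc.1 hc.2 M hμ hM hT u₁ u₂ u₃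
  rcases le_total j₂ j₃ with h23 | h23
  · have h21 : j₂ ≤ j₁ := by lia
    rw [show min j₁ (min j₂ j₃) = j₂ by lia]
    simp_rw [triSum_swap_left (annulus j₁)]
    refine (lintegral_triSum_coeff_low_le h21 h23 _ hμ ?_ hT u₂ u₁ u₃).trans (le_of_eq (by ring))
    intro p hp q hq r hr h0
    exact hM q hq p hp r hr (by rw [add_comm q p]; exact h0)
  · have h31 : j₃ ≤ j₁ := by lia
    rw [show min j₁ (min j₂ j₃) = j₃ by lia]
    have e : ∀ t, triSum (annulus j₁) (annulus j₂) (annulus j₃) M (coeff (u₁ t)) (coeff (u₂ t))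
        (coeff (u₃ t)) = triSum (annulus j₃) (annulus j₁) (annulus j₂) (fun p q r => M q r p)
        (coeff (u₃ t)) (coeff (u₁ t)) (coeff (u₂ t)) := fun t => by
      rw [triSum_swap_right, triSum_swap_left]
    simp only [e]
    refine (lintegral_triSum_coeff_low_le h31 h23 _ hμ ?_ hT u₃ u₁ u₂).trans (le_of_eq (by ring))
    intro p hp q hq r hr h0
    exact hM q hq r hr p hp (by rw [← h0]; abel)

/-! ### Smooth functions on `[0, T] × 𝕋²` -/

/-- The periodic lift of a function on `ℝ × 𝕋²`. -/
def lift (w : ℝ → Torus → ℝ) (q : ℝ × ℝ × ℝ) : ℝ := w q.1 ((q.2.1 : Circle1), (q.2.2 : Circle1))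

/-- Smoothness on `[0, T] × 𝕋²`. -/
def SmoothOn (T : ℝ) (w : ℝ → Torus → ℝ) : Prop := ContDiffOn ℝ ∞ (lift w) (Icc 0 T ×ˢ univ)

/-- The torus element `s e` for `e ∈ ℝ²`. -/
def shift (e : ℝ × ℝ) (s : ℝ) : Torus := (((s * e.1 : ℝ) : Circle1), ((s * e.2 : ℝ) : Circle1))

/-- The directional derivative in space along `e ∈ ℝ²`. -/
def dirDeriv (e : ℝ × ℝ) (w : ℝ → Torus → ℝ) (t : ℝ) (p : Torus) : ℝ :=
  deriv (fun s : ℝ => w t (p + shift e s)) 0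

/-- The time derivative, one-sided at the end points of `[0, T]`. -/
def timeDeriv (T : ℝ) (w : ℝ → Torus → ℝ) (t : ℝ) (p : Torus) : ℝ :=
  derivWithin (fun τ => w τ p) (Icc 0 T) t

theorem exists_coe_eq (p : Torus) : ∃ x ∈ Icc 0 (2 * Real.pi), ∃ y ∈ Icc 0 (2 * Real.pi),
    p = ((x : Circle1), (y : Circle1)) := by
  obtain ⟨x, hx, hx'⟩ := AddCircle.eq_coe_Ico p.1
  obtain ⟨y, hy, hy'⟩ := AddCircle.eq_coe_Ico p.2
  exact ⟨x, Ico_subset_Icc_self hx, y, Ico_subset_Icc_self hy, Prod.ext hx'.symm hy'.symm⟩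

theorem uniqueDiffOn_slab {T : ℝ} (hT : 0 < T) :
    UniqueDiffOn ℝ (Icc 0 T ×ˢ (univ : Set (ℝ × ℝ))) :=
  (uniqueDiffOn_Icc hT).prod uniqueDiffOn_univ

namespace SmoothOn

variable {T : ℝ} {w w' : ℝ → Torus → ℝ}

theorem hasFDerivWithinAt (hw : SmoothOn T w) {q : ℝ × ℝ × ℝ} (hq : q ∈ Icc 0 T ×ˢ univ) :
    HasFDerivWithinAt (lift w) (fderivWithin ℝ (lift w) (Icc 0 T ×ˢ univ) q) (Icc 0 T ×ˢ univ) q :=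
  (hw.differentiableOn (by simp) q hq).hasFDerivWithinAt

theorem hasDerivAt_lift (hw : SmoothOn T w) {t : ℝ} (ht : t ∈ Icc 0 T) (e : ℝ × ℝ) (x y s : ℝ) :
    HasDerivAt (fun s : ℝ => lift w (t, x + s * e.1, y + s * e.2))
      (fderivWithin ℝ (lift w) (Icc 0 T ×ˢ univ) (t, x + s * e.1, y + s * e.2) (0, e.1, e.2)) s := by
  have h1 : HasDerivAt (fun s : ℝ => (t, x + s * e.1, y + s * e.2)) (0, e.1, e.2) s := by
    refine (hasDerivAt_const s t).prodMk (HasDerivAt.prodMk ?_ ?_)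
    · simpa using ((hasDerivAt_id s).mul_const e.1).const_add x
    · simpa using ((hasDerivAt_id s).mul_const e.2).const_add y
  have h2 := hw.hasFDerivWithinAt (q := (t, x + s * e.1, y + s * e.2)) ⟨ht, mem_univ _⟩
  have := h2.comp_hasDerivWithinAt s h1.hasDerivWithinAt
    (fun s' (_ : s' ∈ univ) => (⟨ht, mem_univ _⟩ : _ ∈ Icc 0 T ×ˢ univ))
  exact hasDerivWithinAt_univ.mp this

theorem lift_shift (w : ℝ → Torus → ℝ) (t x y s : ℝ) (e : ℝ × ℝ) :
    w t (((x : Circle1), (y : Circle1)) + shift e s) = lift w (t, x + s * e.1, y + s * e.2) := by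
  simp [lift, shift]

theorem lift_dirDeriv (hw : SmoothOn T w) {t : ℝ} (ht : t ∈ Icc 0 T) (e : ℝ × ℝ) (x y : ℝ) :
    lift (dirDeriv e w) (t, x, y) =
      fderivWithin ℝ (lift w) (Icc 0 T ×ˢ univ) (t, x, y) (0, e.1, e.2) := by
  have := (hw.hasDerivAt_lift ht e x y 0).deriv
  simp only [zero_mul, add_zero] at this
  rw [← this, lift, dirDeriv]
  simp only [lift_shift]

theorem fderivWithin_apply (hT : 0 < T) (hw : SmoothOn T w) (e : ℝ × ℝ × ℝ) :
    ContDiffOn ℝ ∞ (fun q => fderivWithin ℝ (lift w) (Icc 0 T ×ˢ univ) q e) (Icc 0 T ×ˢ univ) :=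
  (ContDiffOn.fderivWithin hw (uniqueDiffOn_slab hT) (by simp)).clm_apply contDiffOn_const

theorem dirDeriv (hT : 0 < T) (hw : SmoothOn T w) (e : ℝ × ℝ) : SmoothOn T (dirDeriv e w) := by
  refine (hw.fderivWithin_apply hT (0, e.1, e.2)).congr ?_
  rintro ⟨t, x, y⟩ ⟨ht, -⟩
  exact hw.lift_dirDeriv ht e x y

theorem hasDerivWithinAt_time (hw : SmoothOn T w) {t : ℝ} (ht : t ∈ Icc 0 T) (x y : ℝ) :
    HasDerivWithinAt (fun τ => lift w (τ, x, y))
      (fderivWithin ℝ (lift w) (Icc 0 T ×ˢ univ) (t, x, y) (1, 0, 0)) (Icc 0 T) t := by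
  have h1 : HasDerivWithinAt (fun τ : ℝ => (τ, x, y)) (1, 0, 0) (Icc 0 T) t :=
    (hasDerivWithinAt_id t _).prodMk ((hasDerivWithinAt_const _ _ x).prodMk
      (hasDerivWithinAt_const _ _ y))
  exact (hw.hasFDerivWithinAt (q := (t, x, y)) ⟨ht, mem_univ _⟩).comp_hasDerivWithinAt t h1
    (fun s' hs' => (⟨hs', mem_univ _⟩ : (s', x, y) ∈ Icc 0 T ×ˢ univ))

theorem lift_timeDeriv (hT : 0 < T) (hw : SmoothOn T w) {t : ℝ} (ht : t ∈ Icc 0 T) (x y : ℝ) :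
    lift (timeDeriv T w) (t, x, y) =
      fderivWithin ℝ (lift w) (Icc 0 T ×ˢ univ) (t, x, y) (1, 0, 0) :=
  (hw.hasDerivWithinAt_time ht x y).derivWithin (uniqueDiffOn_Icc hT t ht)

theorem timeDeriv (hT : 0 < T) (hw : SmoothOn T w) : SmoothOn T (timeDeriv T w) := by
  refine (hw.fderivWithin_apply hT (1, 0, 0)).congr ?_
  rintro ⟨t, x, y⟩ ⟨ht, -⟩
  exact hw.lift_timeDeriv hT ht x y

theorem hasDerivWithinAt_timeDeriv (hT : 0 < T) (hw : SmoothOn T w) {t : ℝ} (ht : t ∈ Icc 0 T)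
    (p : Torus) :
    HasDerivWithinAt (fun τ => w τ p) (ZK.timeDeriv T w t p) (Icc 0 T) t := by
  obtain ⟨x, -, y, -, rfl⟩ := exists_coe_eq p
  have := hw.hasDerivWithinAt_time ht x y
  rw [← hw.lift_timeDeriv hT ht] at this
  exact this

theorem exists_bound (hw : SmoothOn T w) : ∃ B : ℝ, 0 ≤ B ∧ ∀ t ∈ Icc 0 T, ∀ p, |w t p| ≤ B := by
  have hc : IsCompact (Icc (0 : ℝ) T ×ˢ (Icc 0 (2 * Real.pi) ×ˢ Icc 0 (2 * Real.pi))) :=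
    isCompact_Icc.prod (isCompact_Icc.prod isCompact_Icc)
  obtain ⟨B, hB⟩ := hc.exists_bound_of_continuousOn
    (hw.continuousOn.mono (prod_mono le_rfl (subset_univ _)))
  refine ⟨max B 0, le_max_right _ _, fun t ht p => ?_⟩
  obtain ⟨x, hx, y, hy, rfl⟩ := exists_coe_eq p
  exact (hB (t, x, y) ⟨ht, hx, hy⟩).trans (le_max_left _ _)

theorem continuous (hw : SmoothOn T w) {t : ℝ} (ht : t ∈ Icc 0 T) : Continuous (w t) := by
  have hq : IsOpenQuotientMap (Prod.map ((↑) : ℝ → Circle1) ((↑) : ℝ → Circle1)) :=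
    QuotientAddGroup.isOpenQuotientMap_mk.prodMap QuotientAddGroup.isOpenQuotientMap_mk
  rw [← hq.continuous_comp_iff]
  have : Continuous fun z : ℝ × ℝ => lift w (t, z) := by
    refine hw.continuousOn.comp_continuous (by fun_prop) fun z => ⟨ht, mem_univ _⟩
  exact this

theorem mul (hw : SmoothOn T w) (hw' : SmoothOn T w') : SmoothOn T (w * w') :=
  ContDiffOn.mul hw hw'

theorem hasDerivAt_shift (hw : SmoothOn T w) {t : ℝ} (ht : t ∈ Icc 0 T) (e : ℝ × ℝ) (p : Torus)
    (s : ℝ) : HasDerivAt (fun s => w t (p + shift e s)) (ZK.dirDeriv e w t (p + shift e s)) s := by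
  obtain ⟨x, -, y, -, rfl⟩ := exists_coe_eq p
  simp only [lift_shift]
  rw [hw.lift_dirDeriv ht]
  exact hw.hasDerivAt_lift ht e x y s

end SmoothOn

/-! ### Fourier coefficients of smooth functions -/

theorem norm_fourier_apply (n : ℤ) (x : Circle1) : ‖fourier n x‖ = 1 := by
  rw [fourier_apply]
  exact Circle.norm_coe _

theorem norm_character (k : ℤ × ℤ) (p : Torus) : ‖character k p‖ = 1 := by
  rw [character, ContinuousMap.coe_mk, norm_mul, norm_fourier_apply, norm_fourier_apply, one_mul]

theorem fourier_add_apply (n : ℤ) (x y : Circle1) :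
    fourier n (x + y) = fourier n x * fourier n y := by
  simp only [fourier_apply, smul_add, AddCircle.toCircle_add, Circle.coe_mul]

theorem character_add_apply (k : ℤ × ℤ) (p q : Torus) :
    character k (p + q) = character k p * character k q := by
  simp only [character, ContinuousMap.coe_mk, Prod.fst_add, Prod.snd_add, fourier_add_apply]
  ring

theorem character_add (k l : ℤ × ℤ) (p : Torus) :
    character (k + l) p = character k p * character l p := by
  simp only [character, ContinuousMap.coe_mk, Prod.fst_add, Prod.snd_add, fourier_add]
  ring

theorem character_neg (k : ℤ × ℤ) (p : Torus) :
    character (-k) p = starRingEnd ℂ (character k p) := by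
  simp only [character, ContinuousMap.coe_mk, Prod.fst_neg, Prod.snd_neg, fourier_neg, map_mul]

theorem fourier_coe_circle (n : ℤ) (x : ℝ) :
    fourier n (x : Circle1) = Complex.exp (Complex.I * n * x) := by
  rw [fourier_coe_apply]
  congr 1
  push_cast
  have := Real.pi_ne_zero
  field_simp

theorem character_shift (k : ℤ × ℤ) (e : ℝ × ℝ) (s : ℝ) :
    character k (shift e s) = Complex.exp (s * (Complex.I * (k.1 * e.1 + k.2 * e.2))) := by
  simp only [character, ContinuousMap.coe_mk, shift, fourier_coe_circle, ← Complex.exp_add]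
  congr 1
  push_cast
  ring

theorem coeff_neg_freq (f : Torus → ℝ) (k : ℤ × ℤ) :
    coeff f (-k) = starRingEnd ℂ (coeff f k) := by
  rw [coeff, coeff, ← integral_conj]
  simp [character_neg]

theorem norm_coeff_le {f : Torus → ℝ} {B : ℝ} (hf : ∀ p, |f p| ≤ B) (k : ℤ × ℤ) :
    ‖coeff f k‖ ≤ B := by
  have := norm_integral_le_of_norm_le_const (μ := torusMeasure) (C := B)
    (f := fun p => starRingEnd ℂ (character k p) * (f p : ℂ))
    (Filter.Eventually.of_forall fun p => by
      rw [norm_mul, RCLike.norm_conj, norm_character, one_mul, Complex.norm_real]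
      exact hf p)
  simpa [coeff] using this

theorem integrable_of_continuous {f : Torus → ℂ} (hf : Continuous f) :
    Integrable f torusMeasure :=
  hf.integrable_of_hasCompactSupport (HasCompactSupport.of_compactSpace f)

theorem continuous_coeff_integrand {f : Torus → ℝ} (hf : Continuous f) (k : ℤ × ℤ) :
    Continuous fun p => starRingEnd ℂ (character k p) * (f p : ℂ) := by
  fun_prop

theorem coeff_sub {f g : Torus → ℝ} (hf : Continuous f) (hg : Continuous g) (k : ℤ × ℤ) :
    coeff (f - g) k = coeff f k - coeff g k := by
  rw [coeff, coeff, coeff, ← integral_sub (integrable_of_continuous (continuous_coeff_integrand hf k))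
    (integrable_of_continuous (continuous_coeff_integrand hg k))]
  congr 1
  ext p
  simp
  ring

theorem coeff_add {f g : Torus → ℝ} (hf : Continuous f) (hg : Continuous g) (k : ℤ × ℤ) :
    coeff (f + g) k = coeff f k + coeff g k := by
  rw [coeff, coeff, coeff, ← integral_add (integrable_of_continuous (continuous_coeff_integrand hf k))
    (integrable_of_continuous (continuous_coeff_integrand hg k))]
  congr 1
  ext p
  simp
  ring

theorem coeff_const_mul (a : ℝ) (f : Torus → ℝ) (k : ℤ × ℤ) :
    coeff (fun p => a * f p) k = a * coeff f k := by
  rw [coeff, coeff, ← integral_const_mul]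
  congr 1
  ext p
  simp
  ring

theorem coeff_comp_add (f : Torus → ℝ) (h : Torus) (k : ℤ × ℤ) :
    coeff (fun p => f (p + h)) k = character k h * coeff f k := by
  rw [coeff, coeff, ← integral_const_mul,
    ← integral_add_right_eq_self (fun p => character k h * (starRingEnd ℂ (character k p) * (f p : ℂ))) h]
  congr 1
  ext p
  rw [character_add_apply, map_mul]
  have : character k h * starRingEnd ℂ (character k h) = 1 := by
    rw [Complex.mul_conj', norm_character]; norm_num
  linear_combination (-(starRingEnd ℂ (character k p)) * (f (p + h) : ℂ)) * this

theorem coeff_dirDeriv {T : ℝ} (hT : 0 < T) {w : ℝ → Torus → ℝ} (hw : SmoothOn T w) {t : ℝ}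
    (ht : t ∈ Icc 0 T) (e : ℝ × ℝ) (k : ℤ × ℤ) :
    coeff (dirDeriv e w t) k = Complex.I * (k.1 * e.1 + k.2 * e.2) * coeff (w t) k := by
  obtain ⟨B, hB0, hB⟩ := (hw.dirDeriv hT e).exists_bound
  have hcont := hw.continuous ht
  have hcont' := (hw.dirDeriv hT e).continuous ht
  have h1 := (hasDerivAt_integral_of_dominated_loc_of_deriv_le (𝕜 := ℝ) (μ := torusMeasure)
    (F := fun s p => starRingEnd ℂ (character k p) * (w t (p + shift e s) : ℂ))
    (F' := fun s p => starRingEnd ℂ (character k p) * (dirDeriv e w t (p + shift e s) : ℂ))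
    (x₀ := 0) (s := univ) (bound := fun _ => B) Filter.univ_mem
    (Filter.Eventually.of_forall fun s => (continuous_coeff_integrand
      (hcont.comp (continuous_add_const _)) k).aestronglyMeasurable)
    (integrable_of_continuous (continuous_coeff_integrand (hcont.comp (continuous_add_const _)) k))
    (continuous_coeff_integrand (hcont'.comp (continuous_add_const _)) k).aestronglyMeasurable
    (Filter.Eventually.of_forall fun p s _ => by
      rw [norm_mul, RCLike.norm_conj, norm_character, one_mul, Complex.norm_real]
      exact hB t ht _)
    (integrable_const _)
    (Filter.Eventually.of_forall fun p s _ =>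
      ((hw.hasDerivAt_shift ht e p s).ofReal_comp).const_mul _)).2
  have h2 : HasDerivAt (fun s : ℝ => Complex.exp (s * (Complex.I * (k.1 * e.1 + k.2 * e.2))) *
      coeff (w t) k) (Complex.I * (k.1 * e.1 + k.2 * e.2) * coeff (w t) k) 0 := by
    have h3 : HasDerivAt (fun s : ℝ => (s : ℂ) * (Complex.I * (k.1 * e.1 + k.2 * e.2)))
        (Complex.I * (k.1 * e.1 + k.2 * e.2)) 0 := by
      simpa using (Complex.ofRealCLM.hasDerivAt (x := (0 : ℝ))).mul_const
        (Complex.I * ((k.1 : ℂ) * e.1 + k.2 * e.2))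
    simpa using h3.cexp.mul_const (coeff (w t) k)
  have h4 : (fun s : ℝ => Complex.exp (s * (Complex.I * (k.1 * e.1 + k.2 * e.2))) * coeff (w t) k) =
      fun s : ℝ => ∫ p, starRingEnd ℂ (character k p) * (w t (p + shift e s) : ℂ) ∂torusMeasure := by
    ext s
    rw [← character_shift, ← coeff_comp_add]
    rfl
  rw [h4] at h2
  have h5 := h1.unique h2
  have h6 : shift e 0 = 0 := by simp [shift]
  simp only [h6, add_zero] at h5
  exact h5

theorem continuousOn_coeff {T : ℝ} {w : ℝ → Torus → ℝ} (hw : SmoothOn T w) (k : ℤ × ℤ) :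
    ContinuousOn (fun t => coeff (w t) k) (Icc 0 T) := by
  obtain ⟨B, hB0, hB⟩ := hw.exists_bound
  refine continuousOn_of_dominated (bound := fun _ => B) ?_ ?_ (integrable_const _) ?_
  · exact fun t ht => (continuous_coeff_integrand (hw.continuous ht) k).aestronglyMeasurable
  · refine fun t ht => Filter.Eventually.of_forall fun p => ?_
    rw [norm_mul, RCLike.norm_conj, norm_character, one_mul, Complex.norm_real]
    exact hB t ht _
  · refine Filter.Eventually.of_forall fun p => ?_
    refine continuousOn_const.mul (Complex.continuous_ofReal.comp_continuousOn ?_)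
    obtain ⟨x, -, y, -, rfl⟩ := exists_coe_eq p
    have : ContinuousOn (fun t : ℝ => lift w (t, x, y)) (Icc 0 T) :=
      hw.continuousOn.comp (by fun_prop) fun t ht => ⟨ht, mem_univ _⟩
    exact this

theorem hasDerivAt_coeff {T : ℝ} (hT : 0 < T) {w : ℝ → Torus → ℝ} (hw : SmoothOn T w) {t : ℝ}
    (ht : t ∈ Ioo 0 T) (k : ℤ × ℤ) :
    HasDerivAt (fun t => coeff (w t) k) (coeff (timeDeriv T w t) k) t := by
  obtain ⟨B, hB0, hB⟩ := (hw.timeDeriv hT).exists_bound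
  have htI := Ioo_subset_Icc_self ht
  exact (hasDerivAt_integral_of_dominated_loc_of_deriv_le (𝕜 := ℝ) (μ := torusMeasure)
    (F := fun s p => starRingEnd ℂ (character k p) * (w s p : ℂ))
    (F' := fun s p => starRingEnd ℂ (character k p) * (timeDeriv T w s p : ℂ))
    (x₀ := t) (s := Ioo 0 T) (bound := fun _ => B) (Ioo_mem_nhds ht.1 ht.2)
    (Filter.eventually_of_mem (Ioo_mem_nhds ht.1 ht.2) fun s hs => (continuous_coeff_integrand
      (hw.continuous (Ioo_subset_Icc_self hs)) k).aestronglyMeasurable)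
    (integrable_of_continuous (continuous_coeff_integrand (hw.continuous htI) k))
    (continuous_coeff_integrand ((hw.timeDeriv hT).continuous htI) k).aestronglyMeasurable
    (Filter.Eventually.of_forall fun p s hs => by
      rw [norm_mul, RCLike.norm_conj, norm_character, one_mul, Complex.norm_real]
      exact hB s (Ioo_subset_Icc_self hs) _)
    (integrable_const _)
    (Filter.Eventually.of_forall fun p s hs =>
      (((hw.hasDerivWithinAt_timeDeriv hT (Ioo_subset_Icc_self hs) p).hasDerivAt
        (Icc_mem_nhds hs.1 hs.2)).ofReal_comp).const_mul _)).2

/-- `C / ((1 + k₁²) (1 + k₂²))` dominates the Fourier coefficients of smooth functions. -/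
theorem exists_summable_coeff_bound {T : ℝ} (hT : 0 < T) {w : ℝ → Torus → ℝ} (hw : SmoothOn T w) :
    ∃ b : ℤ × ℤ → ℝ, Summable b ∧ (∀ k, 0 ≤ b k) ∧ ∀ t ∈ Icc 0 T, ∀ k, ‖coeff (w t) k‖ ≤ b k := by
  have s1 := hw.dirDeriv hT (1, 0)
  have s11 := s1.dirDeriv hT (1, 0)
  have s2 := hw.dirDeriv hT (0, 1)
  have s22 := s2.dirDeriv hT (0, 1)
  have s122 := s22.dirDeriv hT (1, 0)
  have s1122 := s122.dirDeriv hT (1, 0)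
  obtain ⟨B₀, p₀, h₀⟩ := hw.exists_bound
  obtain ⟨B₁, p₁, h₁⟩ := s11.exists_bound
  obtain ⟨B₂, p₂, h₂⟩ := s22.exists_bound
  obtain ⟨B₃, p₃, h₃⟩ := s1122.exists_bound
  have hsum : Summable fun n : ℤ => 1 / (1 + (n : ℝ) ^ 2) := by
    refine (summable_eight_div.mul_left (1 / 8)).congr fun n => ?_
    ring
  refine ⟨fun k => (B₀ + B₁ + B₂ + B₃) * (1 / (1 + (k.1 : ℝ) ^ 2) * (1 / (1 + (k.2 : ℝ) ^ 2))),
    (hsum.mul_of_nonneg hsum (fun n => by positivity) (fun n => by positivity)).mul_left _,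
    fun k => by positivity, fun t ht k => ?_⟩
  have c₀ := norm_coeff_le (h₀ t ht) k
  have c₁ := norm_coeff_le (h₁ t ht) k
  have c₂ := norm_coeff_le (h₂ t ht) k
  have c₃ := norm_coeff_le (h₃ t ht) k
  rw [coeff_dirDeriv hT s1 ht, coeff_dirDeriv hT hw ht] at c₁
  rw [coeff_dirDeriv hT s2 ht, coeff_dirDeriv hT hw ht] at c₂
  rw [coeff_dirDeriv hT s122 ht, coeff_dirDeriv hT s22 ht, coeff_dirDeriv hT s2 ht,
    coeff_dirDeriv hT hw ht] at c₃
  simp only [norm_mul, Complex.norm_I, Complex.ofReal_one, Complex.ofReal_zero, mul_one, mul_zero,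
    add_zero, zero_add, one_mul, Complex.norm_intCast] at c₁ c₂ c₃
  have q1 : |(k.1 : ℝ)| * |(k.1 : ℝ)| = (k.1 : ℝ) ^ 2 := by rw [abs_mul_abs_self]; ring
  have q2 : |(k.2 : ℝ)| * |(k.2 : ℝ)| = (k.2 : ℝ) ^ 2 := by rw [abs_mul_abs_self]; ring
  rw [← mul_assoc, q1] at c₁
  rw [← mul_assoc, q2] at c₂
  rw [← mul_assoc, ← mul_assoc, ← mul_assoc, q1, mul_assoc ((k.1 : ℝ) ^ 2), q2] at c₃
  have e : (B₀ + B₁ + B₂ + B₃) * (1 / (1 + (k.1 : ℝ) ^ 2) * (1 / (1 + (k.2 : ℝ) ^ 2))) =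
      (B₀ + B₁ + B₂ + B₃) / ((1 + (k.1 : ℝ) ^ 2) * (1 + (k.2 : ℝ) ^ 2)) := by
    field_simp
  simp only [e]
  rw [le_div_iff₀ (by positivity)]
  linarith

/-! ### Fourier inversion and convolution -/

theorem hasSum_coeff {f : Torus → ℝ} (hf : Continuous f) (hs : Summable (coeff f)) (p : Torus) :
    HasSum (fun k => coeff f k * character k p) (f p : ℂ) := by
  obtain ⟨x, y⟩ := p
  set g : ℤ → Circle1 → ℂ := fun m y => fourierCoeff (fun x => (f (x, y) : ℂ)) m with hg
  have hgc : ∀ m, Continuous (g m) := by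
    intro m
    have h := continuous_parametric_integral_of_continuous (μ := AddCircle.haarAddCircle)
      (f := fun (y x : Circle1) => fourier (-m) x • (f (x, y) : ℂ))
      (by unfold Function.uncurry; fun_prop) isCompact_univ
    simp only [Measure.restrict_univ] at h
    exact h
  have hgcoeff : ∀ m n, fourierCoeff (g m) n = coeff f (m, n) := by
    intro m n
    rw [coeff, integral_prod_symm _ (integrable_of_continuous (continuous_coeff_integrand hf _))]
    simp only [hg, fourierCoeff]
    congr 1
    ext y
    rw [← integral_smul]
    congr 1
    ext x
    simp only [character, ContinuousMap.coe_mk, map_mul, fourier_neg, smul_eq_mul]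
    ring
  have hfactor : ∀ m, Summable fun n => coeff f (m, n) := fun m => hs.prod_factor m
  have h1 : ∀ m y, HasSum (fun n => coeff f (m, n) * fourier n y) (g m y) := by
    intro m y
    have := has_pointwise_sum_fourier_series_of_summable (f := ⟨g m, hgc m⟩)
      (by
        have e : fourierCoeff (⇑(⟨g m, hgc m⟩ : C(Circle1, ℂ))) = fun n => coeff f (m, n) :=
          funext fun n => hgcoeff m n
        rw [e]
        exact hfactor m) y
    simpa only [ContinuousMap.coe_mk, hgcoeff, smul_eq_mul] using this
  have hnorm : Summable fun k => ‖coeff f k‖ := hs.norm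
  have hgs : Summable fun m => g m y := by
    refine Summable.of_norm_bounded hnorm.prod fun m => ?_
    rw [← (h1 m y).tsum_eq]
    refine (norm_tsum_le_tsum_norm ?_).trans (le_of_eq ?_)
    · simpa only [norm_mul, norm_fourier_apply, mul_one] using hnorm.prod_factor m
    · simp only [norm_mul, norm_fourier_apply, mul_one]
  have h2 : HasSum (fun m => g m y * fourier m x) (f (x, y) : ℂ) := by
    have := has_pointwise_sum_fourier_series_of_summable
      (f := ⟨fun x => (f (x, y) : ℂ), by fun_prop⟩) hgs x
    exact this
  have hsum : Summable fun k => coeff f k * character k (x, y) := by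
    refine Summable.of_norm ?_
    simpa only [norm_mul, norm_character, mul_one] using hnorm
  have h3 := hsum.hasSum.prod_fiberwise (g := fun m => g m y * fourier m x) fun m => by
    have e : (fun n => coeff f (m, n) * character (m, n) (x, y)) =
        fun n => coeff f (m, n) * fourier n y * fourier m x := by
      funext n
      simp only [character, ContinuousMap.coe_mk]
      ring
    rw [e]
    exact (h1 m y).mul_right (fourier m x)
  rw [← h3.unique h2]
  exact hsum.hasSum

theorem coeff_mul {f g : Torus → ℝ} (hf : Continuous f) (hg : Continuous g)
    (hs : Summable (coeff f)) (k : ℤ × ℤ) :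
    coeff (f * g) k = ∑' l, coeff f l * coeff g (k - l) := by
  set F : ℤ × ℤ → Torus → ℂ := fun l p =>
    coeff f l * (starRingEnd ℂ (character (k - l) p) * (g p : ℂ)) with hF
  obtain ⟨B, hB⟩ := isCompact_univ.exists_bound_of_continuousOn hg.continuousOn
  have hi : ∀ l, Integrable (F l) torusMeasure := fun l =>
    (integrable_of_continuous (continuous_coeff_integrand hg _)).const_mul _
  have hn : Summable fun l => ∫ p, ‖F l p‖ ∂torusMeasure := by
    refine Summable.of_nonneg_of_le (fun l => integral_nonneg fun p => norm_nonneg _) (fun l => ?_)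
      (hs.norm.mul_right B)
    have := integral_mono (hi l).norm (integrable_const (‖coeff f l‖ * B)) fun p => by
      simp only [hF, norm_mul, RCLike.norm_conj, norm_character, one_mul, Complex.norm_real]
      gcongr
      exact hB p (mem_univ _)
    simpa using this
  have h := hasSum_integral_of_summable_integral_norm hi hn
  have e1 : ∀ l, ∫ p, F l p ∂torusMeasure = coeff f l * coeff g (k - l) := by
    intro l
    simp only [hF, coeff]
    rw [integral_const_mul]
  have e2 : ∀ p, ∑' l, F l p = starRingEnd ℂ (character k p) * ((f * g) p : ℂ) := by
    intro p
    have h1 := ((hasSum_coeff hf hs p).mul_right (starRingEnd ℂ (character k p) * (g p : ℂ))).tsum_eq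
    rw [Pi.mul_apply, Complex.ofReal_mul, mul_left_comm, ← h1]
    congr 1
    ext l
    simp only [hF]
    rw [← character_neg, ← character_neg, neg_sub, sub_eq_add_neg, character_add]
    ring
  simp only [e1, e2] at h
  exact h.tsum_eq.symm

/-! ### The equation for the Fourier coefficients -/

theorem deriv_fst_eq (w : ℝ → Torus → ℝ) (t x : ℝ) (y : Circle1) :
    deriv (fun x' : ℝ => w t ((x' : Circle1), y)) x = dirDeriv (1, 0) w t ((x : Circle1), y) := by
  have := deriv_comp_const_add (fun x' : ℝ => w t ((x' : Circle1), y)) x 0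
  rw [add_zero] at this
  rw [← this, dirDeriv]
  simp [shift]

theorem deriv_snd_eq (w : ℝ → Torus → ℝ) (t y : ℝ) (x : Circle1) :
    deriv (fun y' : ℝ => w t (x, (y' : Circle1))) y = dirDeriv (0, 1) w t (x, (y : Circle1)) := by
  have := deriv_comp_const_add (fun y' : ℝ => w t (x, (y' : Circle1))) y 0
  rw [add_zero] at this
  rw [← this, dirDeriv]
  simp [shift]

theorem IsSmoothSolution.timeDeriv_eq {T : ℝ} {u : ℝ → Torus → ℝ} (hu : IsSmoothSolution T u)
    {t : ℝ} (ht : t ∈ Icc 0 T) (p : Torus) :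
    timeDeriv T u t p = u t p * dirDeriv (1, 0) u t p
      - dirDeriv (1, 0) (dirDeriv (1, 0) (dirDeriv (1, 0) u)) t p
      - 3 * dirDeriv (1, 0) (dirDeriv (0, 1) (dirDeriv (0, 1) u)) t p := by
  obtain ⟨x, -, y, -, rfl⟩ := exists_coe_eq p
  have h := hu.equation t ht x y
  have e1 : ∀ w : ℝ → Torus → ℝ, ∀ y : Circle1, deriv (fun x' : ℝ => w t ((x' : Circle1), y)) =
      fun x : ℝ => dirDeriv (1, 0) w t ((x : Circle1), y) :=
    fun w y => funext fun x => deriv_fst_eq w t x y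
  have e2 : ∀ w : ℝ → Torus → ℝ, ∀ x : Circle1, deriv (fun y' : ℝ => w t (x, (y' : Circle1))) =
      fun y : ℝ => dirDeriv (0, 1) w t (x, (y : Circle1)) :=
    fun w x => funext fun y => deriv_snd_eq w t y x
  simp only [iteratedDeriv_succ', iteratedDeriv_zero, e1, e2] at h
  rw [timeDeriv]
  linarith

theorem IsSmoothSolution.smoothOn {T : ℝ} {u : ℝ → Torus → ℝ} (hu : IsSmoothSolution T u) :
    SmoothOn T u := hu.smooth

theorem summable_coeff {T : ℝ} (hT : 0 < T) {w : ℝ → Torus → ℝ} (hw : SmoothOn T w) {t : ℝ}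
    (ht : t ∈ Icc 0 T) : Summable (coeff (w t)) := by
  obtain ⟨b, hb, -, h⟩ := exists_summable_coeff_bound hT hw
  exact Summable.of_norm_bounded hb fun k => h t ht k

theorem coeff_mul_dirDeriv {T : ℝ} (hT : 0 < T) {w : ℝ → Torus → ℝ} (hw : SmoothOn T w) {t : ℝ}
    (ht : t ∈ Icc 0 T) (k : ℤ × ℤ) :
    coeff (fun p => w t p * dirDeriv (1, 0) w t p) k =
      Complex.I * k.1 / 2 * ∑' l, coeff (w t) l * coeff (w t) (k - l) := by
  have h1 : ∀ p, dirDeriv (1, 0) (w * w) t p = 2 * (w t p * dirDeriv (1, 0) w t p) := by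
    intro p
    have h := hw.hasDerivAt_shift ht (1, 0) p 0
    have h2 := (h.mul h).deriv
    have h6 : shift (1, 0) 0 = 0 := by simp [shift]
    rw [h6, add_zero] at h2
    rw [dirDeriv]
    refine Eq.trans ?_ (h2.trans (by ring))
    rfl
  have h2 : (fun p => w t p * dirDeriv (1, 0) w t p) =
      fun p => (1 / 2 : ℝ) * dirDeriv (1, 0) (w * w) t p := by
    ext p
    rw [h1]
    ring
  rw [h2, coeff_const_mul, coeff_dirDeriv hT (hw.mul hw) ht, Pi.mul_apply,
    coeff_mul (hw.continuous ht) (hw.continuous ht) (summable_coeff hT hw ht)]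
  push_cast
  ring

theorem IsSmoothSolution.hasDerivAt_coeff {T : ℝ} (hT : 0 < T) {u : ℝ → Torus → ℝ}
    (hu : IsSmoothSolution T u) {t : ℝ} (ht : t ∈ Ioo 0 T) (k : ℤ × ℤ) :
    HasDerivAt (fun t => coeff (u t) k) (Complex.I * phase k * coeff (u t) k +
      Complex.I * k.1 / 2 * ∑' l, coeff (u t) l * coeff (u t) (k - l)) t := by
  have htI := Ioo_subset_Icc_self ht
  have hw := hu.smoothOn
  have s1 := hw.dirDeriv hT (1, 0)
  have s11 := s1.dirDeriv hT (1, 0)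
  have s111 := s11.dirDeriv hT (1, 0)
  have s2 := hw.dirDeriv hT (0, 1)
  have s22 := s2.dirDeriv hT (0, 1)
  have s122 := s22.dirDeriv hT (1, 0)
  convert ZK.hasDerivAt_coeff hT hw ht k using 1
  have e : timeDeriv T u t = ((fun p => u t p * dirDeriv (1, 0) u t p)
      - dirDeriv (1, 0) (dirDeriv (1, 0) (dirDeriv (1, 0) u)) t)
      - fun p => 3 * dirDeriv (1, 0) (dirDeriv (0, 1) (dirDeriv (0, 1) u)) t p :=
    funext fun p => hu.timeDeriv_eq htI p
  have c1 : Continuous fun p => u t p * dirDeriv (1, 0) u t p :=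
    (hw.continuous htI).mul (s1.continuous htI)
  have c2 : Continuous fun p => 3 * dirDeriv (1, 0) (dirDeriv (0, 1) (dirDeriv (0, 1) u)) t p :=
    continuous_const.mul (s122.continuous htI)
  rw [e, coeff_sub (c1.sub (s111.continuous htI)) c2,
    coeff_sub c1 (s111.continuous htI), coeff_const_mul, coeff_mul_dirDeriv hT hw htI,
    coeff_dirDeriv hT s11 htI, coeff_dirDeriv hT s1 htI, coeff_dirDeriv hT hw htI,
    coeff_dirDeriv hT s22 htI, coeff_dirDeriv hT s2 htI, coeff_dirDeriv hT hw htI, phase]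
  push_cast
  linear_combination ((Complex.I * ((k.1 : ℂ) ^ 3 + 3 * k.1 * k.2 ^ 2)) * coeff (u t) k) *
    Complex.I_sq

/-! ### Dyadic decomposition of the frequencies -/

theorem exists_mem_annulus (k : ℤ × ℤ) : ∃ j, k ∈ annulus j := by
  classical
  have hex : ∃ j : ℕ, k.1 ^ 2 + k.2 ^ 2 < ((2 : ℤ) ^ (j + 1)) ^ 2 := by
    refine ⟨(k.1 ^ 2 + k.2 ^ 2).toNat, ?_⟩
    set m := (k.1 ^ 2 + k.2 ^ 2).toNat with hm
    have h0 : (m : ℤ) = k.1 ^ 2 + k.2 ^ 2 := Int.toNat_of_nonneg (by positivity)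
    have h1 : (m : ℤ) < 2 ^ (m + 1) := by
      exact_mod_cast (Nat.lt_two_pow_self).trans_le (Nat.pow_le_pow_right (by norm_num) (Nat.le_succ m))
    rw [← h0]
    nlinarith
  refine ⟨Nat.find hex, (mem_annulus _ _).mpr ⟨?_, Nat.find_spec hex⟩⟩
  rcases Nat.eq_zero_or_pos (Nat.find hex) with h | h
  · exact Or.inl h
  · right
    have := Nat.find_min hex (m := Nat.find hex - 1) (by lia)
    rw [Nat.sub_add_cancel h] at this
    exact not_lt.mp this

theorem annulus_unique {k : ℤ × ℤ} {i j : ℕ} (hi : k ∈ annulus i) (hj : k ∈ annulus j) : i = j := by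
  have key : ∀ {i j : ℕ}, k ∈ annulus i → k ∈ annulus j → i ≤ j := by
    intro i j hi hj
    by_contra! hlt
    have h1 := ((mem_annulus _ _).mp hi).1.resolve_left (by lia)
    have h2 := ((mem_annulus _ _).mp hj).2
    have h3 : (2 : ℤ) ^ (j + 1) ≤ 2 ^ i := pow_le_pow_right₀ (by norm_num) hlt
    have h4 : ((2 : ℤ) ^ (j + 1)) ^ 2 ≤ (2 ^ i) ^ 2 := by gcongr
    linarith
  exact le_antisymm (key hi hj) (key hj hi)

/-- The dyadic index of a frequency. -/
def idx (k : ℤ × ℤ) : ℕ := (exists_mem_annulus k).choose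

theorem mem_annulus_idx (k : ℤ × ℤ) : k ∈ annulus (idx k) := (exists_mem_annulus k).choose_spec

theorem mem_annulus_iff_idx {k : ℤ × ℤ} {j : ℕ} : k ∈ annulus j ↔ idx k = j :=
  ⟨fun h => annulus_unique (mem_annulus_idx k) h, fun h => h ▸ mem_annulus_idx k⟩

/-- The Euclidean length of a frequency. -/
def len (k : ℤ × ℤ) : ℝ := ‖(⟨k.1, k.2⟩ : ℂ)‖

theorem len_sq (k : ℤ × ℤ) : len k ^ 2 = (k.1 : ℝ) ^ 2 + (k.2 : ℝ) ^ 2 := by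
  rw [len, Complex.sq_norm, Complex.normSq_mk]
  ring

theorem len_nonneg (k : ℤ × ℤ) : 0 ≤ len k := norm_nonneg _

theorem len_neg (k : ℤ × ℤ) : len (-k) = len k := by
  rw [len, len, ← norm_neg]
  congr 1
  apply Complex.ext <;> simp

theorem abs_fst_le_len (k : ℤ × ℤ) : |(k.1 : ℝ)| ≤ len k :=
  Complex.abs_re_le_norm (⟨k.1, k.2⟩ : ℂ)

theorem abs_snd_le_len (k : ℤ × ℤ) : |(k.2 : ℝ)| ≤ len k :=
  Complex.abs_im_le_norm (⟨k.1, k.2⟩ : ℂ)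

theorem len_add_le (k l : ℤ × ℤ) : len (k + l) ≤ len k + len l := by
  refine (le_of_eq ?_).trans (norm_add_le (⟨k.1, k.2⟩ : ℂ) (⟨l.1, l.2⟩ : ℂ))
  rw [len]
  congr 1
  apply Complex.ext <;> simp

theorem abs_len_sub_len_le (k l : ℤ × ℤ) : |len k - len l| ≤ len (k - l) := by
  refine (abs_norm_sub_norm_le (⟨k.1, k.2⟩ : ℂ) (⟨l.1, l.2⟩ : ℂ)).trans (le_of_eq ?_)
  rw [len]
  congr 1
  apply Complex.ext <;> simp

theorem len_lt_of_mem_annulus {k : ℤ × ℤ} {j : ℕ} (hk : k ∈ annulus j) : len k < 2 * 2 ^ j := by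
  have h := ((mem_annulus _ _).mp hk).2
  have h' : (k.1 : ℝ) ^ 2 + (k.2 : ℝ) ^ 2 < ((2 : ℝ) ^ (j + 1)) ^ 2 := by exact_mod_cast h
  rw [← len_sq, pow_succ' (2 : ℝ) j] at h'
  exact lt_of_pow_lt_pow_left₀ 2 (by positivity) h'

theorem le_len_of_mem_annulus {k : ℤ × ℤ} {j : ℕ} (hk : k ∈ annulus j) (hj : j ≠ 0) :
    2 ^ j ≤ len k := by
  have h := ((mem_annulus _ _).mp hk).1.resolve_left hj
  have h' : ((2 : ℝ) ^ j) ^ 2 ≤ (k.1 : ℝ) ^ 2 + (k.2 : ℝ) ^ 2 := by exact_mod_cast h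
  rw [← len_sq] at h'
  exact (pow_le_pow_iff_left₀ (by positivity) (len_nonneg k) two_ne_zero).mp h'

/-! ### A Lipschitz weight adapted to a dyadic annulus -/

/-- A weight that equals `1` on the annulus of `2 ^ n` and vanishes unless
`2 ^ n / 2 < |k| < 3 * 2 ^ n`. -/
def wt (n : ℕ) (k : ℤ × ℤ) : ℝ :=
  max 0 (min 1 (min (if n = 0 then 1 else 2 * (len k / 2 ^ n) - 1) (3 - len k / 2 ^ n)))

theorem wt_nonneg (n : ℕ) (k : ℤ × ℤ) : 0 ≤ wt n k := le_max_left _ _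

theorem wt_le_one (n : ℕ) (k : ℤ × ℤ) : wt n k ≤ 1 := max_le zero_le_one (min_le_left _ _)

theorem wt_neg (n : ℕ) (k : ℤ × ℤ) : wt n (-k) = wt n k := by rw [wt, wt, len_neg]

theorem wt_eq_one {n : ℕ} {k : ℤ × ℤ} (hk : k ∈ annulus n) : wt n k = 1 := by
  have h2 : (0 : ℝ) < 2 ^ n := by positivity
  have h3 : len k / 2 ^ n ≤ 2 := by
    rw [div_le_iff₀ h2]; exact (len_lt_of_mem_annulus hk).le
  have h4 : (1 : ℝ) ≤ if n = 0 then 1 else 2 * (len k / 2 ^ n) - 1 := by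
    split_ifs with h
    · exact le_rfl
    · have : 1 ≤ len k / 2 ^ n := by rw [le_div_iff₀ h2, one_mul]; exact le_len_of_mem_annulus hk h
      linarith
  rw [wt, min_eq_left (le_min h4 (by linarith)), max_eq_right zero_le_one]

theorem abs_wt_sub_wt_le (n : ℕ) (k l : ℤ × ℤ) :
    |wt n k - wt n l| ≤ 2 / 2 ^ n * len (k - l) := by
  have h2 : (0 : ℝ) < 2 ^ n := by positivity
  have hd : |len k / 2 ^ n - len l / 2 ^ n| ≤ 1 / 2 ^ n * len (k - l) := by
    rw [← sub_div, abs_div, abs_of_pos h2, one_div_mul_eq_div]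
    gcongr
    exact abs_len_sub_len_le k l
  have hnn : 0 ≤ 1 / 2 ^ n * len (k - l) := (abs_nonneg _).trans hd
  have e : 2 / 2 ^ n * len (k - l) = 2 * (1 / 2 ^ n * len (k - l)) := by ring
  rw [e]
  refine (abs_max_sub_max_le_max _ _ _ _).trans (max_le (by simpa using hnn) ?_)
  refine (abs_min_sub_min_le_max _ _ _ _).trans (max_le (by simpa using hnn) ?_)
  refine (abs_min_sub_min_le_max _ _ _ _).trans (max_le ?_ ?_)
  · split_ifs
    · simpa using hnn
    · rw [show 2 * (len k / 2 ^ n) - 1 - (2 * (len l / 2 ^ n) - 1) =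
        2 * (len k / 2 ^ n - len l / 2 ^ n) by ring, abs_mul, abs_two]
      gcongr
  · rw [show 3 - len k / 2 ^ n - (3 - len l / 2 ^ n) = -(len k / 2 ^ n - len l / 2 ^ n) by ring,
      abs_neg]
    linarith

theorem wt_ne_zero {n : ℕ} {k : ℤ × ℤ} (h : wt n k ≠ 0) :
    (n = 0 ∨ 2 ^ n < 2 * len k) ∧ len k < 3 * 2 ^ n := by
  have h2 : (0 : ℝ) < 2 ^ n := by positivity
  have hpos : 0 < wt n k := lt_of_le_of_ne (wt_nonneg n k) (Ne.symm h)
  rw [wt, lt_max_iff, lt_min_iff, lt_min_iff] at hpos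
  obtain ⟨-, h3, h4⟩ := hpos.resolve_left (lt_irrefl _)
  constructor
  · split_ifs at h3 with h0
    · exact Or.inl h0
    · right
      have : 1 < 2 * len k / 2 ^ n := by rw [mul_div_assoc]; linarith
      rwa [one_lt_div h2] at this
  · have : len k / 2 ^ n < 3 := by linarith
    rwa [div_lt_iff₀ h2] at this

/-- Dyadic indices that differ by at most one. -/
def Near (i j : ℕ) : Prop := i ≤ j + 1 ∧ j ≤ i + 1

theorem near_of_wt_ne_zero {n j : ℕ} {k : ℤ × ℤ} (hk : k ∈ annulus j) (h : wt n k ≠ 0) :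
    Near n j := by
  obtain ⟨h1, h2⟩ := wt_ne_zero h
  constructor
  · rcases h1 with h1 | h1
    · lia
    · have h3 := len_lt_of_mem_annulus hk
      have h4 : (2 : ℝ) ^ n < 2 ^ (j + 2) := by rw [pow_add]; linarith
      have := (pow_lt_pow_iff_right₀ (by norm_num : (1 : ℝ) < 2)).mp h4
      lia
  · rcases eq_or_ne j 0 with rfl | hj
    · lia
    · have h3 := le_len_of_mem_annulus hk hj
      have h4 : (2 : ℝ) ^ j < 2 ^ (n + 2) := by
        have : (0 : ℝ) < 2 ^ n := by positivity
        rw [pow_add]; linarith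
      have := (pow_lt_pow_iff_right₀ (by norm_num : (1 : ℝ) < 2)).mp h4
      lia

/-- The symbol `wt n k * k₁`. -/
def sym (n : ℕ) (k : ℤ × ℤ) : ℝ := wt n k * k.1

theorem sym_neg (n : ℕ) (k : ℤ × ℤ) : sym n (-k) = -sym n k := by
  simp [sym, wt_neg]

theorem abs_sym_sub_sym_le (n : ℕ) (k l : ℤ × ℤ) : |sym n k - sym n l| ≤ 7 * len (k - l) := by
  have h2 : (0 : ℝ) < 2 ^ n := by positivity
  have key : ∀ k l : ℤ × ℤ, wt n l ≠ 0 → |sym n k - sym n l| ≤ 7 * len (k - l) := by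
    intro k l hl
    have hll := (wt_ne_zero hl).2
    have e : sym n k - sym n l = wt n k * ((k.1 : ℝ) - l.1) + (wt n k - wt n l) * l.1 := by
      rw [sym, sym]; ring
    rw [e]
    have h1 : |(k.1 : ℝ) - l.1| ≤ len (k - l) := by
      have := abs_fst_le_len (k - l)
      simpa using this
    have h3 : |wt n k * ((k.1 : ℝ) - l.1)| ≤ 1 * len (k - l) := by
      rw [abs_mul, abs_of_nonneg (wt_nonneg n k)]
      gcongr
      exact wt_le_one n k
    have h4 : |(wt n k - wt n l) * l.1| ≤ 2 / 2 ^ n * len (k - l) * (3 * 2 ^ n) := by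
      rw [abs_mul]
      gcongr
      · exact mul_nonneg (by positivity) (len_nonneg _)
      · exact abs_wt_sub_wt_le n k l
      · exact (abs_fst_le_len l).trans hll.le
    have h5 : 2 / 2 ^ n * len (k - l) * (3 * 2 ^ n) = 6 * len (k - l) := by
      field_simp
      ring
    exact (abs_add_le _ _).trans (by linarith)
  by_cases hl : wt n l = 0
  · by_cases hk : wt n k = 0
    · simp only [sym, hl, hk, zero_mul, sub_zero, abs_zero]
      have := len_nonneg (k - l)
      positivity
    · rw [abs_sub_comm, ← len_neg, neg_sub]
      exact key l k hk
  · exact key k l hl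

theorem abs_sym_add_sym_le (n : ℕ) {p q r : ℤ × ℤ} (h : p + q + r = 0) :
    |sym n q + sym n r| ≤ 7 * len p := by
  have h1 := abs_sym_sub_sym_le n q (-r)
  rw [sym_neg, sub_neg_eq_add, sub_neg_eq_add] at h1
  have : q + r = -p := by
    rw [eq_neg_iff_add_eq_zero, ← h]; abel
  rwa [this, len_neg] at h1

theorem abs_sym_le (n : ℕ) (k : ℤ × ℤ) : |sym n k| ≤ 7 * len k := by
  have := abs_sym_sub_sym_le n k 0
  simpa [sym] using this

theorem abs_sym_le_const (n : ℕ) (k : ℤ × ℤ) : |sym n k| ≤ 3 * 2 ^ n := by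
  by_cases h : wt n k = 0
  · simp [sym, h]
  · rw [sym, abs_mul, abs_of_nonneg (wt_nonneg n k)]
    calc wt n k * |(k.1 : ℝ)| ≤ 1 * (3 * 2 ^ n) := by
          gcongr
          · exact wt_le_one n k
          · exact (abs_fst_le_len k).trans (wt_ne_zero h).2.le
      _ = _ := one_mul _

theorem abs_sym_add_add_le (n : ℕ) {p q r : ℤ × ℤ} (h : p + q + r = 0) :
    |sym n p + sym n q + sym n r| ≤ 14 * len p := by
  have h1 := abs_sym_add_sym_le n h
  have h2 := abs_sym_le n p
  rw [add_assoc]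
  exact (abs_add_le _ _).trans (by linarith)

/-- A box that contains the support of `wt n`. -/
def box (n : ℕ) : Finset (ℤ × ℤ) :=
  Finset.Icc (-(3 * 2 ^ n)) (3 * 2 ^ n) ×ˢ Finset.Icc (-(3 * 2 ^ n)) (3 * 2 ^ n)

theorem mem_box_of_wt_ne_zero {n : ℕ} {k : ℤ × ℤ} (h : wt n k ≠ 0) : k ∈ box n := by
  have h1 := (wt_ne_zero h).2
  have h2 := (abs_fst_le_len k).trans h1.le
  have h3 := (abs_snd_le_len k).trans h1.le
  rw [box, Finset.mem_product, Finset.mem_Icc, Finset.mem_Icc, ← abs_le, ← abs_le]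
  exact ⟨by exact_mod_cast h2, by exact_mod_cast h3⟩

/-! ### The cubic form in the energy identity -/

/-- The cubic form that gives the time derivative of the weighted energy. -/
def theta (n : ℕ) (z c : ℤ × ℤ → ℂ) : ℂ :=
  ∑ k ∈ box n, Complex.I * sym n k * c (-k) * ∑' l, z l * c (k - l)

/-- The sum of `M(p, q, r) f(p) g(q) h(r)` over all `p + q + r = 0`. -/
def triSeries (M : ℤ × ℤ → ℤ × ℤ → ℤ × ℤ → ℂ) (f g h : ℤ × ℤ → ℂ) : ℂ :=
  ∑' w : (ℤ × ℤ) × (ℤ × ℤ), M w.1 w.2 (-w.1 - w.2) * f w.1 * g w.2 * h (-w.1 - w.2)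

theorem norm_le_tsum_norm {c : ℤ × ℤ → ℂ} (hc : Summable c) (k : ℤ × ℤ) :
    ‖c k‖ ≤ ∑' l, ‖c l‖ :=
  hc.norm.le_tsum k fun _ _ => norm_nonneg _

theorem summable_triSeries {M : ℤ × ℤ → ℤ × ℤ → ℤ × ℤ → ℂ} {C : ℝ} (hM : ∀ p q r, ‖M p q r‖ ≤ C)
    {f g h : ℤ × ℤ → ℂ} (hf : Summable f) (hg : Summable g) (hh : Summable h) :
    Summable fun w : (ℤ × ℤ) × (ℤ × ℤ) =>
      M w.1 w.2 (-w.1 - w.2) * f w.1 * g w.2 * h (-w.1 - w.2) := by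
  refine Summable.of_norm_bounded ((hf.norm.mul_of_nonneg hg.norm (fun _ => norm_nonneg _)
    (fun _ => norm_nonneg _)).mul_left (C * ∑' l, ‖h l‖)) fun w => ?_
  have hC : 0 ≤ C := (norm_nonneg _).trans (hM 0 0 0)
  rw [norm_mul, norm_mul, norm_mul]
  calc _ ≤ C * ‖f w.1‖ * ‖g w.2‖ * ∑' l, ‖h l‖ := by
        gcongr
        · exact hM _ _ _
        · exact norm_le_tsum_norm hh _
    _ = _ := by ring

theorem summable_mul_comp_sub {z c : ℤ × ℤ → ℂ} (hz : Summable z) (hc : Summable c) (k : ℤ × ℤ) :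
    Summable fun l => z l * c (k - l) := by
  refine Summable.of_norm_bounded (hz.norm.mul_right (∑' l, ‖c l‖)) fun l => ?_
  rw [norm_mul]
  gcongr
  exact norm_le_tsum_norm hc _

theorem theta_add (n : ℕ) {z z' c : ℤ × ℤ → ℂ} (hz : Summable z) (hz' : Summable z')
    (hc : Summable c) : theta n (z + z') c = theta n z c + theta n z' c := by
  simp only [theta, ← Finset.sum_add_distrib]
  refine Finset.sum_congr rfl fun k _ => ?_
  rw [← mul_add, ← (summable_mul_comp_sub hz hc k).tsum_add (summable_mul_comp_sub hz' hc k)]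
  simp only [Pi.add_apply, add_mul]

theorem theta_eq_tsum (n : ℕ) {z c : ℤ × ℤ → ℂ} (hz : Summable z) (hc : Summable c) :
    Summable (fun w : (ℤ × ℤ) × (ℤ × ℤ) =>
      Complex.I * sym n w.1 * c (-w.1) * (z w.2 * c (w.1 - w.2))) ∧
    theta n z c = ∑' w : (ℤ × ℤ) × (ℤ × ℤ),
      Complex.I * sym n w.1 * c (-w.1) * (z w.2 * c (w.1 - w.2)) := by
  have hcn : Summable fun k => ‖c (-k)‖ := (Equiv.neg (ℤ × ℤ)).summable_iff.mpr hc.norm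
  have hs : Summable (fun w : (ℤ × ℤ) × (ℤ × ℤ) =>
      Complex.I * sym n w.1 * c (-w.1) * (z w.2 * c (w.1 - w.2))) := by
    refine Summable.of_norm_bounded ((hcn.mul_of_nonneg hz.norm (fun _ => norm_nonneg _)
      (fun _ => norm_nonneg _)).mul_left (3 * 2 ^ n * ∑' l, ‖c l‖)) fun w => ?_
    simp only [norm_mul, Complex.norm_I, one_mul, Complex.norm_real, Real.norm_eq_abs]
    calc _ ≤ 3 * 2 ^ n * ‖c (-w.1)‖ * (‖z w.2‖ * ∑' l, ‖c l‖) := by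
          gcongr
          · exact abs_sym_le_const n _
          · exact norm_le_tsum_norm hc _
      _ = _ := by ring
  refine ⟨hs, ?_⟩
  rw [hs.tsum_prod, theta, tsum_eq_sum (s := box n)]
  · exact Finset.sum_congr rfl fun k _ => tsum_mul_left.symm
  · intro k hk
    have : wt n k = 0 := by
      by_contra h
      exact hk (mem_box_of_wt_ne_zero h)
    simp [sym, this]

theorem theta_eq_triSeries_snd (n : ℕ) {z c : ℤ × ℤ → ℂ} (hz : Summable z) (hc : Summable c) :
    theta n z c = triSeries (fun _ q _ => -Complex.I * sym n q) z c c := by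
  rw [(theta_eq_tsum n hz hc).2, triSeries]
  let e : (ℤ × ℤ) × (ℤ × ℤ) ≃ (ℤ × ℤ) × (ℤ × ℤ) :=
    { toFun := fun w => (-w.2, w.1)
      invFun := fun w => (w.2, -w.1)
      left_inv := fun w => by simp
      right_inv := fun w => by simp }
  rw [← e.tsum_eq]
  refine tsum_congr fun w => ?_
  simp only [e, Equiv.coe_fn_mk, sym_neg, neg_neg]
  rw [show -w.2 - w.1 = -w.1 - w.2 by abel]
  push_cast
  ring

theorem theta_eq_triSeries_thd (n : ℕ) {z c : ℤ × ℤ → ℂ} (hz : Summable z) (hc : Summable c) :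
    theta n z c = triSeries (fun _ _ r => -Complex.I * sym n r) z c c := by
  rw [(theta_eq_tsum n hz hc).2, triSeries]
  let e : (ℤ × ℤ) × (ℤ × ℤ) ≃ (ℤ × ℤ) × (ℤ × ℤ) :=
    { toFun := fun w => (w.1 + w.2, w.1)
      invFun := fun w => (w.2, w.1 - w.2)
      left_inv := fun w => by simp
      right_inv := fun w => by simp }
  rw [← e.tsum_eq]
  refine tsum_congr fun w => ?_
  simp only [e, Equiv.coe_fn_mk]
  rw [show -w.1 - w.2 = -(w.1 + w.2) by abel, sym_neg, show w.1 + w.2 - w.1 = w.2 by abel]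
  push_cast
  ring

theorem theta_eq_triSeries_fst (n : ℕ) {c : ℤ × ℤ → ℂ} (hc : Summable c) :
    theta n c c = triSeries (fun p _ _ => -Complex.I * sym n p) c c c := by
  rw [theta_eq_triSeries_snd n hc hc, triSeries, triSeries,
    ← (Equiv.prodComm (ℤ × ℤ) (ℤ × ℤ)).tsum_eq]
  refine tsum_congr fun w => ?_
  simp only [Equiv.prodComm_apply, Prod.fst_swap, Prod.snd_swap]
  rw [show -w.2 - w.1 = -w.1 - w.2 by abel]
  ring

theorem norm_neg_I_mul_sym_le (n : ℕ) (k : ℤ × ℤ) : ‖-Complex.I * sym n k‖ ≤ 3 * 2 ^ n := by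
  rw [norm_mul, norm_neg, Complex.norm_I, one_mul, Complex.norm_real]
  exact abs_sym_le_const n k

/-- The symbol of the cubic form after symmetrization in the last two frequencies. -/
def halfSym (n : ℕ) (_ q r : ℤ × ℤ) : ℂ := -Complex.I * sym n q / 2 + -Complex.I * sym n r / 2

/-- The symbol of the cubic form after symmetrization in all frequencies. -/
def fullSym (n : ℕ) (p q r : ℤ × ℤ) : ℂ :=
  -Complex.I * sym n p / 3 + -Complex.I * sym n q / 3 + -Complex.I * sym n r / 3

theorem theta_eq_triSeries_halfSym (n : ℕ) {z c : ℤ × ℤ → ℂ} (hz : Summable z) (hc : Summable c) :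
    theta n z c = triSeries (halfSym n) z c c := by
  have s1 := summable_triSeries (M := fun _ q _ => -Complex.I * sym n q)
    (fun _ q _ => norm_neg_I_mul_sym_le n q) hz hc hc
  have s2 := summable_triSeries (M := fun _ _ r => -Complex.I * sym n r)
    (fun _ _ r => norm_neg_I_mul_sym_le n r) hz hc hc
  have h : theta n z c = theta n z c / 2 + theta n z c / 2 := by ring
  rw [h]
  nth_rewrite 1 [theta_eq_triSeries_snd n hz hc]
  rw [theta_eq_triSeries_thd n hz hc]
  simp only [triSeries]
  rw [← tsum_div_const, ← tsum_div_const, ← (s1.div_const 2).tsum_add (s2.div_const 2)]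
  refine tsum_congr fun w => ?_
  rw [halfSym]
  ring

theorem theta_eq_triSeries_fullSym (n : ℕ) {c : ℤ × ℤ → ℂ} (hc : Summable c) :
    theta n c c = triSeries (fullSym n) c c c := by
  have s0 := summable_triSeries (M := fun p _ _ => -Complex.I * sym n p)
    (fun p _ _ => norm_neg_I_mul_sym_le n p) hc hc hc
  have s1 := summable_triSeries (M := fun _ q _ => -Complex.I * sym n q)
    (fun _ q _ => norm_neg_I_mul_sym_le n q) hc hc hc
  have s2 := summable_triSeries (M := fun _ _ r => -Complex.I * sym n r)
    (fun _ _ r => norm_neg_I_mul_sym_le n r) hc hc hc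
  have h : theta n c c = theta n c c / 3 + theta n c c / 3 + theta n c c / 3 := by ring
  rw [h]
  nth_rewrite 1 [theta_eq_triSeries_fst n hc]
  nth_rewrite 1 [theta_eq_triSeries_snd n hc hc]
  rw [theta_eq_triSeries_thd n hc hc]
  simp only [triSeries]
  rw [← tsum_div_const, ← tsum_div_const, ← tsum_div_const,
    ← (s0.div_const 3).tsum_add (s1.div_const 3),
    ← ((s0.div_const 3).add (s1.div_const 3)).tsum_add (s2.div_const 3)]
  refine tsum_congr fun w => ?_
  rw [fullSym]
  ring

theorem norm_halfSym_le_const (n : ℕ) (p q r : ℤ × ℤ) : ‖halfSym n p q r‖ ≤ 3 * 2 ^ n := by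
  refine (norm_add_le _ _).trans ?_
  have h1 := norm_neg_I_mul_sym_le n q
  have h2 := norm_neg_I_mul_sym_le n r
  rw [norm_div, norm_div, RCLike.norm_ofNat]
  linarith

theorem norm_fullSym_le_const (n : ℕ) (p q r : ℤ × ℤ) : ‖fullSym n p q r‖ ≤ 3 * 2 ^ n := by
  refine (norm_add₃_le).trans ?_
  have h0 := norm_neg_I_mul_sym_le n p
  have h1 := norm_neg_I_mul_sym_le n q
  have h2 := norm_neg_I_mul_sym_le n r
  rw [norm_div, norm_div, norm_div, RCLike.norm_ofNat]
  linarith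

theorem enorm_triSeries_le {M : ℤ × ℤ → ℤ × ℤ → ℤ × ℤ → ℂ} {C : ℝ} (hM : ∀ p q r, ‖M p q r‖ ≤ C)
    {f g h : ℤ × ℤ → ℂ} (hf : Summable f) (hg : Summable g) (hh : Summable h) :
    ‖triSeries M f g h‖ₑ ≤ ∑' J : ℕ × ℕ × ℕ,
      ‖triSum (annulus J.1) (annulus J.2.1) (annulus J.2.2) M f g h‖ₑ := by
  classical
  set φ : (ℤ × ℤ) × (ℤ × ℤ) → ℕ × ℕ × ℕ := fun w => (idx w.1, idx w.2, idx (-w.1 - w.2)) with hφ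
  have hs := summable_triSeries hM hf hg hh
  have h1 := hs.hasSum.tsum_fiberwise φ
  refine (enorm_le_tsum_enorm_of_hasSum h1).trans (le_of_eq (tsum_congr fun J => ?_))
  congr 1
  obtain ⟨j₁, j₂, j₃⟩ := J
  have hset : φ ⁻¹' {(j₁, j₂, j₃)} =
      ((annulus j₁ ×ˢ annulus j₂).filter fun w => -w.1 - w.2 ∈ annulus j₃ :
        Finset ((ℤ × ℤ) × (ℤ × ℤ))) := by
    ext w
    simp [hφ, mem_annulus_iff_idx, and_assoc]
  rw [hset, Finset.tsum_subtype' _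
    (fun w : (ℤ × ℤ) × (ℤ × ℤ) => M w.1 w.2 (-w.1 - w.2) * f w.1 * g w.2 * h (-w.1 - w.2)),
    Finset.sum_filter,
    Finset.sum_product, triSum]
  refine Finset.sum_congr rfl fun p _ => Finset.sum_congr rfl fun q _ => ?_
  have e : ∀ r : ℤ × ℤ, p + q + r = 0 ↔ r = -p - q := by
    intro r
    constructor
    · intro h
      rw [eq_neg_of_add_eq_zero_right h]
      abel
    · rintro rfl
      abel
  simp only [e, Finset.sum_ite_eq']

/-! ### The energy inequality -/

theorem continuousOn_theta {T : ℝ} (hT : 0 < T) {z v : ℝ → Torus → ℝ} (hz : SmoothOn T z)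
    (hv : SmoothOn T v) (n : ℕ) :
    ContinuousOn (fun t => theta n (coeff (z t)) (coeff (v t))) (Icc 0 T) := by
  obtain ⟨b, hb, hb0, hbz⟩ := exists_summable_coeff_bound hT hz
  obtain ⟨b', hb', hb0', hbv⟩ := exists_summable_coeff_bound hT hv
  refine continuousOn_finsetSum _ fun k _ => (continuousOn_const.mul (continuousOn_coeff hv _)).mul ?_
  refine continuousOn_tsum (u := fun l => b l * ∑' m, b' m)
    (fun l => (continuousOn_coeff hz l).mul (continuousOn_coeff hv _)) (hb.mul_right _) ?_
  intro l t ht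
  rw [norm_mul]
  gcongr
  · exact hb0 l
  · exact hbz t ht l
  · exact (hbv t ht _).trans (hb'.le_tsum _ fun m _ => hb0' m)

theorem hasDerivAt_energy {z v : ℝ → Torus → ℝ} {t : ℝ}
    (heq : ∀ k, HasDerivAt (fun t => coeff (v t) k) (Complex.I * phase k * coeff (v t) k +
      Complex.I * k.1 / 2 * ∑' l, coeff (z t) l * coeff (v t) (k - l)) t) (n : ℕ) :
    HasDerivAt (fun t => ∑ k ∈ box n, wt n k * ‖coeff (v t) k‖ ^ 2)
      (theta n (coeff (z t)) (coeff (v t))).re t := by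
  have h := HasDerivAt.fun_sum fun k (_ : k ∈ box n) => ((heq k).norm_sq.const_mul (wt n k))
  refine h.congr_deriv ?_
  rw [theta, Complex.re_sum]
  symm
  refine Finset.sum_congr rfl fun k _ => ?_
  rw [Complex.inner, coeff_neg_freq, sym]
  set c := coeff (v t) k
  set S := ∑' l, coeff (z t) l * coeff (v t) (k - l)
  have e : (Complex.I * phase k * c + Complex.I * k.1 / 2 * S) * starRingEnd ℂ c =
      Complex.I * ((phase k * ‖c‖ ^ 2 : ℝ) : ℂ) +
        ((1 / 2 : ℝ) : ℂ) * (Complex.I * k.1 * starRingEnd ℂ c * S) := by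
    have := Complex.mul_conj' c
    push_cast
    linear_combination (Complex.I * phase k) * this
  have e' : Complex.I * ((wt n k * k.1 : ℝ) : ℂ) * starRingEnd ℂ c * S =
      ((wt n k : ℝ) : ℂ) * (Complex.I * k.1 * starRingEnd ℂ c * S) := by
    push_cast
    ring
  rw [e, e', Complex.add_re, Complex.re_ofReal_mul, Complex.re_ofReal_mul, Complex.I_mul_re,
    Complex.ofReal_im]
  ring

theorem energy_le {T : ℝ} (hT : 0 < T) {z v : ℝ → Torus → ℝ} (hz : SmoothOn T z)
    (hv : SmoothOn T v)
    (heq : ∀ t ∈ Ioo 0 T, ∀ k, HasDerivAt (fun t => coeff (v t) k)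
      (Complex.I * phase k * coeff (v t) k +
        Complex.I * k.1 / 2 * ∑' l, coeff (z t) l * coeff (v t) (k - l)) t)
    (n : ℕ) {t : ℝ} (ht : t ∈ Icc 0 T) :
    ENNReal.ofReal (∑ k ∈ box n, wt n k * ‖coeff (v t) k‖ ^ 2) ≤
      ENNReal.ofReal (∑ k ∈ box n, wt n k * ‖coeff (v 0) k‖ ^ 2) +
        ∫⁻ τ in Ico 0 T, ‖theta n (coeff (z τ)) (coeff (v τ))‖ₑ := by
  have hsub : Icc 0 t ⊆ Icc 0 T := Icc_subset_Icc_right ht.2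
  have hcont : ContinuousOn (fun t => ∑ k ∈ box n, wt n k * ‖coeff (v t) k‖ ^ 2) (Icc 0 t) :=
    continuousOn_finsetSum _ fun k _ => continuousOn_const.mul
      (((continuousOn_coeff hv k).mono hsub).norm.pow 2)
  have hre : ContinuousOn (fun τ => (theta n (coeff (z τ)) (coeff (v τ))).re) (Icc 0 t) :=
    Complex.continuous_re.comp_continuousOn ((continuousOn_theta hT hz hv n).mono hsub)
  have hftc := intervalIntegral.integral_eq_sub_of_hasDerivAt_of_le ht.1 hcont
    (fun τ hτ => hasDerivAt_energy (heq τ ⟨hτ.1, hτ.2.trans_le ht.2⟩) n)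
    (hre.intervalIntegrable_of_Icc ht.1)
  set E := fun t => ∑ k ∈ box n, wt n k * ‖coeff (v t) k‖ ^ 2 with hE
  change ENNReal.ofReal (E t) ≤ ENNReal.ofReal (E 0) + _
  have h1 : E t = E 0 + ∫ τ in (0)..t, (theta n (coeff (z τ)) (coeff (v τ))).re := by
    rw [hftc]; ring
  rw [h1]
  refine ENNReal.ofReal_add_le.trans ?_
  gcongr
  refine (ENNReal.ofReal_le_ofReal (le_abs_self _)).trans ?_
  rw [← Real.norm_eq_abs, ofReal_norm, intervalIntegral.integral_of_le ht.1,
    restrict_Ico_eq_restrict_Ioc]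
  refine (enorm_integral_le_lintegral_enorm _).trans ?_
  refine (lintegral_mono_set (Ioc_subset_Ioc_right ht.2)).trans (lintegral_mono fun τ => ?_)
  rw [← ofReal_norm, ← ofReal_norm]
  exact ENNReal.ofReal_le_ofReal (Complex.abs_re_le_norm _)

theorem enorm_proj_sq (n : ℕ) (f : Torus → ℝ) :
    ‖proj n f‖ₑ ^ 2 = ENNReal.ofReal (∑ k ∈ annulus n, ‖coeff f k‖ ^ 2) := by
  rw [← ofReal_norm, ← ENNReal.ofReal_pow (norm_nonneg _)]
  congr 1
  have h := orthonormal_characterL2.inner_sum (coeff f) (coeff f) (annulus n)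
  have h2 : ((‖proj n f‖ ^ 2 : ℝ) : ℂ) = ((∑ k ∈ annulus n, ‖coeff f k‖ ^ 2 : ℝ) : ℂ) := by
    have h3 := inner_self_eq_norm_sq_to_K (𝕜 := ℂ) (proj n f)
    rw [Complex.ofReal_pow]
    refine Eq.trans h3.symm ?_
    rw [proj, h]
    push_cast
    exact Finset.sum_congr rfl fun k _ => Complex.conj_mul' _
  exact_mod_cast h2

theorem enorm_proj_sq_le_energy (n : ℕ) (f : Torus → ℝ) :
    ‖proj n f‖ₑ ^ 2 ≤ ENNReal.ofReal (∑ k ∈ box n, wt n k * ‖coeff f k‖ ^ 2) := by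
  rw [enorm_proj_sq]
  refine ENNReal.ofReal_le_ofReal ?_
  calc ∑ k ∈ annulus n, ‖coeff f k‖ ^ 2 = ∑ k ∈ annulus n, wt n k * ‖coeff f k‖ ^ 2 := by
        refine Finset.sum_congr rfl fun k hk => ?_
        rw [wt_eq_one hk, one_mul]
    _ ≤ _ := by
        refine Finset.sum_le_sum_of_subset_of_nonneg (fun k hk => ?_) fun k _ _ =>
          mul_nonneg (wt_nonneg n k) (sq_nonneg _)
        refine mem_box_of_wt_ne_zero ?_
        rw [wt_eq_one hk]
        exact one_ne_zero

theorem enorm_proj_sq_le {T : ℝ} (hT : 0 < T) {z v : ℝ → Torus → ℝ} (hz : SmoothOn T z)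
    (hv : SmoothOn T v)
    (heq : ∀ t ∈ Ioo 0 T, ∀ k, HasDerivAt (fun t => coeff (v t) k)
      (Complex.I * phase k * coeff (v t) k +
        Complex.I * k.1 / 2 * ∑' l, coeff (z t) l * coeff (v t) (k - l)) t) (n : ℕ) :
    ⨆ t ∈ Icc 0 T, ‖proj n (v t)‖ₑ ^ 2 ≤
      ENNReal.ofReal (∑ k ∈ box n, wt n k * ‖coeff (v 0) k‖ ^ 2) +
        ∫⁻ τ in Ico 0 T, ‖theta n (coeff (z τ)) (coeff (v τ))‖ₑ :=
  iSup₂_le fun _ ht => (enorm_proj_sq_le_energy n _).trans (energy_le hT hz hv heq n ht)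

/-! ### Estimates of the cubic form -/

/-- Triples of dyadic indices that carry frequencies with sum zero. -/
def Admissible (J : ℕ × ℕ × ℕ) : Prop :=
  J.1 ≤ max J.2.1 J.2.2 + 1 ∧ J.2.1 ≤ max J.1 J.2.2 + 1 ∧ J.2.2 ≤ max J.1 J.2.1 + 1

theorem le_max_add_one {i j l : ℕ} {p q r : ℤ × ℤ} (hp : p ∈ annulus i) (hq : q ∈ annulus j)
    (hr : r ∈ annulus l) (h : p + q + r = 0) : i ≤ max j l + 1 := by
  rcases eq_or_ne i 0 with rfl | hi
  · lia
  have h1 := le_len_of_mem_annulus hp hi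
  have h2 := len_lt_of_mem_annulus hq
  have h3 := len_lt_of_mem_annulus hr
  have h4 : len p ≤ len q + len r := by
    have : p = -(q + r) := by
      rw [eq_neg_iff_add_eq_zero, ← h]; abel
    rw [this, len_neg]
    exact len_add_le q r
  have h5 : (2 : ℝ) ^ j ≤ 2 ^ max j l := pow_le_pow_right₀ (by norm_num) (le_max_left _ _)
  have h6 : (2 : ℝ) ^ l ≤ 2 ^ max j l := pow_le_pow_right₀ (by norm_num) (le_max_right _ _)
  have h7 : (2 : ℝ) ^ i < 2 ^ (max j l + 2) := by
    rw [pow_add]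
    linarith
  have := (pow_lt_pow_iff_right₀ (by norm_num : (1 : ℝ) < 2)).mp h7
  lia

theorem admissible_of_add_eq_zero {J : ℕ × ℕ × ℕ} {p q r : ℤ × ℤ} (hp : p ∈ annulus J.1)
    (hq : q ∈ annulus J.2.1) (hr : r ∈ annulus J.2.2) (h : p + q + r = 0) : Admissible J :=
  ⟨le_max_add_one hp hq hr h, le_max_add_one hq hp hr (by rw [← h]; abel),
    le_max_add_one hr hp hq (by rw [← h]; abel)⟩

theorem lintegral_triSeries_le {T : ℝ} (hT : 0 < T) {M : ℤ × ℤ → ℤ × ℤ → ℤ × ℤ → ℂ} {C : ℝ}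
    (hM : ∀ p q r, ‖M p q r‖ ≤ C) {z v : ℝ → Torus → ℝ} (hz : SmoothOn T z) (hv : SmoothOn T v) :
    ∫⁻ t in Ico 0 T, ‖triSeries M (coeff (z t)) (coeff (v t)) (coeff (v t))‖ₑ ≤
      ∑' J : ℕ × ℕ × ℕ, ∫⁻ t in Ico 0 T, ‖triSum (annulus J.1) (annulus J.2.1) (annulus J.2.2) M
        (coeff (z t)) (coeff (v t)) (coeff (v t))‖ₑ := by
  rw [← lintegral_tsum]
  · refine setLIntegral_mono' measurableSet_Ico fun t ht => ?_
    have ht' := Ico_subset_Icc_self ht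
    have s := summable_coeff hT hv ht'
    exact enorm_triSeries_le hM (summable_coeff hT hz ht') s s
  · intro J
    refine (ContinuousOn.aemeasurable ?_ measurableSet_Ico).enorm
    have hc : ∀ {w : ℝ → Torus → ℝ}, SmoothOn T w → ∀ k,
        ContinuousOn (fun t => coeff (w t) k) (Ico 0 T) :=
      fun hw k => (continuousOn_coeff hw k).mono Ico_subset_Icc_self
    unfold triSum
    refine continuousOn_finsetSum _ fun p _ => continuousOn_finsetSum _ fun q _ =>
      continuousOn_finsetSum _ fun r _ => ?_
    split_ifs
    · exact ((continuousOn_const.mul (hc hz p)).mul (hc hv q)).mul (hc hv r)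
    · exact continuousOn_const

theorem lintegral_triSum_coeff_le_of_imp {T : ℝ} (hT : T ≤ 1)
    {M : ℤ × ℤ → ℤ × ℤ → ℤ × ℤ → ℂ} (J : ℕ × ℕ × ℕ) {μ : ℝ≥0} (hμ : 0 < μ)
    (hM : ∀ p ∈ annulus J.1, ∀ q ∈ annulus J.2.1, ∀ r ∈ annulus J.2.2, p + q + r = 0 →
      ‖M p q r‖ ≤ μ)
    {P : Prop} [Decidable P] (hP : ∀ p ∈ annulus J.1, ∀ q ∈ annulus J.2.1, ∀ r ∈ annulus J.2.2,
      p + q + r = 0 → M p q r ≠ 0 → P) (z v : ℝ → Torus → ℝ) :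
    ∫⁻ t in Ico 0 T, ‖triSum (annulus J.1) (annulus J.2.1) (annulus J.2.2) M
        (coeff (z t)) (coeff (v t)) (coeff (v t))‖ₑ ≤
      if P then triConst * μ * ((2 : ℝ≥0∞) ^ min J.1 (min J.2.1 J.2.2)) ^ (1 / 2 : ℝ) *
        (shortNorm T z J.1 * shortNorm T v J.2.1 * shortNorm T v J.2.2) else 0 := by
  split_ifs with h
  · exact lintegral_triSum_coeff_le M hμ hM hT z v v
  · refine le_of_eq (setLIntegral_eq_zero measurableSet_Ico fun t _ => ?_)
    rw [Pi.zero_apply, enorm_eq_zero]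
    refine Finset.sum_eq_zero fun p hp => Finset.sum_eq_zero fun q hq =>
      Finset.sum_eq_zero fun r hr => ?_
    split_ifs with h0
    · have : M p q r = 0 := by
        by_contra hne
        exact h (hP p hp q hq r hr h0 hne)
      simp [this]
    · rfl

theorem sym_ne_zero_near {n j : ℕ} {k : ℤ × ℤ} (hk : k ∈ annulus j) (h : sym n k ≠ 0) : Near n j :=
  near_of_wt_ne_zero hk fun h0 => h (by simp [sym, h0])

theorem norm_halfSym_le {n j : ℕ} {p q r : ℤ × ℤ} (hp : p ∈ annulus j) (h : p + q + r = 0) :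
    ‖halfSym n p q r‖ ≤ 14 * 2 ^ j := by
  have e : halfSym n p q r = -Complex.I * ((sym n q + sym n r : ℝ) : ℂ) / 2 := by
    rw [halfSym]; push_cast; ring
  rw [e, norm_div, norm_mul, norm_neg, Complex.norm_I, one_mul, Complex.norm_real,
    RCLike.norm_ofNat, Real.norm_eq_abs]
  have h1 := abs_sym_add_sym_le n h
  have h2 := len_lt_of_mem_annulus hp
  have h3 : (0 : ℝ) < 2 ^ j := by positivity
  linarith

theorem norm_fullSym_le {n : ℕ} {J : ℕ × ℕ × ℕ} {p q r : ℤ × ℤ} (hp : p ∈ annulus J.1)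
    (hq : q ∈ annulus J.2.1) (hr : r ∈ annulus J.2.2) (h : p + q + r = 0) :
    ‖fullSym n p q r‖ ≤ 14 * 2 ^ min J.1 (min J.2.1 J.2.2) := by
  have e : fullSym n p q r = -Complex.I * ((sym n p + sym n q + sym n r : ℝ) : ℂ) / 3 := by
    rw [fullSym]; push_cast; ring
  rw [e, norm_div, norm_mul, norm_neg, Complex.norm_I, one_mul, Complex.norm_real,
    RCLike.norm_ofNat, Real.norm_eq_abs]
  have key : ∀ j k, k ∈ annulus j → |sym n p + sym n q + sym n r| ≤ 14 * len k →
      |sym n p + sym n q + sym n r| / 3 ≤ 14 * 2 ^ j := by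
    intro j k hk h1
    have h2 := len_lt_of_mem_annulus hk
    have h3 : (0 : ℝ) < 2 ^ j := by positivity
    linarith
  rcases min_choice J.1 (min J.2.1 J.2.2) with h1 | h1
  · rw [h1]
    exact key _ p hp (abs_sym_add_add_le n h)
  rw [h1]
  rcases min_choice J.2.1 J.2.2 with h2 | h2
  · rw [h2]
    refine key _ q hq ?_
    rw [add_comm (sym n p) (sym n q)]
    exact abs_sym_add_add_le n (by rw [← h]; abel)
  · rw [h2]
    refine key _ r hr ?_
    rw [add_comm _ (sym n r), ← add_assoc]
    exact abs_sym_add_add_le n (by rw [← h]; abel)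

/-- The dyadic contribution in the estimate of the energy, up to the size of the symbol. -/
def dyadicTerm (T : ℝ) (z v : ℝ → Torus → ℝ) (m : ℕ) (J : ℕ × ℕ × ℕ) : ℝ≥0∞ :=
  triConst * 14 * 2 ^ m * ((2 : ℝ≥0∞) ^ min J.1 (min J.2.1 J.2.2)) ^ (1 / 2 : ℝ) *
    (shortNorm T z J.1 * shortNorm T v J.2.1 * shortNorm T v J.2.2)

open Classical in
theorem lintegral_theta_half_le {T : ℝ} (hT : 0 < T) (hT1 : T ≤ 1) {z v : ℝ → Torus → ℝ}
    (hz : SmoothOn T z) (hv : SmoothOn T v) (n : ℕ) :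
    ∫⁻ t in Ico 0 T, ‖theta n (coeff (z t)) (coeff (v t))‖ₑ ≤ ∑' J : ℕ × ℕ × ℕ,
      if Admissible J ∧ (Near n J.2.1 ∨ Near n J.2.2) then dyadicTerm T z v J.1 J else 0 := by
  have h1 : ∫⁻ t in Ico 0 T, ‖theta n (coeff (z t)) (coeff (v t))‖ₑ =
      ∫⁻ t in Ico 0 T, ‖triSeries (halfSym n) (coeff (z t)) (coeff (v t)) (coeff (v t))‖ₑ := by
    refine setLIntegral_congr_fun measurableSet_Ico fun t ht => ?_
    have ht' := Ico_subset_Icc_self ht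
    simp only [theta_eq_triSeries_halfSym n (summable_coeff hT hz ht') (summable_coeff hT hv ht')]
  rw [h1]
  refine (lintegral_triSeries_le hT (norm_halfSym_le_const n) hz hv).trans
    (ENNReal.tsum_le_tsum fun J => ?_)
  have := lintegral_triSum_coeff_le_of_imp hT1 (M := halfSym n) J (μ := 14 * 2 ^ J.1)
    (by positivity) (fun p hp q _ r _ h0 => by
      have := norm_halfSym_le (n := n) hp h0
      exact_mod_cast this)
    (P := Admissible J ∧ (Near n J.2.1 ∨ Near n J.2.2))
    (fun p hp q hq r hr h0 hne => ⟨admissible_of_add_eq_zero hp hq hr h0, by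
      by_contra! hc
      apply hne
      have e1 : sym n q = 0 := by
        by_contra h; exact hc.1 (sym_ne_zero_near hq h)
      have e2 : sym n r = 0 := by
        by_contra h; exact hc.2 (sym_ne_zero_near hr h)
      simp [halfSym, e1, e2]⟩) z v
  refine this.trans (le_of_eq ?_)
  simp only [dyadicTerm, ENNReal.coe_mul, ENNReal.coe_ofNat, ENNReal.coe_pow, mul_assoc]

open Classical in
theorem lintegral_theta_full_le {T : ℝ} (hT : 0 < T) (hT1 : T ≤ 1) {v : ℝ → Torus → ℝ}
    (hv : SmoothOn T v) (n : ℕ) :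
    ∫⁻ t in Ico 0 T, ‖theta n (coeff (v t)) (coeff (v t))‖ₑ ≤ ∑' J : ℕ × ℕ × ℕ,
      if Admissible J ∧ (Near n J.1 ∨ Near n J.2.1 ∨ Near n J.2.2) then
        dyadicTerm T v v (min J.1 (min J.2.1 J.2.2)) J else 0 := by
  have h1 : ∫⁻ t in Ico 0 T, ‖theta n (coeff (v t)) (coeff (v t))‖ₑ =
      ∫⁻ t in Ico 0 T, ‖triSeries (fullSym n) (coeff (v t)) (coeff (v t)) (coeff (v t))‖ₑ := by
    refine setLIntegral_congr_fun measurableSet_Ico fun t ht => ?_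
    have ht' := Ico_subset_Icc_self ht
    simp only [theta_eq_triSeries_fullSym n (summable_coeff hT hv ht')]
  rw [h1]
  refine (lintegral_triSeries_le hT (norm_fullSym_le_const n) hv hv).trans
    (ENNReal.tsum_le_tsum fun J => ?_)
  have := lintegral_triSum_coeff_le_of_imp hT1 (M := fullSym n) J
    (μ := 14 * 2 ^ min J.1 (min J.2.1 J.2.2))
    (by positivity) (fun p hp q hq r hr h0 => by
      have := norm_fullSym_le (n := n) hp hq hr h0
      exact_mod_cast this)
    (P := Admissible J ∧ (Near n J.1 ∨ Near n J.2.1 ∨ Near n J.2.2))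
    (fun p hp q hq r hr h0 hne => ⟨admissible_of_add_eq_zero hp hq hr h0, by
      by_contra! hc
      apply hne
      have e0 : sym n p = 0 := by
        by_contra h; exact hc.1 (sym_ne_zero_near hp h)
      have e1 : sym n q = 0 := by
        by_contra h; exact hc.2.1 (sym_ne_zero_near hq h)
      have e2 : sym n r = 0 := by
        by_contra h; exact hc.2.2 (sym_ne_zero_near hr h)
      simp [fullSym, e0, e1, e2]⟩) v v
  refine this.trans (le_of_eq ?_)
  simp only [dyadicTerm, ENNReal.coe_mul, ENNReal.coe_ofNat, ENNReal.coe_pow, mul_assoc]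

/-! ### Summation over dyadic indices -/

/-- The dyadic weight `N ^ σ`, `N = 2 ^ j`. -/
def dyad (σ : ℝ) (j : ℕ) : ℝ≥0∞ := ((2 : ℝ≥0∞) ^ j) ^ σ

theorem dyad_add (σ τ : ℝ) (j : ℕ) : dyad (σ + τ) j = dyad σ j * dyad τ j :=
  ENNReal.rpow_add _ _ (by positivity) (by finiteness)

theorem dyad_one (j : ℕ) : dyad 1 j = 2 ^ j := ENNReal.rpow_one _

theorem dyad_mono {σ : ℝ} (hσ : 0 ≤ σ) {i j : ℕ} (h : i ≤ j) : dyad σ i ≤ dyad σ j :=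
  ENNReal.rpow_le_rpow (pow_le_pow_right₀ one_le_two h) hσ

theorem dyad_anti {σ : ℝ} (hσ : σ ≤ 0) {i j : ℕ} (h : i ≤ j) : dyad σ j ≤ dyad σ i := by
  have := ENNReal.inv_le_inv.mpr (dyad_mono (neg_nonneg.mpr hσ) h)
  rwa [dyad, dyad, ENNReal.rpow_neg, ENNReal.rpow_neg, inv_inv, inv_inv] at this

theorem dyad_le_of_le_add_one {σ : ℝ} (hσ : 0 ≤ σ) {i j : ℕ} (h : i ≤ j + 1) :
    dyad σ i ≤ 2 ^ σ * dyad σ j := by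
  refine (dyad_mono hσ h).trans (le_of_eq ?_)
  rw [dyad, pow_succ', ENNReal.mul_rpow_of_nonneg _ _ hσ, dyad]

theorem dyad_two_mul (σ : ℝ) (j : ℕ) : dyad (2 * σ) j = dyad σ j * dyad σ j := by
  rw [two_mul, dyad_add]

/-- Weights at comparable indices can be distributed. -/
theorem dyad_two_mul_le {σ : ℝ} (hσ : 0 ≤ σ) {i j l : ℕ} (hij : i ≤ j + 1) (hil : i ≤ l + 1) :
    dyad (2 * σ) i ≤ 2 ^ (2 * σ) * (dyad σ j * dyad σ l) := by
  rw [dyad_two_mul, two_mul σ, ENNReal.rpow_add _ _ (by norm_num) (by norm_num)]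
  calc dyad σ i * dyad σ i ≤ (2 ^ σ * dyad σ j) * (2 ^ σ * dyad σ l) :=
        mul_le_mul' (dyad_le_of_le_add_one hσ hij) (dyad_le_of_le_add_one hσ hil)
    _ = _ := by ring

theorem tsum_dyad_ne_top {σ : ℝ} (hσ : σ < 0) : ∑' j, dyad σ j ≠ ⊤ := by
  have h : ∀ j, dyad σ j = ((2 : ℝ≥0∞) ^ σ) ^ j := fun j => by
    rw [dyad, ← ENNReal.rpow_natCast, ← ENNReal.rpow_mul, mul_comm, ENNReal.rpow_mul,
      ENNReal.rpow_natCast]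
  simp_rw [h]
  rw [ENNReal.tsum_geometric]
  have : (2 : ℝ≥0∞) ^ σ < 1 := ENNReal.rpow_lt_one_of_one_lt_of_neg (by norm_num) hσ
  exact ENNReal.inv_ne_top.mpr (tsub_pos_of_lt this).ne'

open Classical in
theorem tsum_dyad_near_le {σ : ℝ} (hσ : 0 ≤ σ) (j : ℕ) :
    ∑' n, dyad σ n * (if Near n j then 1 else 0) ≤ 3 * 2 ^ σ * dyad σ j := by
  have h : ∀ n ∉ Finset.Icc (j - 1) (j + 1), dyad σ n * (if Near n j then (1 : ℝ≥0∞) else 0) = 0 := by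
    intro n hn
    rw [if_neg, mul_zero]
    rintro ⟨h1, h2⟩
    exact hn (Finset.mem_Icc.mpr ⟨by lia, h1⟩)
  rw [tsum_eq_sum h]
  calc ∑ n ∈ Finset.Icc (j - 1) (j + 1), dyad σ n * (if Near n j then (1 : ℝ≥0∞) else 0)
      ≤ ∑ n ∈ Finset.Icc (j - 1) (j + 1), 2 ^ σ * dyad σ j := by
        refine Finset.sum_le_sum fun n hn => ?_
        refine (mul_le_of_le_one_right' (by split_ifs <;> simp)).trans ?_
        exact dyad_le_of_le_add_one hσ (Finset.mem_Icc.mp hn).2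
    _ ≤ _ := by
        rw [Finset.sum_const, nsmul_eq_mul, mul_assoc]
        gcongr
        rw [Nat.card_Icc]
        exact_mod_cast (by lia : j + 1 + 1 - (j - 1) ≤ 3)

theorem tsum_mul_le_sqrt (y w : ℕ → ℝ≥0∞) :
    ∑' j, y j * w j ≤ (∑' j, y j ^ 2) ^ (1 / 2 : ℝ) * (∑' j, w j ^ 2) ^ (1 / 2 : ℝ) := by
  have h := ENNReal.lintegral_mul_le_Lp_mul_Lq (Measure.count : Measure ℕ)
    Real.HolderConjugate.two_two (f := y) (g := w) measurable_from_nat.aemeasurable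
    measurable_from_nat.aemeasurable
  simpa [lintegral_count] using h

open Classical in
theorem tsum_near_le (y w : ℕ → ℝ≥0∞) :
    ∑' j, ∑' l, (if Near j l then y j * w l else 0) ≤
      3 * ((∑' j, y j ^ 2) ^ (1 / 2 : ℝ) * (∑' j, w j ^ 2) ^ (1 / 2 : ℝ)) := by
  have hshift : ∀ a : ℕ → ℝ≥0∞, ∑' j, a (j + 1) ≤ ∑' j, a j := fun a =>
    ENNReal.tsum_comp_le_tsum_of_injective (add_left_injective 1) a
  have hpt : ∀ j l, (if Near j l then y j * w l else 0) ≤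
      (if l = j then y j * w l else 0) + (if l = j + 1 then y j * w l else 0) +
        (if j = l + 1 then y j * w l else 0) := by
    intro j l
    by_cases h : Near j l
    · obtain ⟨h1, h2⟩ := h
      rw [if_pos ⟨h1, h2⟩]
      rcases (by lia : l = j ∨ l = j + 1 ∨ j = l + 1) with h | h | h
      · simp [h]
      · simp [h]
      · rw [if_pos h]; exact le_add_self
    · rw [if_neg h]; exact zero_le
  refine (ENNReal.tsum_le_tsum fun j => ENNReal.tsum_le_tsum fun l => hpt j l).trans ?_
  simp_rw [ENNReal.tsum_add]
  rw [ENNReal.tsum_comm (f := fun j l => if j = l + 1 then y j * w l else 0)]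
  simp_rw [tsum_ite_eq]
  have h1 := tsum_mul_le_sqrt y w
  have h2 := tsum_mul_le_sqrt y fun j => w (j + 1)
  have h3 := tsum_mul_le_sqrt (fun j => y (j + 1)) w
  have h2' : (∑' j, w (j + 1) ^ 2) ^ (1 / 2 : ℝ) ≤ (∑' j, w j ^ 2) ^ (1 / 2 : ℝ) :=
    ENNReal.rpow_le_rpow (hshift fun j => w j ^ 2) (by norm_num)
  have h3' : (∑' j, y (j + 1) ^ 2) ^ (1 / 2 : ℝ) ≤ (∑' j, y j ^ 2) ^ (1 / 2 : ℝ) :=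
    ENNReal.rpow_le_rpow (hshift fun j => y j ^ 2) (by norm_num)
  calc _ ≤ (∑' j, y j ^ 2) ^ (1 / 2 : ℝ) * (∑' j, w j ^ 2) ^ (1 / 2 : ℝ) +
        (∑' j, y j ^ 2) ^ (1 / 2 : ℝ) * (∑' j, w j ^ 2) ^ (1 / 2 : ℝ) +
        (∑' j, y j ^ 2) ^ (1 / 2 : ℝ) * (∑' j, w j ^ 2) ^ (1 / 2 : ℝ) := by
        refine add_le_add (add_le_add h1 (h2.trans ?_)) (h3.trans ?_)
        · gcongr
        · gcongr
    _ = _ := by ring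

open Classical in
/-- The term of a paraproduct with low index `i` and comparable indices `j`, `l`. -/
def paraTerm (x y w : ℕ → ℝ≥0∞) (i j l : ℕ) : ℝ≥0∞ := if Near j l then x i * (y j * w l) else 0

/-- The bound for the sum of a paraproduct. -/
def paraBound (x y w : ℕ → ℝ≥0∞) : ℝ≥0∞ :=
  3 * ((∑' j, x j) * ((∑' j, y j ^ 2) ^ (1 / 2 : ℝ) * (∑' j, w j ^ 2) ^ (1 / 2 : ℝ)))

theorem tsum_tsum_paraTerm_le (x y w : ℕ → ℝ≥0∞) :
    ∑' i, ∑' j, ∑' l, paraTerm x y w i j l ≤ paraBound x y w := by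
  classical
  have h : ∀ i j l, paraTerm x y w i j l = x i * (if Near j l then y j * w l else 0) := by
    intro i j l
    rw [paraTerm]
    split_ifs <;> simp
  simp_rw [h, ENNReal.tsum_mul_left, ENNReal.tsum_mul_right]
  rw [paraBound, mul_left_comm]
  gcongr
  exact tsum_near_le y w

theorem tsum_paraTerm_fst_le (x y w : ℕ → ℝ≥0∞) :
    ∑' J : ℕ × ℕ × ℕ, paraTerm x y w J.1 J.2.1 J.2.2 ≤ paraBound x y w := by
  refine le_of_eq_of_le ?_ (tsum_tsum_paraTerm_le x y w)
  rw [ENNReal.tsum_prod']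
  exact tsum_congr fun i => ENNReal.tsum_prod'

theorem tsum_paraTerm_snd_le (x y w : ℕ → ℝ≥0∞) :
    ∑' J : ℕ × ℕ × ℕ, paraTerm x y w J.2.1 J.1 J.2.2 ≤ paraBound x y w := by
  let e : ℕ × ℕ × ℕ ≃ ℕ × ℕ × ℕ :=
    ⟨fun J => (J.2.1, J.1, J.2.2), fun J => (J.2.1, J.1, J.2.2), fun _ => rfl, fun _ => rfl⟩
  exact (e.tsum_eq fun J => paraTerm x y w J.1 J.2.1 J.2.2).trans_le (tsum_paraTerm_fst_le x y w)

theorem tsum_paraTerm_thd_le (x y w : ℕ → ℝ≥0∞) :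
    ∑' J : ℕ × ℕ × ℕ, paraTerm x y w J.2.2 J.1 J.2.1 ≤ paraBound x y w := by
  let e : ℕ × ℕ × ℕ ≃ ℕ × ℕ × ℕ :=
    ⟨fun J => (J.2.2, J.1, J.2.1), fun J => (J.2.1, J.2.2, J.1), fun _ => rfl, fun _ => rfl⟩
  exact (e.tsum_eq fun J => paraTerm x y w J.1 J.2.1 J.2.2).trans_le (tsum_paraTerm_fst_le x y w)

theorem Admissible.cases {J : ℕ × ℕ × ℕ} (h : Admissible J) :
    (J.1 ≤ J.2.1 ∧ J.1 ≤ J.2.2 ∧ Near J.2.1 J.2.2) ∨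
      (J.2.1 ≤ J.1 ∧ J.2.1 ≤ J.2.2 ∧ Near J.1 J.2.2) ∨
      (J.2.2 ≤ J.1 ∧ J.2.2 ≤ J.2.1 ∧ Near J.1 J.2.1) := by
  obtain ⟨i, j, l⟩ := J
  obtain ⟨h1, h2, h3⟩ := h
  simp only [Near] at *
  omega

/-! ### The norms as weighted sums -/

/-- The weighted dyadic pieces of the short-time norm. -/
def piece (σ T : ℝ) (u : ℝ → Torus → ℝ) (j : ℕ) : ℝ≥0∞ := dyad σ j * shortNorm T u j

theorem Fnorm_eq (σ T : ℝ) (u : ℝ → Torus → ℝ) :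
    Fnorm σ T u = (∑' j, piece σ T u j ^ 2) ^ (1 / 2 : ℝ) := by
  rw [Fnorm]
  congr 1
  refine tsum_congr fun j => ?_
  rw [piece, mul_pow, sq (dyad σ j), ← dyad_two_mul, dyad, shortNorm]
  congr 1
  have e : ∀ x : ℝ≥0∞, x ^ 2 = ENNReal.orderIsoRpow 2 two_pos x := fun x => by
    rw [ENNReal.orderIsoRpow_apply, ← ENNReal.rpow_natCast]
    norm_num
  simp_rw [e, OrderIso.map_iSup]

theorem piece_le_Fnorm (σ T : ℝ) (u : ℝ → Torus → ℝ) (j : ℕ) : piece σ T u j ≤ Fnorm σ T u := by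
  rw [Fnorm_eq]
  calc piece σ T u j = (piece σ T u j ^ 2) ^ (1 / 2 : ℝ) := by
        rw [← ENNReal.rpow_natCast, ← ENNReal.rpow_mul]; norm_num
    _ ≤ _ := ENNReal.rpow_le_rpow (ENNReal.le_tsum j) (by norm_num)

theorem tsum_piece_le (σ τ T : ℝ) (u : ℝ → Torus → ℝ) :
    ∑' j, piece (σ + τ) T u j ≤ (∑' j, dyad τ j) * Fnorm σ T u := by
  rw [← ENNReal.tsum_mul_right]
  refine ENNReal.tsum_le_tsum fun j => ?_
  rw [piece, dyad_add, mul_comm (dyad σ j), mul_assoc]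
  gcongr
  exact piece_le_Fnorm σ T u j

/-- The constant of the summation over the low index. -/
def lowConst (s : ℝ) : ℝ≥0∞ := ∑' j, dyad (3 / 2 - s) j

theorem paraBound_piece_le (s τ σ₁ σ₂ T : ℝ) (u v w : ℝ → Torus → ℝ) :
    paraBound (piece (τ + (3 / 2 - s)) T u) (piece σ₁ T v) (piece σ₂ T w) ≤
      3 * lowConst s * (Fnorm τ T u * (Fnorm σ₁ T v * Fnorm σ₂ T w)) := by
  rw [paraBound, ← Fnorm_eq, ← Fnorm_eq, lowConst]
  calc _ ≤ 3 * (((∑' j, dyad (3 / 2 - s) j) * Fnorm τ T u) *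
        (Fnorm σ₁ T v * Fnorm σ₂ T w)) := by
        gcongr
        exact tsum_piece_le τ (3 / 2 - s) T u
    _ = _ := by ring

/-! ### The cubic estimates in the short-time norms -/

open Classical in
theorem tsum_dyad_mul_tsum_le {σ : ℝ} (hσ : 0 ≤ σ) (D : ℕ × ℕ × ℕ → ℝ≥0∞) :
    ∑' n, dyad (2 * σ) n * ∑' J : ℕ × ℕ × ℕ,
      (if Admissible J ∧ (Near n J.1 ∨ Near n J.2.1 ∨ Near n J.2.2) then D J else 0) ≤
    ∑' J : ℕ × ℕ × ℕ, if Admissible J then 3 * 2 ^ (2 * σ) *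
      (dyad (2 * σ) J.1 + dyad (2 * σ) J.2.1 + dyad (2 * σ) J.2.2) * D J else 0 := by
  simp_rw [← ENNReal.tsum_mul_left]
  rw [ENNReal.tsum_comm]
  refine ENNReal.tsum_le_tsum fun J => ?_
  by_cases hJ : Admissible J
  swap
  · simp [hJ]
  have hpt : ∀ n, dyad (2 * σ) n * (if Admissible J ∧ (Near n J.1 ∨ Near n J.2.1 ∨ Near n J.2.2)
      then D J else 0) ≤ (dyad (2 * σ) n * (if Near n J.1 then 1 else 0) +
        dyad (2 * σ) n * (if Near n J.2.1 then 1 else 0) +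
        dyad (2 * σ) n * (if Near n J.2.2 then 1 else 0)) * D J := by
    intro n
    rw [← mul_add, ← mul_add, mul_assoc]
    gcongr
    split_ifs <;> simp_all [add_mul, add_assoc]
  refine (ENNReal.tsum_le_tsum hpt).trans ?_
  rw [if_pos hJ, ENNReal.tsum_mul_right, ENNReal.tsum_add, ENNReal.tsum_add]
  gcongr
  have h2 : 0 ≤ 2 * σ := by positivity
  rw [mul_add, mul_add]
  gcongr <;> exact tsum_dyad_near_le h2 _

theorem dyad_sum_le {σ : ℝ} (hσ : 0 ≤ σ) {i j l : ℕ} (hij : i ≤ j) (hil : i ≤ l)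
    (hjl : Near j l) : dyad (2 * σ) i + dyad (2 * σ) j + dyad (2 * σ) l ≤
      3 * 2 ^ (2 * σ) * (dyad σ j * dyad σ l) := by
  obtain ⟨h1, h2⟩ := hjl
  calc _ ≤ 2 ^ (2 * σ) * (dyad σ j * dyad σ l) + 2 ^ (2 * σ) * (dyad σ j * dyad σ l) +
        2 ^ (2 * σ) * (dyad σ j * dyad σ l) := by
        gcongr <;> apply dyad_two_mul_le hσ <;> lia
    _ = _ := by ring

theorem two_pow_mul_half (j : ℕ) (s : ℝ) :
    2 ^ j * ((2 : ℝ≥0∞) ^ j) ^ (1 / 2 : ℝ) = dyad (s + (3 / 2 - s)) j := by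
  change _ * dyad (1 / 2) j = _
  rw [← dyad_one, ← dyad_add]
  congr 1
  ring

theorem two_pow_mul_half_le {s : ℝ} (hs : 1 ≤ s) {i j : ℕ} (h : i ≤ j) :
    2 ^ j * ((2 : ℝ≥0∞) ^ i) ^ (1 / 2 : ℝ) ≤ dyad s j * dyad (0 + (3 / 2 - s)) i := by
  have e1 : (2 : ℝ≥0∞) ^ j = dyad s j * dyad (1 - s) j := by
    rw [← dyad_one, ← dyad_add]; congr 1; ring
  have e2 : dyad (0 + (3 / 2 - s)) i = dyad (1 - s) i * dyad (1 / 2) i := by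
    rw [← dyad_add]; congr 1; ring
  rw [e1, e2, mul_assoc]
  gcongr
  · exact dyad_anti (by linarith) h
  · exact le_rfl

/-- The constant in front of the weighted dyadic terms. -/
def termConst (σ : ℝ) : ℝ≥0∞ := 3 * 2 ^ (2 * σ) * (3 * 2 ^ (2 * σ)) * (triConst * 14)

/-- The constant of the cubic estimates. -/
def cubicConst (s σ : ℝ) : ℝ≥0∞ := termConst σ * (9 * lowConst s)

theorem cubicConst_ne_top {s : ℝ} (hs : 3 / 2 < s) {σ : ℝ} (hσ : 0 ≤ σ) : cubicConst s σ ≠ ⊤ := by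
  have h1 : lowConst s ≠ ⊤ := tsum_dyad_ne_top (by linarith)
  have h2 : (2 : ℝ≥0∞) ^ (2 * σ) ≠ ⊤ := ENNReal.rpow_ne_top_of_nonneg (by positivity) (by norm_num)
  rw [cubicConst, termConst]
  finiteness

/-- Bounds a weighted dyadic term by a paraproduct term. -/
theorem weighted_le_paraTerm {σ α β γ : ℝ} {i j l : ℕ} (hjl : Near j l) {W G a b c : ℝ≥0∞}
    {U V X : ℕ → ℝ≥0∞} {x y w : ℕ → ℝ≥0∞}
    (hx : x i = dyad α i * U i) (hy : y j = dyad β j * V j) (hw : w l = dyad γ l * X l)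
    (hW : W ≤ 3 * 2 ^ (2 * σ) * a) (hG : G ≤ b) (hc : a * b ≤ dyad α i * dyad β j * dyad γ l)
    (habc : c = U i * V j * X l) :
    3 * 2 ^ (2 * σ) * W * (triConst * 14 * G * c) ≤ termConst σ * paraTerm x y w i j l := by
  rw [paraTerm, if_pos hjl, hx, hy, hw, habc, termConst]
  calc _ ≤ 3 * 2 ^ (2 * σ) * (3 * 2 ^ (2 * σ) * a) * (triConst * 14 * b * (U i * V j * X l)) := by
        gcongr
    _ = 3 * 2 ^ (2 * σ) * (3 * 2 ^ (2 * σ)) * (triConst * 14) * (a * b) * (U i * V j * X l) := by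
        ring
    _ ≤ 3 * 2 ^ (2 * σ) * (3 * 2 ^ (2 * σ)) * (triConst * 14) *
        (dyad α i * dyad β j * dyad γ l) * (U i * V j * X l) := by gcongr
    _ = _ := by ring

open Classical in
theorem tsum_half_le {s σ : ℝ} (hs : 1 ≤ s) (hσ : 0 ≤ σ) (T : ℝ) (z v : ℝ → Torus → ℝ) :
    ∑' n, dyad (2 * σ) n * ∑' J : ℕ × ℕ × ℕ,
      (if Admissible J ∧ (Near n J.2.1 ∨ Near n J.2.2) then dyadicTerm T z v J.1 J else 0) ≤
    cubicConst s σ * (Fnorm s T z * Fnorm σ T v ^ 2 +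
      Fnorm 0 T v * Fnorm σ T v * Fnorm (σ + s) T z) := by
  set f₁ : ℕ × ℕ × ℕ → ℝ≥0∞ := fun J => paraTerm (piece (s + (3 / 2 - s)) T z) (piece σ T v)
    (piece σ T v) J.1 J.2.1 J.2.2 with hf₁
  set f₂ : ℕ × ℕ × ℕ → ℝ≥0∞ := fun J => paraTerm (piece (0 + (3 / 2 - s)) T v)
    (piece (σ + s) T z) (piece σ T v) J.2.1 J.1 J.2.2 with hf₂
  set f₃ : ℕ × ℕ × ℕ → ℝ≥0∞ := fun J => paraTerm (piece (0 + (3 / 2 - s)) T v)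
    (piece (σ + s) T z) (piece σ T v) J.2.2 J.1 J.2.1 with hf₃
  have hpt : ∀ J : ℕ × ℕ × ℕ, (if Admissible J then 3 * 2 ^ (2 * σ) *
      (dyad (2 * σ) J.1 + dyad (2 * σ) J.2.1 + dyad (2 * σ) J.2.2) * dyadicTerm T z v J.1 J
      else 0) ≤ termConst σ * f₁ J + termConst σ * f₂ J + termConst σ * f₃ J := by
    intro J
    split_ifs with hJ
    swap
    · exact zero_le
    rw [dyadicTerm, mul_assoc (triConst * 14 : ℝ≥0∞)]
    rcases hJ.cases with ⟨h1, h2, h3⟩ | ⟨h1, h2, h3⟩ | ⟨h1, h2, h3⟩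
    · refine le_trans ?_ (le_self_add.trans le_self_add)
      rw [min_eq_left (le_min h1 h2)]
      refine weighted_le_paraTerm h3 rfl rfl rfl (dyad_sum_le hσ h1 h2 h3)
        (two_pow_mul_half J.1 s).le (le_of_eq (by ring)) rfl
    · refine le_trans ?_ (le_add_self.trans le_self_add)
      rw [min_eq_right ((min_le_left _ _).trans h1), min_eq_left h2,
        add_comm (dyad (2 * σ) J.1)]
      refine weighted_le_paraTerm h3 rfl rfl rfl (dyad_sum_le hσ h1 h2 h3)
        (two_pow_mul_half_le hs h1) (le_of_eq (by rw [dyad_add σ s]; ring)) (by ring)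
    · refine le_trans ?_ le_add_self
      rw [min_eq_right ((min_le_right _ _).trans h1), min_eq_right h2,
        add_comm _ (dyad (2 * σ) J.2.2), ← add_assoc]
      refine weighted_le_paraTerm h3 rfl rfl rfl (dyad_sum_le hσ h1 h2 h3)
        (two_pow_mul_half_le hs h1) (le_of_eq (by rw [dyad_add σ s]; ring)) (by ring)
  have hweak : ∀ n, ∑' J : ℕ × ℕ × ℕ,
      (if Admissible J ∧ (Near n J.2.1 ∨ Near n J.2.2) then dyadicTerm T z v J.1 J else 0) ≤
      ∑' J : ℕ × ℕ × ℕ, (if Admissible J ∧ (Near n J.1 ∨ Near n J.2.1 ∨ Near n J.2.2) then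
        dyadicTerm T z v J.1 J else 0) := by
    intro n
    refine ENNReal.tsum_le_tsum fun J => ?_
    by_cases h : Admissible J ∧ (Near n J.2.1 ∨ Near n J.2.2)
    · rw [if_pos h, if_pos ⟨h.1, Or.inr h.2⟩]
    · rw [if_neg h]; exact zero_le
  calc _ ≤ _ := ENNReal.tsum_le_tsum fun n => mul_le_mul_right (hweak n) _
    _ ≤ _ := tsum_dyad_mul_tsum_le hσ _
    _ ≤ _ := ENNReal.tsum_le_tsum hpt
    _ = termConst σ * ∑' J, f₁ J + termConst σ * ∑' J, f₂ J + termConst σ * ∑' J, f₃ J := by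
        simp_rw [ENNReal.tsum_add, ENNReal.tsum_mul_left]
    _ ≤ termConst σ * (3 * lowConst s * (Fnorm s T z * (Fnorm σ T v * Fnorm σ T v))) +
        termConst σ * (3 * lowConst s * (Fnorm 0 T v * (Fnorm (σ + s) T z * Fnorm σ T v))) +
        termConst σ * (3 * lowConst s * (Fnorm 0 T v * (Fnorm (σ + s) T z * Fnorm σ T v))) := by
        gcongr
        · exact (tsum_paraTerm_fst_le _ _ _).trans (paraBound_piece_le _ _ _ _ _ _ _ _)
        · exact (tsum_paraTerm_snd_le _ _ _).trans (paraBound_piece_le _ _ _ _ _ _ _ _)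
        · exact (tsum_paraTerm_thd_le _ _ _).trans (paraBound_piece_le _ _ _ _ _ _ _ _)
    _ = termConst σ * (lowConst s * (3 * (Fnorm s T z * Fnorm σ T v ^ 2) +
        6 * (Fnorm 0 T v * Fnorm σ T v * Fnorm (σ + s) T z))) := by ring
    _ ≤ termConst σ * (lowConst s * (9 * (Fnorm s T z * Fnorm σ T v ^ 2) +
        9 * (Fnorm 0 T v * Fnorm σ T v * Fnorm (σ + s) T z))) := by
        gcongr <;> norm_num
    _ = _ := by rw [cubicConst]; ring

open Classical in
theorem tsum_full_le (s : ℝ) {σ : ℝ} (hσ : 0 ≤ σ) (T : ℝ) (v : ℝ → Torus → ℝ) :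
    ∑' n, dyad (2 * σ) n * ∑' J : ℕ × ℕ × ℕ,
      (if Admissible J ∧ (Near n J.1 ∨ Near n J.2.1 ∨ Near n J.2.2) then
        dyadicTerm T v v (min J.1 (min J.2.1 J.2.2)) J else 0) ≤
    cubicConst s σ * (Fnorm s T v * Fnorm σ T v ^ 2) := by
  set f : ℕ → ℕ → ℕ → ℝ≥0∞ := paraTerm (piece (s + (3 / 2 - s)) T v) (piece σ T v) (piece σ T v)
    with hf
  have hpt : ∀ J : ℕ × ℕ × ℕ, (if Admissible J then 3 * 2 ^ (2 * σ) *
      (dyad (2 * σ) J.1 + dyad (2 * σ) J.2.1 + dyad (2 * σ) J.2.2) *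
        dyadicTerm T v v (min J.1 (min J.2.1 J.2.2)) J else 0) ≤
      termConst σ * f J.1 J.2.1 J.2.2 + termConst σ * f J.2.1 J.1 J.2.2 +
        termConst σ * f J.2.2 J.1 J.2.1 := by
    intro J
    split_ifs with hJ
    swap
    · exact zero_le
    rw [dyadicTerm, mul_assoc (triConst * 14 : ℝ≥0∞)]
    rcases hJ.cases with ⟨h1, h2, h3⟩ | ⟨h1, h2, h3⟩ | ⟨h1, h2, h3⟩
    · refine le_trans ?_ (le_self_add.trans le_self_add)
      rw [min_eq_left (le_min h1 h2)]
      exact weighted_le_paraTerm h3 rfl rfl rfl (dyad_sum_le hσ h1 h2 h3)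
        (two_pow_mul_half J.1 s).le (le_of_eq (by ring)) rfl
    · refine le_trans ?_ (le_add_self.trans le_self_add)
      rw [min_eq_right ((min_le_left _ _).trans h1), min_eq_left h2,
        add_comm (dyad (2 * σ) J.1)]
      exact weighted_le_paraTerm h3 rfl rfl rfl (dyad_sum_le hσ h1 h2 h3)
        (two_pow_mul_half J.2.1 s).le (le_of_eq (by ring)) (by ring)
    · refine le_trans ?_ le_add_self
      rw [min_eq_right ((min_le_right _ _).trans h1), min_eq_right h2,
        add_comm _ (dyad (2 * σ) J.2.2), ← add_assoc]
      exact weighted_le_paraTerm h3 rfl rfl rfl (dyad_sum_le hσ h1 h2 h3)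
        (two_pow_mul_half J.2.2 s).le (le_of_eq (by ring)) (by ring)
  calc _ ≤ _ := tsum_dyad_mul_tsum_le hσ _
    _ ≤ _ := ENNReal.tsum_le_tsum hpt
    _ = termConst σ * ∑' J : ℕ × ℕ × ℕ, f J.1 J.2.1 J.2.2 +
        termConst σ * ∑' J : ℕ × ℕ × ℕ, f J.2.1 J.1 J.2.2 +
        termConst σ * ∑' J : ℕ × ℕ × ℕ, f J.2.2 J.1 J.2.1 := by
        simp_rw [ENNReal.tsum_add, ENNReal.tsum_mul_left]
    _ ≤ termConst σ * (3 * lowConst s * (Fnorm s T v * (Fnorm σ T v * Fnorm σ T v))) +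
        termConst σ * (3 * lowConst s * (Fnorm s T v * (Fnorm σ T v * Fnorm σ T v))) +
        termConst σ * (3 * lowConst s * (Fnorm s T v * (Fnorm σ T v * Fnorm σ T v))) := by
        gcongr
        · exact (tsum_paraTerm_fst_le _ _ _).trans (paraBound_piece_le _ _ _ _ _ _ _ _)
        · exact (tsum_paraTerm_snd_le _ _ _).trans (paraBound_piece_le _ _ _ _ _ _ _ _)
        · exact (tsum_paraTerm_thd_le _ _ _).trans (paraBound_piece_le _ _ _ _ _ _ _ _)
    _ = _ := by rw [cubicConst]; ring

/-! ### The initial data -/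

theorem tsum_initial_le {σ : ℝ} (hσ : 0 ≤ σ) (f : Torus → ℝ) :
    ∑' n, dyad (2 * σ) n * ENNReal.ofReal (∑ k ∈ box n, wt n k * ‖coeff f k‖ ^ 2) ≤
      3 * 2 ^ (2 * σ) * Hnorm σ f ^ 2 := by
  classical
  have h2 : 0 ≤ 2 * σ := by positivity
  have h1 : ∀ n, ENNReal.ofReal (∑ k ∈ box n, wt n k * ‖coeff f k‖ ^ 2) ≤
      ∑' k, (if Near n (idx k) then 1 else 0) * ‖coeff f k‖ₑ ^ 2 := by
    intro n
    rw [ENNReal.ofReal_sum_of_nonneg fun k _ => mul_nonneg (wt_nonneg n k) (sq_nonneg _)]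
    refine (Finset.sum_le_sum fun k _ => ?_).trans (ENNReal.sum_le_tsum (box n))
    rw [ENNReal.ofReal_mul (wt_nonneg n k), ENNReal.ofReal_pow (norm_nonneg _), ofReal_norm]
    gcongr
    split_ifs with h
    · exact ENNReal.ofReal_le_one.mpr (wt_le_one n k)
    · rw [nonpos_iff_eq_zero, ENNReal.ofReal_eq_zero]
      by_contra! h0
      exact h (near_of_wt_ne_zero (mem_annulus_idx k) h0.ne')
  have h3 : ∀ k : ℤ × ℤ, dyad (2 * σ) (idx k) ≤
      ENNReal.ofReal ((1 + (k.1 : ℝ) ^ 2 + (k.2 : ℝ) ^ 2) ^ σ) := by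
    intro k
    rw [← ENNReal.ofReal_rpow_of_nonneg (by positivity) hσ, dyad, ENNReal.rpow_mul]
    refine ENNReal.rpow_le_rpow ?_ hσ
    have e : ((2 : ℝ≥0∞) ^ idx k) ^ (2 : ℝ) = ENNReal.ofReal ((2 ^ idx k) ^ 2) := by
      rw [ENNReal.ofReal_pow (by positivity), ENNReal.ofReal_pow (by positivity),
        ENNReal.ofReal_ofNat]
      exact ENNReal.rpow_two _
    rw [e]
    refine ENNReal.ofReal_le_ofReal ?_
    rw [add_assoc, ← len_sq]
    rcases eq_or_ne (idx k) 0 with h0 | h0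
    · rw [h0]; nlinarith [sq_nonneg (len k)]
    · have := le_len_of_mem_annulus (mem_annulus_idx k) h0
      have : ((2 : ℝ) ^ idx k) ^ 2 ≤ len k ^ 2 := by gcongr
      linarith
  have h4 : Hnorm σ f ^ 2 = ∑' k : ℤ × ℤ,
      ENNReal.ofReal ((1 + (k.1 : ℝ) ^ 2 + (k.2 : ℝ) ^ 2) ^ σ) * ‖coeff f k‖ₑ ^ 2 := by
    rw [Hnorm, ← ENNReal.rpow_natCast, ← ENNReal.rpow_mul]
    norm_num
  calc _ ≤ ∑' n, dyad (2 * σ) n *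
        ∑' k, (if Near n (idx k) then 1 else 0) * ‖coeff f k‖ₑ ^ 2 :=
        ENNReal.tsum_le_tsum fun n => mul_le_mul_right (h1 n) _
    _ = ∑' k, (∑' n, dyad (2 * σ) n * (if Near n (idx k) then 1 else 0)) * ‖coeff f k‖ₑ ^ 2 := by
        simp_rw [← ENNReal.tsum_mul_left, ← ENNReal.tsum_mul_right, mul_assoc]
        exact ENNReal.tsum_comm
    _ ≤ ∑' k, (3 * 2 ^ (2 * σ) * dyad (2 * σ) (idx k)) * ‖coeff f k‖ₑ ^ 2 :=
        ENNReal.tsum_le_tsum fun k => mul_le_mul_left (tsum_dyad_near_le h2 _) _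
    _ ≤ _ := by
        simp_rw [mul_assoc (3 * 2 ^ (2 * σ) : ℝ≥0∞), ENNReal.tsum_mul_left]
        rw [h4]
        gcongr with k
        exact h3 k

theorem Hnorm_zero_le_L2norm {f : Torus → ℝ} (hf : Continuous f) : Hnorm 0 f ≤ L2norm f := by
  set F : C(Torus, ℂ) := ⟨fun p => (f p : ℂ), by fun_prop⟩ with hF
  set g : L2 := ContinuousMap.toLp 2 torusMeasure ℂ F with hg
  have hgF : g =ᵐ[torusMeasure] F := ContinuousMap.coeFn_toLp torusMeasure F
  have hc : ∀ k, coeff f k = inner ℂ (characterL2 k) g := by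
    intro k
    rw [L2.inner_def, coeff]
    have hk : characterL2 k =ᵐ[torusMeasure] character k :=
      ContinuousMap.coeFn_toLp torusMeasure (character k)
    refine integral_congr_ae ?_
    filter_upwards [hk, hgF] with p hp hp'
    rw [hp, hp', RCLike.inner_apply']
    rfl
  have hL : L2norm f = ‖g‖ₑ := by
    rw [L2norm, Lp.enorm_def]
    refine eLpNorm_congr_norm_ae ?_
    filter_upwards [hgF] with p hp
    rw [hp, hF]
    simp
  rw [hL, Hnorm]
  have hs : ∑' k, ‖coeff f k‖ₑ ^ 2 ≤ ‖g‖ₑ ^ 2 := by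
    have h0 : ∀ k, ‖coeff f k‖ₑ ^ 2 = ENNReal.ofReal (‖inner ℂ (characterL2 k) g‖ ^ 2) := fun k => by
      rw [hc, ENNReal.ofReal_pow (norm_nonneg _), ofReal_norm]
    simp_rw [h0]
    rw [← ENNReal.ofReal_tsum_of_nonneg (fun k => sq_nonneg _)
      (orthonormal_characterL2.inner_products_summable g), ← ofReal_norm,
      ← ENNReal.ofReal_pow (norm_nonneg _)]
    exact ENNReal.ofReal_le_ofReal (orthonormal_characterL2.tsum_inner_products_le g)
  calc _ = (∑' k, ‖coeff f k‖ₑ ^ 2) ^ (1 / 2 : ℝ) := by simp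
    _ ≤ (‖g‖ₑ ^ 2) ^ (1 / 2 : ℝ) := ENNReal.rpow_le_rpow hs (by norm_num)
    _ = _ := by rw [← ENNReal.rpow_natCast, ← ENNReal.rpow_mul]; norm_num

/-! ### Differences of solutions -/

theorem SmoothOn.add {T : ℝ} {w w' : ℝ → Torus → ℝ} (hw : SmoothOn T w) (hw' : SmoothOn T w') :
    SmoothOn T (w + w') :=
  ContDiffOn.add hw hw'

theorem SmoothOn.sub {T : ℝ} {w w' : ℝ → Torus → ℝ} (hw : SmoothOn T w) (hw' : SmoothOn T w') :
    SmoothOn T (w - w') :=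
  ContDiffOn.sub hw hw'

theorem tsum_mul_self_sub {a b : ℤ × ℤ → ℂ} (ha : Summable a) (hb : Summable b) (k : ℤ × ℤ) :
    ∑' l, (a + b) l * (a - b) (k - l) = ∑' l, a l * a (k - l) - ∑' l, b l * b (k - l) := by
  have hcomm : ∑' l, a l * b (k - l) = ∑' l, b l * a (k - l) := by
    rw [← (Equiv.subLeft k).tsum_eq]
    refine tsum_congr fun l => ?_
    simp [mul_comm]
  have haa := summable_mul_comp_sub ha ha k
  have hab := summable_mul_comp_sub ha hb k
  have hba := summable_mul_comp_sub hb ha k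
  have hbb := summable_mul_comp_sub hb hb k
  calc _ = ∑' l, (a l * a (k - l) - a l * b (k - l) + (b l * a (k - l) - b l * b (k - l))) := by
        refine tsum_congr fun l => ?_
        simp only [Pi.add_apply, Pi.sub_apply]
        ring
    _ = _ := by
        rw [(haa.sub hab).tsum_add (hba.sub hbb), haa.tsum_sub hab, hba.tsum_sub hbb, hcomm]
        ring

theorem hasDerivAt_coeff_sub {T : ℝ} (hT : 0 < T) {u₁ u₂ : ℝ → Torus → ℝ}
    (h₁ : IsSmoothSolution T u₁) (h₂ : IsSmoothSolution T u₂) {t : ℝ} (ht : t ∈ Ioo 0 T)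
    (k : ℤ × ℤ) :
    HasDerivAt (fun t => coeff ((u₁ - u₂) t) k) (Complex.I * phase k * coeff ((u₁ - u₂) t) k +
      Complex.I * k.1 / 2 * ∑' l, coeff ((u₁ + u₂) t) l * coeff ((u₁ - u₂) t) (k - l)) t := by
  have hs : ∀ τ ∈ Icc 0 T, coeff ((u₁ - u₂) τ) = coeff (u₁ τ) - coeff (u₂ τ) := fun τ hτ =>
    funext (coeff_sub (h₁.smoothOn.continuous hτ) (h₂.smoothOn.continuous hτ))
  have ha : ∀ τ ∈ Icc 0 T, coeff ((u₁ + u₂) τ) = coeff (u₁ τ) + coeff (u₂ τ) := fun τ hτ =>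
    funext (coeff_add (h₁.smoothOn.continuous hτ) (h₂.smoothOn.continuous hτ))
  have ht' := Ioo_subset_Icc_self ht
  have h := (h₁.hasDerivAt_coeff hT ht k).sub (h₂.hasDerivAt_coeff hT ht k)
  refine (h.congr_of_eventuallyEq ?_).congr_deriv ?_
  · filter_upwards [Ioo_mem_nhds ht.1 ht.2] with τ hτ
    rw [hs τ (Ioo_subset_Icc_self hτ)]
    rfl
  · rw [hs t ht', ha t ht', tsum_mul_self_sub (summable_coeff hT h₁.smoothOn ht')
      (summable_coeff hT h₂.smoothOn ht'), Pi.sub_apply]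
    ring

/-! ### Energy estimates -/

theorem Enorm_sq (σ T : ℝ) (u : ℝ → Torus → ℝ) :
    Enorm σ T u ^ 2 = ∑' j, dyad (2 * σ) j * ⨆ t ∈ Icc 0 T, ‖proj j (u t)‖ₑ ^ 2 := by
  rw [Enorm, ← ENNReal.rpow_natCast, ← ENNReal.rpow_mul]
  norm_num [dyad]

/-- The time integrals of the cubic forms, summed over the dyadic indices. -/
def cubic (σ T : ℝ) (z v : ℝ → Torus → ℝ) : ℝ≥0∞ :=
  ∑' n, dyad (2 * σ) n * ∫⁻ τ in Ico 0 T, ‖theta n (coeff (z τ)) (coeff (v τ))‖ₑ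

theorem Enorm_sq_le {T : ℝ} (hT : 0 < T) {z v : ℝ → Torus → ℝ} (hz : SmoothOn T z)
    (hv : SmoothOn T v)
    (heq : ∀ t ∈ Ioo 0 T, ∀ k, HasDerivAt (fun t => coeff (v t) k)
      (Complex.I * phase k * coeff (v t) k +
        Complex.I * k.1 / 2 * ∑' l, coeff (z t) l * coeff (v t) (k - l)) t)
    {σ : ℝ} (hσ : 0 ≤ σ) :
    Enorm σ T v ^ 2 ≤ 3 * 2 ^ (2 * σ) * Hnorm σ (v 0) ^ 2 + cubic σ T z v := by
  rw [Enorm_sq, cubic]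
  refine (ENNReal.tsum_le_tsum fun n => mul_le_mul_right (enorm_proj_sq_le hT hz hv heq n) _).trans ?_
  simp_rw [mul_add, ENNReal.tsum_add]
  gcongr
  exact tsum_initial_le hσ (v 0)

theorem cubic_add_le (σ : ℝ) {T : ℝ} (hT : 0 < T) {z z' v : ℝ → Torus → ℝ} (hz : SmoothOn T z)
    (hz' : SmoothOn T z') (hv : SmoothOn T v) :
    cubic σ T (z + z') v ≤ cubic σ T z v + cubic σ T z' v := by
  rw [cubic, cubic, cubic, ← ENNReal.tsum_add]
  refine ENNReal.tsum_le_tsum fun n => ?_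
  rw [← mul_add]
  gcongr
  rw [← lintegral_add_left' (((continuousOn_theta hT hz hv n).mono
    Ico_subset_Icc_self).aemeasurable measurableSet_Ico).enorm]
  refine setLIntegral_mono' measurableSet_Ico fun τ hτ => ?_
  have hτ' := Ico_subset_Icc_self hτ
  have e : coeff ((z + z') τ) = coeff (z τ) + coeff (z' τ) :=
    funext (coeff_add (hz.continuous hτ') (hz'.continuous hτ'))
  rw [e, theta_add n (summable_coeff hT hz hτ') (summable_coeff hT hz' hτ')
    (summable_coeff hT hv hτ')]
  exact enorm_add_le _ _

theorem cubic_le {s σ : ℝ} (hs : 1 ≤ s) (hσ : 0 ≤ σ) {T : ℝ} (hT : 0 < T) (hT1 : T ≤ 1)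
    {z v : ℝ → Torus → ℝ} (hz : SmoothOn T z) (hv : SmoothOn T v) :
    cubic σ T z v ≤ cubicConst s σ * (Fnorm s T z * Fnorm σ T v ^ 2 +
      Fnorm 0 T v * Fnorm σ T v * Fnorm (σ + s) T z) := by
  classical
  exact (ENNReal.tsum_le_tsum fun n => mul_le_mul_right
    (lintegral_theta_half_le hT hT1 hz hv n) _).trans (tsum_half_le hs hσ T z v)

theorem cubic_self_le (s : ℝ) {σ : ℝ} (hσ : 0 ≤ σ) {T : ℝ} (hT : 0 < T) (hT1 : T ≤ 1)
    {v : ℝ → Torus → ℝ} (hv : SmoothOn T v) :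
    cubic σ T v v ≤ cubicConst s σ * (Fnorm s T v * Fnorm σ T v ^ 2) := by
  classical
  exact (ENNReal.tsum_le_tsum fun n => mul_le_mul_right
    (lintegral_theta_full_le hT hT1 hv n) _).trans (tsum_full_le s hσ T v)

theorem Enorm_sq_le_of_solution {s : ℝ} (hs : 0 ≤ s) {T : ℝ} (hT : 0 < T) (hT1 : T ≤ 1)
    {u : ℝ → Torus → ℝ} (hu : IsSmoothSolution T u) :
    Enorm s T u ^ 2 ≤ 3 * 2 ^ (2 * s) * Hnorm s (u 0) ^ 2 + cubicConst s s * Fnorm s T u ^ 3 := by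
  refine (Enorm_sq_le hT hu.smoothOn hu.smoothOn (fun t ht => hu.hasDerivAt_coeff hT ht) hs).trans ?_
  gcongr
  refine (cubic_self_le s hs hT hT1 hu.smoothOn).trans (le_of_eq ?_)
  ring

theorem Enorm_zero_sq_le_of_sub {s : ℝ} (hs : 1 ≤ s) {T : ℝ} (hT : 0 < T) (hT1 : T ≤ 1)
    {u₁ u₂ : ℝ → Torus → ℝ} (h₁ : IsSmoothSolution T u₁) (h₂ : IsSmoothSolution T u₂) :
    Enorm 0 T (u₁ - u₂) ^ 2 ≤ 3 * L2norm ((u₁ - u₂) 0) ^ 2 + 2 * cubicConst s 0 *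
      (Fnorm 0 T (u₁ - u₂) ^ 2 * (Fnorm s T u₁ + Fnorm s T u₂)) := by
  set v := u₁ - u₂ with hv
  have sv : SmoothOn T v := h₁.smoothOn.sub h₂.smoothOn
  calc _ ≤ _ := Enorm_sq_le hT (h₁.smoothOn.add h₂.smoothOn) sv
        (fun t ht => hasDerivAt_coeff_sub hT h₁ h₂ ht) le_rfl
    _ ≤ 3 * L2norm (v 0) ^ 2 + (cubic 0 T u₁ v + cubic 0 T u₂ v) := by
        rw [mul_zero, ENNReal.rpow_zero, mul_one]
        gcongr
        · exact Hnorm_zero_le_L2norm (sv.continuous ⟨le_rfl, hT.le⟩)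
        · exact cubic_add_le 0 hT h₁.smoothOn h₂.smoothOn sv
    _ ≤ 3 * L2norm (v 0) ^ 2 + (cubicConst s 0 * (Fnorm s T u₁ * Fnorm 0 T v ^ 2 +
          Fnorm 0 T v * Fnorm 0 T v * Fnorm (0 + s) T u₁) +
        cubicConst s 0 * (Fnorm s T u₂ * Fnorm 0 T v ^ 2 +
          Fnorm 0 T v * Fnorm 0 T v * Fnorm (0 + s) T u₂)) := by
        gcongr
        · exact cubic_le hs le_rfl hT hT1 h₁.smoothOn sv
        · exact cubic_le hs le_rfl hT hT1 h₂.smoothOn sv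
    _ = _ := by rw [zero_add]; ring

theorem Enorm_sq_le_of_sub {s : ℝ} (hs : 1 ≤ s) {T : ℝ} (hT : 0 < T) (hT1 : T ≤ 1)
    {u₁ u₂ : ℝ → Torus → ℝ} (h₁ : IsSmoothSolution T u₁) (h₂ : IsSmoothSolution T u₂) :
    Enorm s T (u₁ - u₂) ^ 2 ≤ 3 * 2 ^ (2 * s) * Hnorm s ((u₁ - u₂) 0) ^ 2 + 2 * cubicConst s s *
      (Fnorm s T (u₁ - u₂) ^ 3 + Fnorm s T (u₁ - u₂) ^ 2 * Fnorm s T u₂ +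
        Fnorm 0 T (u₁ - u₂) * Fnorm s T (u₁ - u₂) * Fnorm (2 * s) T u₂) := by
  set v := u₁ - u₂ with hv
  have hs0 : 0 ≤ s := zero_le_one.trans hs
  have sv : SmoothOn T v := h₁.smoothOn.sub h₂.smoothOn
  have s2 := h₂.smoothOn
  have hz : u₁ + u₂ = v + (u₂ + u₂) := by rw [hv]; abel
  have heq : ∀ t ∈ Ioo 0 T, ∀ k, HasDerivAt (fun t => coeff (v t) k)
      (Complex.I * phase k * coeff (v t) k +
        Complex.I * k.1 / 2 * ∑' l, coeff ((v + (u₂ + u₂)) t) l * coeff (v t) (k - l)) t := by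
    rw [← hz]
    exact fun t ht => hasDerivAt_coeff_sub hT h₁ h₂ ht
  have hself := cubic_self_le s hs0 hT hT1 sv
  have hmix := cubic_le hs hs0 hT hT1 s2 sv
  calc _ ≤ _ := Enorm_sq_le hT (sv.add (s2.add s2)) sv heq hs0
    _ ≤ 3 * 2 ^ (2 * s) * Hnorm s (v 0) ^ 2 +
        (cubic s T v v + (cubic s T u₂ v + cubic s T u₂ v)) := by
        gcongr
        exact (cubic_add_le s hT sv (s2.add s2) sv).trans
          (add_le_add_right (cubic_add_le s hT s2 s2 sv) _)
    _ ≤ 3 * 2 ^ (2 * s) * Hnorm s (v 0) ^ 2 +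
        (2 * (cubicConst s s * (Fnorm s T v * Fnorm s T v ^ 2)) +
        (cubicConst s s * (Fnorm s T u₂ * Fnorm s T v ^ 2 +
          Fnorm 0 T v * Fnorm s T v * Fnorm (s + s) T u₂) +
        cubicConst s s * (Fnorm s T u₂ * Fnorm s T v ^ 2 +
          Fnorm 0 T v * Fnorm s T v * Fnorm (s + s) T u₂))) := by
        gcongr
        rw [two_mul]
        exact hself.trans le_self_add
    _ = _ := by rw [two_mul s]; ring

end ZK

end

theorem mainTheorem8 (s : ℝ) (hs : 3 / 2 < s) :
    ∃ C : ℝ≥0, ∀ T : ℝ, 0 < T → T ≤ 1 →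
      (∀ u : ℝ → ZK.Torus → ℝ, ZK.IsSmoothSolution T u →
        ZK.Enorm s T u ^ 2 ≤ C * (ZK.Hnorm s (u 0) ^ 2 + ZK.Fnorm s T u ^ 3)) ∧
      (∀ u₁ u₂ v : ℝ → ZK.Torus → ℝ, ZK.IsSmoothSolution T u₁ → ZK.IsSmoothSolution T u₂ →
        v = u₁ - u₂ →
        ZK.Enorm 0 T v ^ 2 ≤ C * (ZK.L2norm (v 0) ^ 2
          + ZK.Fnorm 0 T v ^ 2 * (ZK.Fnorm s T u₁ + ZK.Fnorm s T u₂)) ∧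
        ZK.Enorm s T v ^ 2 ≤ C * (ZK.Hnorm s (v 0) ^ 2 + ZK.Fnorm s T v ^ 3
          + ZK.Fnorm s T v ^ 2 * ZK.Fnorm s T u₂
          + ZK.Fnorm 0 T v * ZK.Fnorm s T v * ZK.Fnorm (2 * s) T u₂)) := by
  have hs1 : 1 ≤ s := by linarith
  have hs0 : 0 ≤ s := by linarith
  have hc : ZK.cubicConst s s ≠ ⊤ := ZK.cubicConst_ne_top hs hs0
  have hc0 : ZK.cubicConst s 0 ≠ ⊤ := ZK.cubicConst_ne_top hs le_rfl
  have h2 : (2 : ℝ≥0∞) ^ (2 * s) ≠ ⊤ := ENNReal.rpow_ne_top_of_nonneg (by positivity) (by norm_num)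
  set K : ℝ≥0∞ := 3 * 2 ^ (2 * s) + 3 + 2 * ZK.cubicConst s s + 2 * ZK.cubicConst s 0 with hK
  have hKtop : K ≠ ⊤ := by rw [hK]; finiteness
  have k1 : 3 * 2 ^ (2 * s) ≤ K := by rw [hK, add_assoc, add_assoc]; exact le_self_add
  have k2 : 3 ≤ K := by
    rw [hK, add_assoc, add_assoc]; exact le_self_add.trans le_add_self
  have k3 : 2 * ZK.cubicConst s s ≤ K := le_add_self.trans le_self_add
  have k4 : 2 * ZK.cubicConst s 0 ≤ K := le_add_self
  have k5 : ZK.cubicConst s s ≤ K := (le_mul_of_one_le_left' one_le_two).trans k3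
  refine ⟨K.toNNReal, fun T hT hT1 => ?_⟩
  rw [ENNReal.coe_toNNReal hKtop]
  refine ⟨fun u hu => ?_, ?_⟩
  · exact (ZK.Enorm_sq_le_of_solution hs0 hT hT1 hu).trans
      ((add_le_add (mul_le_mul_left k1 _) (mul_le_mul_left k5 _)).trans (le_of_eq (by ring)))
  · rintro u₁ u₂ v h₁ h₂ rfl
    exact ⟨(ZK.Enorm_zero_sq_le_of_sub hs1 hT hT1 h₁ h₂).trans
        ((add_le_add (mul_le_mul_left k2 _) (mul_le_mul_left k4 _)).trans (le_of_eq (by ring))),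
      (ZK.Enorm_sq_le_of_sub hs1 hT hT1 h₁ h₂).trans
        ((add_le_add (mul_le_mul_left k1 _) (mul_le_mul_left k3 _)).trans (le_of_eq (by ring)))⟩
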